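/- Let $s\in(0,1)$, $N>2s$ and $p\in\left(2+\frac{2s}{N-2s},\frac{2N}{N-2s}\right)$. Let $V:\mathbb{R}^N\to[0,\infty)$ be continuous with $\liminf_{|x|\to\infty}V(x)|x|^{2s}>0$, and let $\Lambda\subset\mathbb{R}^N$ be a bounded open set with $0\in\Lambda$. Write $$[u]_s^2=\iint_{\mathbb{R}^{2N}}\frac{|u(x)-u(y)|^2}{|x-y|^{N+2s}}\,dx\,dy,\qquad (-\Delta)^su(x)=\mathrm{P.V.}\int_{\mathbb{R}^N}\frac{u(x)-u(y)}{|x-y|^{N+2s}}\,dy,$$ and, for $\varepsilon>0$, let $H^s_{V,\varepsilon}$ be the space of measurable $u:\mathbb{R}^N\to\mathbb{R}$ with $\|u\|_{V,\varepsilon}^2:=\varepsilon^{2s}[u]_s^2+\int_{\mathbb{R}^N}Vu^2\,dx<\infty$. Then there are constants $\sigma>0$, $t\in\left(2s,(N-2s)(p-2)\right)$ and $\tau\in(0,1)$ such that the penalization potentials $$P_\varepsilon(x)=\frac{\varepsilon^\sigma}{|x|^t}\,\chi_{\mathbb{R}^N\setminus\Lambda}(x)$$ have the following properties. 1. For all sufficiently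 small $\varepsilon>0$: - $(P_1)$ the space $H^s_{V,\varepsilon}$ is compactly embedded in $L^2\left(\mathbb{R}^N,(P_\varepsilon+\chi_\Lambda)\,dx\right)$; - $(P_2)$ $\int_{\mathbb{R}^N}P_\varepsilon\varphi^2\,dx\le\tau\|\varphi\|_{V,\varepsilon}^2$ for all $\varphi\in H^s_{V,\varepsilon}$. 2. Let $\delta\in(0,1)$, $R>0$ and $C_\infty>0$, and let $x_\varepsilon\in\Lambda$ (for small $\varepsilon>0$) be points with $\liminf_{\varepsilon\to0}\operatorname{dist}(x_\varepsilon,\partial\Lambda)>0$. Then for all sufficiently small $\varepsilon>0$ there is a function $\overline U_\varepsilon\in H^s_{V,\varepsilon}$ of class $C^{1,1}$ on $\mathbb{R}^N$ (that is, $C^1$ with locally Lipschitz gradient) with $\overline U_\varepsilon>0$ on $\mathbb{R}^N$ such that at every point of $\mathbb{R}^N\setminus B_{R\varepsilon}(x_\varepsilon)$ the value $(-\Delta)^s\overline U_\varepsilon$ exists, and $$\begin{cases}\varepsilon^{2s}(-\Delta)^s\overline U_\varepsilon+(1-\delta)V\overline U_\varepsilon\ \ge\ P_\varepsilon\overline U_\varepsilon&\text{in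 }\mathbb{R}^N\setminus B_{R\varepsilon}(x_\varepsilon),\\ \overline U_\varepsilon\ \ge\ C_\infty&\text{in }B_{R\varepsilon}(x_\varepsilon),\end{cases}$$ and moreover $\overline U_\varepsilon^{\,p-2}<P_\varepsilon$ in $\mathbb{R}^N\setminus\Lambda$. If in addition $\int_{\mathbb{R}^N}V(x)(1+|x|)^{-2\mu}\,dx<\infty$ for some $\mu<N-2s$ (for instance, if $V(x)|x|^{2s}$ is bounded for large $|x|$), then $\overline U_\varepsilon$ can be taken such that also $\overline U_\varepsilon$ and $\nabla\overline U_\varepsilon$ are bounded and $\nabla\overline U_\varepsilon$ is globally Lipschitz. -/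

import Mathlib

open Filter Topology MeasureTheory Set
open scoped ENNReal

noncomputable section

namespace FracSchrodinger

variable {N : ℕ}

/-- The Gagliardo energy `∫∫ |u(x) - u(y)|² / |x - y|^(N + 2s) dx dy`, which is the meaning of
`∫ |(-Δ)^(s/2) u|² dx`. -/
def gagliardo (s : ℝ) (u : EuclideanSpace ℝ (Fin N) → ℝ) : ℝ≥0∞ :=
  ∫⁻ z : EuclideanSpace ℝ (Fin N) × EuclideanSpace ℝ (Fin N),
    ENNReal.ofReal ((u z.1 - u z.2) ^ 2 / ‖z.1 - z.2‖ ^ ((N : ℝ) + 2 * s))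

/-- The square of the norm of `L²(ℝ^N, w(x) dx)`, for a weight `w ≥ 0`. -/
def weightedSq (w u : EuclideanSpace ℝ (Fin N) → ℝ) : ℝ≥0∞ :=
  ∫⁻ x, ENNReal.ofReal (w x * u x ^ 2)

/-- Membership in the weighted fractional Sobolev space `H^s_{V,ε}(ℝ^N)`. For `ε > 0` the set does
not depend on `ε`; only its norm does. -/
def MemHsV (s : ℝ) (V u : EuclideanSpace ℝ (Fin N) → ℝ) : Prop :=
  AEStronglyMeasurable u volume ∧ gagliardo s u < ∞ ∧ weightedSq V u < ∞

/-- The square of the norm of `H^s_{V,ε}(ℝ^N)`: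
`∫ ε^(2s) |(-Δ)^(s/2) u|² + V u² dx`. -/
def normSqHsV (ε s : ℝ) (V u : EuclideanSpace ℝ (Fin N) → ℝ) : ℝ≥0∞ :=
  ENNReal.ofReal (ε ^ (2 * s)) * gagliardo s u + weightedSq V u

/-- `H^s_{V,ε}(ℝ^N)` is contained in `L²(ℝ^N, w(x) dx)`, and the inclusion is compact: every
sequence bounded in `H^s_{V,ε}` has a subsequence that converges in `L²(ℝ^N, w(x) dx)`. -/
def CompactlyEmbedded (ε s : ℝ) (V w : EuclideanSpace ℝ (Fin N) → ℝ) : Prop :=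
  (∀ u : EuclideanSpace ℝ (Fin N) → ℝ, MemHsV s V u → weightedSq w u < ∞) ∧
  ∀ u : ℕ → EuclideanSpace ℝ (Fin N) → ℝ, (∀ n, MemHsV s V (u n)) →
    (∃ C : ℝ, ∀ n, normSqHsV ε s V (u n) ≤ ENNReal.ofReal C) →
    ∃ v : EuclideanSpace ℝ (Fin N) → ℝ,
      AEStronglyMeasurable v volume ∧ weightedSq w v < ∞ ∧
      ∃ φ : ℕ → ℕ, StrictMono φ ∧
        Tendsto (fun n => weightedSq w (fun x => u (φ n) x - v x)) atTop (𝓝 0)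

/-- Condition (P₁) on a penalization potential `P`: the embedding of `H^s_{V,ε}(ℝ^N)` in
`L²(ℝ^N, (P + χ_Λ) dx)` is compact. -/
def CondP1 (ε s : ℝ) (V : EuclideanSpace ℝ (Fin N) → ℝ) (Λ : Set (EuclideanSpace ℝ (Fin N)))
    (P : EuclideanSpace ℝ (Fin N) → ℝ) : Prop :=
  CompactlyEmbedded ε s V (fun x => P x + Λ.indicator (fun _ => (1 : ℝ)) x)

/-- The inequality of condition (P₂) on a penalization potential `P`, with the constant `τ`:
`∫ P φ² ≤ τ ∫ ε^(2s) |(-Δ)^(s/2) φ|² + V φ²` for all `φ` in `H^s_{V,ε}(ℝ^N)`. -/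
def CondP2 (ε s τ : ℝ) (V P : EuclideanSpace ℝ (Fin N) → ℝ) : Prop :=
  ∀ φ : EuclideanSpace ℝ (Fin N) → ℝ, MemHsV s V φ →
    weightedSq P φ ≤ ENNReal.ofReal τ * normSqHsV ε s V φ

/-- The penalization potential `P_ε(x) = ε^σ |x|^(-t) χ_{ℝ^N \ Λ}(x)`. -/
def penalization (Λ : Set (EuclideanSpace ℝ (Fin N))) (σ t ε : ℝ) :
    EuclideanSpace ℝ (Fin N) → ℝ :=
  Λᶜ.indicator (fun x => ε ^ σ / ‖x‖ ^ t)

/-- `HasFracLaplacian s u x ℓ`: the fractional Laplacian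
`(-Δ)^s u (x) = P.V. ∫ (u(x) - u(y)) / |x - y|^(N + 2s) dy` exists at the point `x` and equals `ℓ`
(without a normalizing constant in front of the integral). -/
def HasFracLaplacian (s : ℝ) (u : EuclideanSpace ℝ (Fin N) → ℝ) (x : EuclideanSpace ℝ (Fin N))
    (ℓ : ℝ) : Prop :=
  (∀ r > 0, IntegrableOn (fun y => (u x - u y) / ‖x - y‖ ^ ((N : ℝ) + 2 * s))
    (Metric.ball x r)ᶜ volume) ∧
  Tendsto (fun r : ℝ => ∫ y in (Metric.ball x r)ᶜ, (u x - u y) / ‖x - y‖ ^ ((N : ℝ) + 2 * s))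
    (𝓝[>] 0) (𝓝 ℓ)

/-- `u` is of class `C^{1,1}` on `ℝ^N`: it is `C¹` with a locally Lipschitz derivative. -/
def IsC11 (u : EuclideanSpace ℝ (Fin N) → ℝ) : Prop :=
  ContDiff ℝ 1 u ∧ LocallyLipschitz (fderiv ℝ u)

/-- `u` is of class `C^{1,1}` on `ℝ^N` with uniform bounds: `u` and its derivative are bounded, and
the derivative is globally Lipschitz. -/
def IsUniformC11 (u : EuclideanSpace ℝ (Fin N) → ℝ) : Prop :=
  ContDiff ℝ 1 u ∧ (∃ C : ℝ, ∀ x, |u x| ≤ C ∧ ‖fderiv ℝ u x‖ ≤ C) ∧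
    ∃ K : NNReal, LipschitzWith K (fderiv ℝ u)

end FracSchrodinger

end

/-!
# Penalization potentials and barrier functions for the fractional Schrödinger equation

Put `γ = N - 2s`. The hypothesis on `p` says that `2s < γ (p - 2)`. The proof takes `σ = t` strictly
between these two numbers and `τ = 1 / 2`, so that off `Λ` the penalization is `(|x| / ε)^(-t)`.

**The embedding.** At infinity `V` is at least a multiple of `|x|^(-2s)`, hence the weight
`P_ε + χ_Λ`, which decays like `|x|^(-t)` with `t > 2s`, is negligible there with respect to `V`. On
bounded sets the `L²` norm is controlled by the energy, since `u(x)` can be compared with `u(y)` for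
`y` in an annulus where `V` is bounded below (`exists_poincare`), and functions of bounded energy are
uniformly approximated by step functions of finitely many parameters (`exists_step_approx`). So
bounded sets of the weighted space are totally bounded in `L²` of the weight
(`compactlyEmbedded_of_tail`), and the same two regions yield the inequality with `τ`, because
`ε^σ` is small compared with `ε^(2s)` (`eventually_condP2_penalization`).

**The barrier.** The barrier is `M U((x - x_ε) / ε)`, where `U` is at most of order
`(1 + |z|)^(-α)`, and exactly of this order on the ball of radius `R`, with `γ / 2 < α < γ` and
`t < α (p - 2)`, and `(-Δ)^s U + a V(x_ε + ε ·) U ≥ κ (1 + |z|)^(-2s) U` with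
`a = 1 - δ`. Off `Λ` the quotients `|x - x_ε| / ε` and `|x| / ε` are comparable and uniformly large;
therefore `P_ε = (|x| / ε)^(-t)` is below the right-hand side as `t > 2s`, and above the power `p - 2`
of the barrier as `t < α (p - 2)` (`eventually_exists_barrier`).

A first candidate for `U` is the mollified Riesz potential `w` of `(1 + |z|)^(-α - 2s)`, for which
`(-Δ)^s w` is a multiple of its density (`hasFracLaplacian_riesz`, `exists_base`). The latter fact is
proved by writing the kernels `|z|^(2s - N)` and `|z|^(-N - 2s)` as mixtures of Gaussians and using
the semigroup property. This choice is sufficient if `∫ V (1 + |x|)^(-2μ)` is finite for some `μ < γ`,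
as one may take `α ≥ μ`. In general, `V` may be so large that `w` does not have finite `V`-energy, and
`w` must be reduced where `V` is large, without losing the supersolution property. This uses `V`
itself:

* On the annulus `ρ ≤ |z| ≤ B ρ` one solves `(-Δ)^s v + a V χ v = (-Δ)^s w`, with a cutoff `χ` of
  the annulus, by the method of continuity and the maximum principle (`potential_sub_le`,
  `exists_absorption_solution`). As `(-Δ)^s (w - v) = a V χ v` has potential at most `w`, its total
  mass is at most of order `(B ρ)^(γ - α)`. This bounds `∫ V v²` over the annulus and the energy of
  `w - v` by a multiple of `ρ^(γ - 2α)`, irrespective of the size of `V`, and it shows that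
  `w - v ≤ w / 2` away from the annulus. A mollification makes `v` smooth
  (`IsPowerPotential.exists_annulus_supersolution`).
* These functions `v_k`, for the annuli of radii `ρ₀ B^k`, are glued with `w` by smooth concave
  functions that are homogeneous of degree one, in place of the minimum (`capMin`, `exists_glue`). At
  each point the glued function has a supporting combination of `w` and at most two of the `v_k`, with
  bounded nonnegative coefficients. Evaluating the fractional Laplacians of these combinations gives
  the supersolution estimate, and comparing increments gives the finiteness of the energy, as
  `∑ (ρ₀ B^k)^(γ - 2α)` converges (`IsPowerPotential.exists_supersolution`).
-/

noncomputable section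

namespace FracSchrodinger

variable {N : ℕ}

/-! ### Powers of the norm, and the principal value of a smooth function -/

theorem nontrivial_euclidean (hN : 0 < N) : Nontrivial (EuclideanSpace ℝ (Fin N)) :=
  Module.nontrivial_of_finrank_pos (R := ℝ) (by simpa using hN)

theorem integrableOn_ball_norm_rpow (hN : 0 < N) {a : ℝ} (ha : a < N) (r : ℝ) :
    IntegrableOn (fun y : EuclideanSpace ℝ (Fin N) => ‖y‖ ^ (-a)) (Metric.ball 0 r) := by
  have := nontrivial_euclidean hN
  rw [integrableOn_fun_norm_addHaar volume (f := fun t : ℝ => t ^ (-a))]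
  rcases le_or_gt r 0 with hr | hr
  · simp [Ioo_eq_empty_of_le hr]
  have h : IntegrableOn (fun t : ℝ => t ^ ((N : ℝ) - 1 - a)) (Ioo 0 r) :=
    (intervalIntegral.integrableOn_Ioo_rpow_iff hr).2 (by linarith)
  refine h.congr_fun (fun t ht => ?_) measurableSet_Ioo
  have ht0 : 0 < t := ht.1
  simp only [finrank_euclideanSpace, Fintype.card_fin, smul_eq_mul]
  rw [← Real.rpow_natCast, ← Real.rpow_add ht0, Nat.cast_sub hN]
  simp [sub_eq_add_neg]

theorem integrableOn_compl_ball_norm_rpow (hN : 0 < N) {a : ℝ} (ha : N < a) {r : ℝ} (hr : 0 < r) :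
    IntegrableOn (fun y : EuclideanSpace ℝ (Fin N) => ‖y‖ ^ (-a)) (Metric.ball 0 r)ᶜ := by
  have := nontrivial_euclidean hN
  have key : Integrable (fun y : EuclideanSpace ℝ (Fin N) =>
      (fun t : ℝ => (Ici r).indicator (fun t => t ^ (-a)) t) ‖y‖) volume := by
    rw [integrable_fun_norm_addHaar volume]
    have h : IntegrableOn (fun t : ℝ => t ^ ((N : ℝ) - 1 - a)) (Ioi (r / 2)) :=
      (integrableOn_Ioi_rpow_iff (half_pos hr)).2 (by linarith)
    have h2 : IntegrableOn (fun t : ℝ => (Ici r).indicator (fun t => t ^ ((N : ℝ) - 1 - a)) t)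
        (Ioi (r / 2)) := h.indicator measurableSet_Ici
    have h3 : Integrable (fun t : ℝ => (Ici r).indicator (fun t => t ^ ((N : ℝ) - 1 - a)) t) := by
      rw [← integrableOn_iff_integrable_of_support_subset (s := Ioi (r / 2))]
      · exact h2
      · intro t ht
        have : t ∈ Ici r := by
          by_contra hc
          exact ht (indicator_of_notMem hc _)
        exact lt_of_lt_of_le (half_lt_self hr) this
    refine (h3.integrableOn (s := Ioi 0)).congr_fun (fun t ht => ?_) measurableSet_Ioi
    have ht0 : 0 < t := ht
    simp only [finrank_euclideanSpace, Fintype.card_fin, smul_eq_mul, indicator]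
    split_ifs with h
    · rw [← Real.rpow_natCast, ← Real.rpow_add ht0, Nat.cast_sub hN]
      simp [sub_eq_add_neg]
    · simp
  rw [← integrable_indicator_iff Metric.isOpen_ball.measurableSet.compl]
  refine key.congr (Eventually.of_forall fun y => ?_)
  simp [indicator]

/-- The second difference `2 u(x) - u(x + y) - u(x - y)`. -/
def secondDiff (u : EuclideanSpace ℝ (Fin N) → ℝ) (x y : EuclideanSpace ℝ (Fin N)) : ℝ :=
  2 * u x - u (x + y) - u (x - y)

section PV

variable {s : ℝ} {u : EuclideanSpace ℝ (Fin N) → ℝ}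

theorem integrableOn_diffQuot (hs : 0 < s) (hN : 0 < N) (hu : Continuous u) {M : ℝ}
    (hM : ∀ x, |u x| ≤ M) (x : EuclideanSpace ℝ (Fin N)) {r : ℝ} (hr : 0 < r) :
    IntegrableOn (fun y => (u x - u y) / ‖x - y‖ ^ ((N : ℝ) + 2 * s)) (Metric.ball x r)ᶜ volume := by
  have h1 := (integrableOn_compl_ball_norm_rpow hN (a := (N : ℝ) + 2 * s) (by linarith) hr)
  rw [← integrable_indicator_iff Metric.isOpen_ball.measurableSet.compl] at h1 ⊢
  have h2 := (h1.comp_sub_left x).const_mul (2 * M)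
  refine h2.mono' ?_ (Eventually.of_forall fun y => ?_)
  · refine (Measurable.indicator ?_ Metric.isOpen_ball.measurableSet.compl).aestronglyMeasurable
    fun_prop
  · have hM0 : 0 ≤ M := (abs_nonneg _).trans (hM x)
    by_cases hy : y ∈ Metric.ball x r
    · rw [indicator_of_notMem (by simpa using hy)]
      simp only [norm_zero]
      refine mul_nonneg (by positivity) (indicator_nonneg (fun z _ => by positivity) _)
    · rw [indicator_of_mem (by simpa using hy), indicator_of_mem]
      · rw [norm_div, Real.rpow_neg (norm_nonneg _),
          Real.norm_of_nonneg (by positivity : 0 ≤ ‖x - y‖ ^ ((N : ℝ) + 2 * s)), div_eq_mul_inv]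
        gcongr
        rw [Real.norm_eq_abs]
        have := abs_sub (u x) (u y)
        linarith [hM x, hM y]
      · simpa [dist_eq_norm, norm_sub_rev] using hy

theorem setIntegral_compl_ball_eq_secondDiff (hs : 0 < s) (hN : 0 < N) (hu : Continuous u) {M : ℝ}
    (hM : ∀ x, |u x| ≤ M) (x : EuclideanSpace ℝ (Fin N)) {r : ℝ} (hr : 0 < r) :
    ∫ y in (Metric.ball x r)ᶜ, (u x - u y) / ‖x - y‖ ^ ((N : ℝ) + 2 * s) =
      1 / 2 * ∫ y in (Metric.ball 0 r)ᶜ, secondDiff u x y / ‖y‖ ^ ((N : ℝ) + 2 * s) := by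
  have hm : MeasurableSet (Metric.ball x r)ᶜ := Metric.isOpen_ball.measurableSet.compl
  have hm0 : MeasurableSet (Metric.ball (0 : EuclideanSpace ℝ (Fin N)) r)ᶜ :=
    Metric.isOpen_ball.measurableSet.compl
  have hI := integrableOn_diffQuot hs hN hu hM x hr
  rw [← integrable_indicator_iff hm] at hI
  rw [← integral_indicator hm, ← integral_indicator hm0]
  set F := (Metric.ball x r)ᶜ.indicator (fun y => (u x - u y) / ‖x - y‖ ^ ((N : ℝ) + 2 * s)) with hF
  have e1 : ∫ y, F (x + y) = ∫ y, F y := integral_add_left_eq_self F x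
  have e2 : ∫ y, F (x - y) = ∫ y, F y := integral_sub_left_eq_self F volume x
  have i1 : Integrable (fun y => F (x + y)) := hI.comp_add_left x
  have i2 : Integrable (fun y => F (x - y)) := hI.comp_sub_left x
  have e3 : ∫ y, (F (x + y) + F (x - y)) = 2 * ∫ y, F y := by
    rw [integral_add i1 i2, e1, e2]; ring
  have e4 : (fun y => F (x + y) + F (x - y)) = (Metric.ball (0 : EuclideanSpace ℝ (Fin N)) r)ᶜ.indicator
      (fun y => secondDiff u x y / ‖y‖ ^ ((N : ℝ) + 2 * s)) := by
    funext y
    simp only [hF, indicator, mem_compl_iff, Metric.mem_ball, dist_self_add_left, dist_self_sub_left,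
      dist_zero_right, sub_add_cancel_left, norm_neg, sub_sub_cancel, secondDiff]
    split_ifs
    · ring
    · ring
  rw [← e4, e3]; ring

theorem hasFracLaplacian_of_integrable (hs : 0 < s) (hN : 0 < N) (hu : Continuous u) {M : ℝ}
    (hM : ∀ x, |u x| ≤ M) (x : EuclideanSpace ℝ (Fin N))
    (hI : Integrable (fun y => secondDiff u x y / ‖y‖ ^ ((N : ℝ) + 2 * s))) :
    HasFracLaplacian s u x (1 / 2 * ∫ y, secondDiff u x y / ‖y‖ ^ ((N : ℝ) + 2 * s)) := by
  have := nontrivial_euclidean hN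
  refine ⟨fun r hr => integrableOn_diffQuot hs hN hu hM x hr, ?_⟩
  have hm0 : ∀ r : ℝ, MeasurableSet (Metric.ball (0 : EuclideanSpace ℝ (Fin N)) r)ᶜ := fun r =>
    Metric.isOpen_ball.measurableSet.compl
  have key : Tendsto (fun r : ℝ => ∫ y in (Metric.ball 0 r)ᶜ,
      secondDiff u x y / ‖y‖ ^ ((N : ℝ) + 2 * s)) (𝓝[>] 0)
      (𝓝 (∫ y, secondDiff u x y / ‖y‖ ^ ((N : ℝ) + 2 * s))) := by
    have hi := fun r => integral_indicator (μ := volume)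
      (f := fun y => secondDiff u x y / ‖y‖ ^ ((N : ℝ) + 2 * s)) (hm0 r)
    simp_rw [← hi]
    refine tendsto_integral_filter_of_dominated_convergence _
      (Eventually.of_forall fun r => hI.aestronglyMeasurable.indicator (hm0 r))
      (Eventually.of_forall fun r => Eventually.of_forall fun y => norm_indicator_le_norm_self _ _)
      hI.norm ?_
    have h0 : ∀ᵐ y : EuclideanSpace ℝ (Fin N), y ≠ 0 := by
      simp [ae_iff]
    filter_upwards [h0] with y hy
    refine tendsto_const_nhds.congr' ?_
    have : ∀ᶠ r : ℝ in 𝓝[>] 0, r < ‖y‖ :=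
      (Iio_mem_nhds (norm_pos_iff.2 hy)) |> mem_nhdsWithin_of_mem_nhds
    filter_upwards [this] with r hr
    rw [indicator_of_mem]
    simpa using hr.le
  refine (key.const_mul (1 / 2)).congr' ?_
  filter_upwards [self_mem_nhdsWithin] with r hr
  exact (setIntegral_compl_ball_eq_secondDiff hs hN hu hM x hr).symm

/-- On a compact set, the second differences of a bounded `C²` function, divided by
`|y|^(N + 2s)`, have a common integrable majorant. -/
theorem exists_integrable_majorant_secondDiff (hs : s ∈ Ioo (0 : ℝ) 1) (hN : 0 < N)
    (hu : ContDiff ℝ 2 u) {M : ℝ} (hM : ∀ x, |u x| ≤ M) (ρ : ℝ) :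
    ∃ d : EuclideanSpace ℝ (Fin N) → ℝ, Integrable d ∧ (∀ y, 0 ≤ d y) ∧
      ∀ x ∈ Metric.closedBall (0 : EuclideanSpace ℝ (Fin N)) ρ, ∀ y,
        |secondDiff u x y / ‖y‖ ^ ((N : ℝ) + 2 * s)| ≤ d y := by
  -- the derivative is Lipschitz on a slightly larger ball
  obtain ⟨K, hK⟩ : ∃ K : NNReal, LipschitzOnWith K (fderiv ℝ u)
      (Metric.closedBall (0 : EuclideanSpace ℝ (Fin N)) (ρ + 1)) := by
    have h1 : ContDiff ℝ 1 (fderiv ℝ u) := hu.fderiv_right (by norm_num)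
    have hc : Continuous (fun x => ‖fderiv ℝ (fderiv ℝ u) x‖₊) :=
      (h1.continuous_fderiv (by norm_num)).nnnorm
    obtain ⟨K, hK⟩ := (isCompact_closedBall (0 : EuclideanSpace ℝ (Fin N)) (ρ + 1)).bddAbove_image
      hc.continuousOn
    refine ⟨K, (convex_closedBall _ _).lipschitzOnWith_of_nnnorm_fderiv_le
      (fun x _ => (h1.differentiable (by norm_num)) x) fun x hx => hK ⟨x, hx, rfl⟩⟩
  have hM0 : 0 ≤ M := (abs_nonneg _).trans (hM 0)
  have hdiff : Differentiable ℝ u := hu.differentiable (by norm_num)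
  have small : ∀ x ∈ Metric.closedBall (0 : EuclideanSpace ℝ (Fin N)) ρ, ∀ y, ‖y‖ < 1 →
      |secondDiff u x y| ≤ 2 * K * ‖y‖ ^ 2 := by
    intro x hx y hy
    have hmem : ∀ t ∈ Icc (0 : ℝ) 1, ∀ e : ℝ, |e| ≤ 1 →
        x + (e * t) • y ∈ Metric.closedBall (0 : EuclideanSpace ℝ (Fin N)) (ρ + 1) := by
      intro t ht e he
      rw [mem_closedBall_zero_iff] at hx ⊢
      have h3 : ‖(e * t) • y‖ ≤ 1 := by
        rw [norm_smul, Real.norm_eq_abs, abs_mul, abs_of_nonneg ht.1]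
        calc |e| * t * ‖y‖ ≤ 1 * 1 * 1 := by
              gcongr
              exacts [ht.1, ht.2]
          _ = 1 := by norm_num
      exact (norm_add_le _ _).trans (add_le_add hx h3)
    let g : ℝ → ℝ := fun t => u (x + t • y) + u (x - t • y)
    have hg : ∀ t, HasDerivAt g (fderiv ℝ u (x + t • y) y - fderiv ℝ u (x - t • y) y) t := by
      intro t
      have a1 : HasDerivAt (fun t : ℝ => x + t • y) y t := by
        simpa using ((hasDerivAt_id t).smul_const y).const_add x
      have a2 : HasDerivAt (fun t : ℝ => x - t • y) (-y) t := by
        simpa using ((hasDerivAt_id t).smul_const y).const_sub x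
      have b1 := (hdiff (x + t • y)).hasFDerivAt.comp_hasDerivAt t a1
      have b2 := (hdiff (x - t • y)).hasFDerivAt.comp_hasDerivAt t a2
      have := b1.add b2
      rw [map_neg, ← sub_eq_add_neg] at this
      exact this
    have hbd : ∀ t ∈ Ico (0 : ℝ) 1,
        ‖fderiv ℝ u (x + t • y) y - fderiv ℝ u (x - t • y) y‖ ≤ 2 * K * ‖y‖ ^ 2 := by
      intro t ht
      have ht' : t ∈ Icc (0 : ℝ) 1 := ⟨ht.1, ht.2.le⟩
      have m1 : x + t • y ∈ Metric.closedBall (0 : EuclideanSpace ℝ (Fin N)) (ρ + 1) := by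
        simpa using hmem t ht' 1 (by simp)
      have m2 : x - t • y ∈ Metric.closedBall (0 : EuclideanSpace ℝ (Fin N)) (ρ + 1) := by
        simpa [sub_eq_add_neg] using hmem t ht' (-1) (by simp)
      have h5 := hK.dist_le_mul _ m1 _ m2
      rw [dist_eq_norm, dist_eq_norm] at h5
      rw [← sub_apply]
      have h6 : ‖x + t • y - (x - t • y)‖ ≤ 2 * ‖y‖ := by
        have : x + t • y - (x - t • y) = (2 * t) • y := by module
        rw [this, norm_smul, Real.norm_eq_abs, abs_of_nonneg (by linarith [ht.1])]
        gcongr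
        linarith [ht.2]
      calc ‖(fderiv ℝ u (x + t • y) - fderiv ℝ u (x - t • y)) y‖
          ≤ ‖fderiv ℝ u (x + t • y) - fderiv ℝ u (x - t • y)‖ * ‖y‖ :=
            ContinuousLinearMap.le_opNorm _ _
        _ ≤ (K * (2 * ‖y‖)) * ‖y‖ := by gcongr; exact h5.trans (by gcongr)
        _ = 2 * K * ‖y‖ ^ 2 := by ring
    have := norm_image_sub_le_of_norm_deriv_le_segment' (f := g)
      (fun t _ => (hg t).hasDerivWithinAt) hbd 1 (by simp)
    simp only [g, one_smul, zero_smul, add_zero, sub_zero, mul_one] at this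
    rw [secondDiff, show 2 * u x - u (x + y) - u (x - y) = -(u (x + y) + u (x - y) - (u x + u x)) by
      ring, abs_neg]
    exact this
  -- near the origin the quotient is at most `|y|^(2 - N - 2s)`, far away at most `|y|^(-N - 2s)`
  refine ⟨fun y => (Metric.ball (0 : EuclideanSpace ℝ (Fin N)) 1).indicator
      (fun y => 2 * K * ‖y‖ ^ (-((N : ℝ) + 2 * s - 2))) y +
      (Metric.ball (0 : EuclideanSpace ℝ (Fin N)) 1)ᶜ.indicator
        (fun y => 4 * M * ‖y‖ ^ (-((N : ℝ) + 2 * s))) y, ?_, ?_, ?_⟩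
  · refine Integrable.add ?_ ?_
    · rw [integrable_indicator_iff Metric.isOpen_ball.measurableSet]
      exact (integrableOn_ball_norm_rpow hN (by linarith [hs.2]) 1).const_mul _
    · rw [integrable_indicator_iff Metric.isOpen_ball.measurableSet.compl]
      exact (integrableOn_compl_ball_norm_rpow hN (by linarith [hs.1]) one_pos).const_mul _
  · intro y
    refine add_nonneg (indicator_nonneg (fun z _ => by positivity) _)
      (indicator_nonneg (fun z _ => by positivity) _)
  · intro x hx y
    beta_reduce
    rw [abs_div, abs_of_nonneg (by positivity : 0 ≤ ‖y‖ ^ ((N : ℝ) + 2 * s))]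
    by_cases hy : y ∈ Metric.ball (0 : EuclideanSpace ℝ (Fin N)) 1
    · rw [indicator_of_mem hy, indicator_of_notMem (by simpa using hy), add_zero]
      rcases eq_or_ne y 0 with rfl | hy0
      · simp [secondDiff]
        have : 2 * u x - u x - u x = 0 := by ring
        rw [this]; simp; positivity
      have hy1 : 0 < ‖y‖ := norm_pos_iff.2 hy0
      rw [div_le_iff₀ (by positivity), mul_assoc, ← Real.rpow_add hy1]
      have : -((N : ℝ) + 2 * s - 2) + (N + 2 * s) = (2 : ℕ) := by push_cast; ring
      rw [this, Real.rpow_natCast]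
      exact small x hx y (by simpa using hy)
    · rw [indicator_of_notMem hy, indicator_of_mem (by simpa using hy), zero_add,
        Real.rpow_neg (norm_nonneg _), ← div_eq_mul_inv]
      gcongr
      have a := abs_le.1 (hM x)
      have b := abs_le.1 (hM (x + y))
      have c := abs_le.1 (hM (x - y))
      rw [secondDiff, abs_le]
      constructor <;> linarith [a.1, a.2, b.1, b.2, c.1, c.2]

theorem integrable_secondDiff (hs : s ∈ Ioo (0 : ℝ) 1) (hN : 0 < N)
    (hu : ContDiff ℝ 2 u) {M : ℝ} (hM : ∀ x, |u x| ≤ M) (x : EuclideanSpace ℝ (Fin N)) :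
    Integrable (fun y => secondDiff u x y / ‖y‖ ^ ((N : ℝ) + 2 * s)) := by
  obtain ⟨d, hd, -, h⟩ := exists_integrable_majorant_secondDiff hs hN hu hM ‖x‖
  refine hd.mono' ?_ (Eventually.of_forall fun y => h x (by simp) y)
  have := hu.continuous
  unfold secondDiff
  refine Measurable.aestronglyMeasurable ?_
  fun_prop

theorem hasFracLaplacian_of_contDiff (hs : s ∈ Ioo (0 : ℝ) 1) (hN : 0 < N)
    (hu : ContDiff ℝ 2 u) {M : ℝ} (hM : ∀ x, |u x| ≤ M) (x : EuclideanSpace ℝ (Fin N)) :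
    HasFracLaplacian s u x (1 / 2 * ∫ y, secondDiff u x y / ‖y‖ ^ ((N : ℝ) + 2 * s)) :=
  hasFracLaplacian_of_integrable hs.1 hN hu.continuous hM x (integrable_secondDiff hs hN hu hM x)

end PV

end FracSchrodinger

end

noncomputable section

namespace FracSchrodinger

variable {N : ℕ}

/-! ### Gaussian kernels -/

/-- The Gaussian probability density `(π t)^(-N/2) exp(-|z|²/t)`; these densities form a convolution
semigroup in `t`. -/
def heat (N : ℕ) (t : ℝ) (z : EuclideanSpace ℝ (Fin N)) : ℝ :=
  (Real.pi * t) ^ (-(N / 2 : ℝ)) * Real.exp (-(‖z‖ ^ 2 / t))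

theorem heat_nonneg {t : ℝ} (ht : 0 ≤ t) (z : EuclideanSpace ℝ (Fin N)) : 0 ≤ heat N t z := by
  unfold heat; positivity

theorem heat_neg (t : ℝ) (z : EuclideanSpace ℝ (Fin N)) : heat N t (-z) = heat N t z := by
  simp [heat]

theorem measurable_heat : Measurable fun p : ℝ × EuclideanSpace ℝ (Fin N) => heat N p.1 p.2 := by
  unfold heat; fun_prop

theorem measurable_heat_right (t : ℝ) : Measurable (heat N t) := by
  unfold heat; fun_prop

theorem lintegral_heat {t : ℝ} (ht : 0 < t) :
    ∫⁻ z : EuclideanSpace ℝ (Fin N), ENNReal.ofReal (heat N t z) = 1 := by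
  have h := GaussianFourier.integral_rexp_neg_mul_sq_norm (V := EuclideanSpace ℝ (Fin N))
    (inv_pos.2 ht)
  have hpos : 0 < ∫ v : EuclideanSpace ℝ (Fin N), Real.exp (-t⁻¹ * ‖v‖ ^ 2) := by
    rw [h]; positivity
  have hi : Integrable fun v : EuclideanSpace ℝ (Fin N) => Real.exp (-t⁻¹ * ‖v‖ ^ 2) := by
    by_contra hc
    rw [integral_undef hc] at hpos
    exact lt_irrefl _ hpos
  have e : ∀ z : EuclideanSpace ℝ (Fin N), heat N t z =
      (Real.pi * t) ^ (-(N / 2 : ℝ)) * Real.exp (-t⁻¹ * ‖z‖ ^ 2) := by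
    intro z; unfold heat; congr 2; ring
  have hi2 : Integrable (heat N t) := by
    simp_rw [funext e]; exact hi.const_mul _
  rw [← ofReal_integral_eq_lintegral_ofReal hi2 (Eventually.of_forall fun z => heat_nonneg ht.le z)]
  simp_rw [e]
  rw [integral_const_mul, h, finrank_euclideanSpace, Fintype.card_fin, div_inv_eq_mul,
    ← Real.rpow_add (by positivity)]
  simp

theorem heat_mul_heat {t τ : ℝ} (ht : 0 < t) (hτ : 0 < τ) (y z : EuclideanSpace ℝ (Fin N)) :
    heat N t y * heat N τ (z - y) =
      heat N (t + τ) z * heat N (t * τ / (t + τ)) (y - (t / (t + τ)) • z) := by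
  unfold heat
  have h1 : ‖z - y‖ ^ 2 = ‖z‖ ^ 2 - 2 * inner ℝ z y + ‖y‖ ^ 2 := by
    rw [norm_sub_sq_real]
  have h2 : ‖y - (t / (t + τ)) • z‖ ^ 2 =
      ‖y‖ ^ 2 - 2 * ((t / (t + τ)) * inner ℝ z y) + (t / (t + τ)) ^ 2 * ‖z‖ ^ 2 := by
    rw [norm_sub_sq_real, inner_smul_right, real_inner_comm, norm_smul, mul_pow, Real.norm_eq_abs,
      sq_abs]
  rw [h1, h2, mul_mul_mul_comm, mul_mul_mul_comm ((Real.pi * (t + τ)) ^ (-(N / 2 : ℝ))),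
    ← Real.exp_add, ← Real.exp_add, ← Real.mul_rpow (by positivity) (by positivity),
    ← Real.mul_rpow (by positivity) (by positivity)]
  have hs : t + τ ≠ 0 := by positivity
  congr 2
  · field_simp
  · field_simp
    ring

/-- The semigroup property of the Gaussian kernels. -/
theorem lintegral_heat_mul_heat {t τ : ℝ} (ht : 0 < t) (hτ : 0 < τ) (z : EuclideanSpace ℝ (Fin N)) :
    ∫⁻ y, ENNReal.ofReal (heat N t y) * ENNReal.ofReal (heat N τ (z - y)) =
      ENNReal.ofReal (heat N (t + τ) z) := by
  have hp : 0 < t * τ / (t + τ) := by positivity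
  calc ∫⁻ y, ENNReal.ofReal (heat N t y) * ENNReal.ofReal (heat N τ (z - y))
      = ∫⁻ y, ENNReal.ofReal (heat N (t + τ) z) *
          ENNReal.ofReal (heat N (t * τ / (t + τ)) (y - (t / (t + τ)) • z)) := by
        refine lintegral_congr fun y => ?_
        rw [← ENNReal.ofReal_mul (heat_nonneg ht.le _), heat_mul_heat ht hτ,
          ENNReal.ofReal_mul (heat_nonneg (by positivity) _)]
    _ = ENNReal.ofReal (heat N (t + τ) z) *
          ∫⁻ y, ENNReal.ofReal (heat N (t * τ / (t + τ)) (y - (t / (t + τ)) • z)) := by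
        refine lintegral_const_mul _ ?_
        exact ((measurable_heat_right _).comp (measurable_id.sub_const _)).ennreal_ofReal
    _ = ENNReal.ofReal (heat N (t + τ) z) := by
        rw [lintegral_sub_right_eq_self (fun y => ENNReal.ofReal (heat N (t * τ / (t + τ)) y)),
          lintegral_heat hp, mul_one]

/-- The constant in the subordination formula
`∫₀^∞ t^(b - 1) heat t z dt = subordConst N b * |z|^(2b - N)`. -/
def subordConst (N : ℕ) (b : ℝ) : ℝ := Real.pi ^ (-(N / 2 : ℝ)) * Real.Gamma (N / 2 - b)

theorem subordConst_pos {b : ℝ} (hb : b < N / 2) : 0 < subordConst N b := by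
  unfold subordConst
  have := Real.Gamma_pos_of_pos (sub_pos.2 hb)
  positivity

/-- Powers of the norm are mixtures of Gaussians: a Gamma integral. -/
theorem lintegral_rpow_mul_heat {b : ℝ} (hb : b < N / 2) {z : EuclideanSpace ℝ (Fin N)} (hz : z ≠ 0) :
    ∫⁻ t in Ioi (0 : ℝ), ENNReal.ofReal (t ^ (b - 1) * heat N t z) =
      ENNReal.ofReal (subordConst N b * ‖z‖ ^ (2 * b - N)) := by
  have hz0 : 0 < ‖z‖ := norm_pos_iff.2 hz
  have ha : 0 < (N / 2 : ℝ) - b := sub_pos.2 hb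
  have hr : 0 < ‖z‖ ^ 2 := by positivity
  set g : ℝ → ℝ := fun u => Real.pi ^ (-(N / 2 : ℝ)) * (u ^ ((N / 2 : ℝ) - b - 1) *
    Real.exp (-(‖z‖ ^ 2 * u))) with hg
  have hgI : IntegrableOn (fun u : ℝ => u ^ ((N / 2 : ℝ) - b - 1) * Real.exp (-(‖z‖ ^ 2 * u)))
      (Ioi 0) := by
    have h := Real.integral_rpow_mul_exp_neg_mul_Ioi ha hr
    by_contra hc
    rw [integral_undef hc] at h
    have : 0 < (1 / ‖z‖ ^ 2) ^ ((N / 2 : ℝ) - b) * Real.Gamma ((N / 2 : ℝ) - b) := by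
      have := Real.Gamma_pos_of_pos ha
      positivity
    linarith
  have hgI' : IntegrableOn g (Ioi 0) := hgI.const_mul _
  have hgint : ∫ u in Ioi (0 : ℝ), g u = subordConst N b * ‖z‖ ^ (2 * b - N) := by
    rw [hg, integral_const_mul, Real.integral_rpow_mul_exp_neg_mul_Ioi ha hr, subordConst]
    have : (1 / ‖z‖ ^ 2) ^ ((N / 2 : ℝ) - b) = ‖z‖ ^ (2 * b - N) := by
      rw [one_div, ← Real.rpow_natCast, ← Real.rpow_neg hz0.le, ← Real.rpow_mul hz0.le]
      congr 1; push_cast; ring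
    rw [this]; ring
  -- the substitution `u = 1 / t`
  have e : ∀ t ∈ Ioi (0 : ℝ), (|(-1 : ℝ)| * t ^ ((-1 : ℝ) - 1)) • g (t ^ (-1 : ℝ)) =
      t ^ (b - 1) * heat N t z := by
    intro t ht
    have ht0 : 0 < t := ht
    simp only [hg, heat, smul_eq_mul, abs_neg, abs_one, one_mul]
    rw [← Real.rpow_mul ht0.le, Real.mul_rpow Real.pi_pos.le ht0.le, Real.rpow_neg_one, div_eq_mul_inv (‖z‖ ^ 2)]
    have : t ^ ((-1 : ℝ) - 1) * t ^ (-1 * ((N / 2 : ℝ) - b - 1)) = t ^ (b - 1) * t ^ (-(N / 2 : ℝ)) := by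
      rw [← Real.rpow_add ht0, ← Real.rpow_add ht0]; congr 1; ring
    linear_combination (Real.pi ^ (-(N / 2 : ℝ)) * Real.exp (-(‖z‖ ^ 2 * t⁻¹))) * this
  have hI := (integrableOn_Ioi_comp_rpow_iff g (by norm_num : (-1 : ℝ) ≠ 0)).2 hgI'
  have hint := integral_comp_rpow_Ioi g (by norm_num : (-1 : ℝ) ≠ 0)
  have hI' := hI.congr_fun e measurableSet_Ioi
  rw [setIntegral_congr_fun measurableSet_Ioi e, hgint] at hint
  rw [← hint, ofReal_integral_eq_lintegral_ofReal hI']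
  refine (ae_restrict_iff' measurableSet_Ioi).2 (Eventually.of_forall fun t ht => ?_)
  have ht0 : 0 < t := ht
  exact mul_nonneg (by positivity) (heat_nonneg ht0.le z)

theorem lintegral_comp_smul_euclidean {E : Type*} [NormedAddCommGroup E] [NormedSpace ℝ E]
    [FiniteDimensional ℝ E] [MeasurableSpace E] [BorelSpace E] (μ : Measure E)
    [μ.IsAddHaarMeasure] {c : ℝ} (hc : 0 < c) (g : E → ℝ≥0∞) :
    ∫⁻ z, g (c • z) ∂μ = ENNReal.ofReal ((c ^ Module.finrank ℝ E)⁻¹) * ∫⁻ z, g z ∂μ := by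
  have h := Measure.map_addHaar_smul μ hc.ne'
  rw [abs_of_pos (by positivity)] at h
  have h2 : ∫⁻ z, g z ∂(Measure.map (fun z => c • z) μ) = ∫⁻ z, g (c • z) ∂μ :=
    (Homeomorph.smulOfNeZero c hc.ne').toMeasurableEquiv.measurableEmbedding.lintegral_map g
  rw [← h2, h, lintegral_smul_measure, smul_eq_mul]

/-! ### The Gaussian averages of a function -/

/-- The convolution of `f` with the Gaussian kernel. -/
def heatAvg (f : EuclideanSpace ℝ (Fin N) → ℝ≥0∞) (x : EuclideanSpace ℝ (Fin N)) (t : ℝ) : ℝ≥0∞ :=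
  ∫⁻ z, ENNReal.ofReal (heat N t z) * f (x - z)

variable {f : EuclideanSpace ℝ (Fin N) → ℝ≥0∞}

theorem measurable_heatAvg (hf : Measurable f) :
    Measurable fun p : EuclideanSpace ℝ (Fin N) × ℝ => heatAvg f p.1 p.2 := by
  unfold heatAvg
  refine Measurable.lintegral_prod_right' (f := fun q : (EuclideanSpace ℝ (Fin N) × ℝ) ×
    EuclideanSpace ℝ (Fin N) => ENNReal.ofReal (heat N q.1.2 q.2) * f (q.1.1 - q.2)) ?_
  refine Measurable.mul ?_ (hf.comp (by fun_prop))
  exact (measurable_heat.comp (by fun_prop : Measurable fun q : (EuclideanSpace ℝ (Fin N) × ℝ) ×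
    EuclideanSpace ℝ (Fin N) => (q.1.2, q.2))).ennreal_ofReal

theorem measurable_heatAvg_right (hf : Measurable f) (x : EuclideanSpace ℝ (Fin N)) :
    Measurable (heatAvg f x) :=
  (measurable_heatAvg hf).comp (by fun_prop : Measurable fun t : ℝ => (x, t))

theorem heatAvg_heatAvg (hf : Measurable f) {t τ : ℝ} (ht : 0 < t) (hτ : 0 < τ)
    (x : EuclideanSpace ℝ (Fin N)) :
    ∫⁻ y, ENNReal.ofReal (heat N t y) * heatAvg f (x - y) τ = heatAvg f x (t + τ) := by
  have hm := measurable_heat_right (N := N)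
  calc ∫⁻ y, ENNReal.ofReal (heat N t y) * heatAvg f (x - y) τ
      = ∫⁻ y, ∫⁻ z, ENNReal.ofReal (heat N t y) *
          (ENNReal.ofReal (heat N τ (z - y)) * f (x - z)) := by
        refine lintegral_congr fun y => ?_
        rw [lintegral_const_mul]
        · congr 1
          unfold heatAvg
          rw [← lintegral_sub_right_eq_self _ y]
          refine lintegral_congr fun z => ?_
          rw [sub_sub_sub_cancel_right]
        · exact ((hm τ).comp (measurable_id.sub_const _)).ennreal_ofReal.mul
            (hf.comp (measurable_id.const_sub _))
    _ = ∫⁻ z, ∫⁻ y, ENNReal.ofReal (heat N t y) *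
          (ENNReal.ofReal (heat N τ (z - y)) * f (x - z)) := by
        refine lintegral_lintegral_swap ?_
        refine Measurable.aemeasurable ?_
        refine ((hm t).comp measurable_fst).ennreal_ofReal.mul
          (((hm τ).comp (by fun_prop)).ennreal_ofReal.mul (hf.comp (by fun_prop)))
    _ = heatAvg f x (t + τ) := by
        refine lintegral_congr fun z => ?_
        simp_rw [← mul_assoc]
        rw [lintegral_mul_const, lintegral_heat_mul_heat ht hτ]
        exact (hm t).ennreal_ofReal.mul ((hm τ).comp (by fun_prop)).ennreal_ofReal

theorem heatAvg_le {M : ℝ≥0∞} (hM : ∀ x, f x ≤ M) {t : ℝ} (ht : 0 < t)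
    (x : EuclideanSpace ℝ (Fin N)) : heatAvg f x t ≤ M := by
  calc heatAvg f x t ≤ ∫⁻ z, ENNReal.ofReal (heat N t z) * M :=
        lintegral_mono fun z => by gcongr; exact hM _
    _ = M := by
        rw [lintegral_mul_const _ (measurable_heat_right t).ennreal_ofReal, lintegral_heat ht, one_mul]

theorem heatAvg_eq_scaled {t : ℝ} (ht : 0 < t) (x : EuclideanSpace ℝ (Fin N)) :
    heatAvg f x t = ∫⁻ z, ENNReal.ofReal (heat N 1 z) * f (x - √t • z) := by
  have h1 : 0 < √t := Real.sqrt_pos.2 ht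
  have h := lintegral_comp_smul_euclidean volume h1
    (fun z : EuclideanSpace ℝ (Fin N) => ENNReal.ofReal (heat N t z) * f (x - z))
  have hc : ENNReal.ofReal ((√t ^ Module.finrank ℝ (EuclideanSpace ℝ (Fin N)))⁻¹) ≠ 0 := by
    simp only [ne_eq, ENNReal.ofReal_eq_zero, not_le]; positivity
  have : ENNReal.ofReal ((√t ^ Module.finrank ℝ (EuclideanSpace ℝ (Fin N)))⁻¹) *
      ∫⁻ z, ENNReal.ofReal (heat N 1 z) * f (x - √t • z) =
      ENNReal.ofReal ((√t ^ Module.finrank ℝ (EuclideanSpace ℝ (Fin N)))⁻¹) * heatAvg f x t := by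
    unfold heatAvg
    rw [← h, ← lintegral_const_mul' _ _ ENNReal.ofReal_ne_top]
    refine lintegral_congr fun z => ?_
    rw [← mul_assoc, ← ENNReal.ofReal_mul (by positivity)]
    congr 2
    unfold heat
    rw [norm_smul, mul_pow, Real.norm_eq_abs, sq_abs, Real.sq_sqrt ht.le, mul_div_cancel_left₀ _ ht.ne',
      Real.mul_rpow Real.pi_pos.le ht.le, mul_one, div_one, finrank_euclideanSpace, Fintype.card_fin]
    have : (√t ^ N)⁻¹ = t ^ (-(N / 2 : ℝ)) := by
      rw [Real.sqrt_eq_rpow, ← Real.rpow_natCast, ← Real.rpow_mul ht.le, ← Real.rpow_neg ht.le]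
      congr 1; ring
    rw [this]; ring
  exact ((ENNReal.mul_right_inj hc ENNReal.ofReal_ne_top).1 this).symm

theorem tendsto_heatAvg_zero (hf : Continuous f) {M : ℝ≥0∞} (hMt : M ≠ ∞) (hM : ∀ x, f x ≤ M)
    (x : EuclideanSpace ℝ (Fin N)) : Tendsto (heatAvg f x) (𝓝[>] 0) (𝓝 (f x)) := by
  have hm := (measurable_heat_right (N := N) 1).ennreal_ofReal
  have h : Tendsto (fun t : ℝ => ∫⁻ z, ENNReal.ofReal (heat N 1 z) * f (x - √t • z)) (𝓝[>] 0)
      (𝓝 (∫⁻ z, ENNReal.ofReal (heat N 1 z) * f x)) := by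
    refine tendsto_lintegral_filter_of_dominated_convergence
      (fun z => ENNReal.ofReal (heat N 1 z) * M) (Eventually.of_forall fun t => ?_)
      (Eventually.of_forall fun t => Eventually.of_forall fun z => ?_) ?_
      (Eventually.of_forall fun z => ?_)
    · exact hm.mul (hf.measurable.comp (by fun_prop))
    · beta_reduce; gcongr; exact hM _
    · rw [lintegral_mul_const _ hm, lintegral_heat one_pos, one_mul]; exact hMt
    · refine ENNReal.Tendsto.const_mul ?_ (Or.inr ENNReal.ofReal_ne_top)
      have : Tendsto (fun t : ℝ => x - √t • z) (𝓝[>] 0) (𝓝 (x - √(0 : ℝ) • z)) :=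
        ((by fun_prop : Continuous fun t : ℝ => x - √t • z).tendsto 0).mono_left nhdsWithin_le_nhds
      rw [Real.sqrt_zero, zero_smul, sub_zero] at this
      exact (hf.tendsto x).comp this
  rw [lintegral_mul_const _ hm, lintegral_heat one_pos, one_mul] at h
  refine h.congr' ?_
  filter_upwards [self_mem_nhdsWithin] with t ht
  exact (heatAvg_eq_scaled ht x).symm

end FracSchrodinger

end

noncomputable section

namespace FracSchrodinger

variable {N : ℕ}

/-! ### Riesz potentials and the fractional Laplacian -/

/-- The Riesz potential `∫ |z|^(2s - N) f(x - z) dz` of a nonnegative function, without a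
normalizing constant. -/
def rieszE (s : ℝ) (f : EuclideanSpace ℝ (Fin N) → ℝ≥0∞) (x : EuclideanSpace ℝ (Fin N)) : ℝ≥0∞ :=
  ∫⁻ z, ENNReal.ofReal (‖z‖ ^ (2 * s - N)) * f (x - z)

/-- The part `∫_δ^∞ t^(-s - 1) heat t y dt` of the subordination integral for `|y|^(-N - 2s)`: a
bounded integrable approximation of that kernel from below. -/
def truncKernel (s δ : ℝ) (y : EuclideanSpace ℝ (Fin N)) : ℝ≥0∞ :=
  ∫⁻ t in Ioi δ, ENNReal.ofReal (t ^ (-s - 1)) * ENNReal.ofReal (heat N t y)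

variable {s : ℝ} {f : EuclideanSpace ℝ (Fin N) → ℝ≥0∞}

theorem rieszE_eq_heatAvg (hN : 0 < N) (hs : s < N / 2) (hf : Measurable f)
    (x : EuclideanSpace ℝ (Fin N)) :
    ENNReal.ofReal (subordConst N s) * rieszE s f x =
      ∫⁻ τ in Ioi (0 : ℝ), ENNReal.ofReal (τ ^ (s - 1)) * heatAvg f x τ := by
  have := nontrivial_euclidean hN
  have hm := measurable_heat_right (N := N)
  have hc := (subordConst_pos hs).le
  have h0 : ∀ᵐ z : EuclideanSpace ℝ (Fin N), z ≠ 0 := by simp [ae_iff]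
  calc ENNReal.ofReal (subordConst N s) * rieszE s f x
      = ∫⁻ z, ENNReal.ofReal (subordConst N s) * (ENNReal.ofReal (‖z‖ ^ (2 * s - N)) * f (x - z)) := by
        rw [rieszE, lintegral_const_mul' _ _ ENNReal.ofReal_ne_top]
    _ = ∫⁻ z, (∫⁻ τ in Ioi (0 : ℝ), ENNReal.ofReal (τ ^ (s - 1)) *
          (ENNReal.ofReal (heat N τ z) * f (x - z))) := by
        refine lintegral_congr_ae ?_
        filter_upwards [h0] with z hz
        rw [← mul_assoc, ← ENNReal.ofReal_mul hc, ← lintegral_rpow_mul_heat hs hz,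
          ← lintegral_mul_const]
        · refine setLIntegral_congr_fun measurableSet_Ioi fun τ hτ => ?_
          have : (0 : ℝ) < τ := hτ
          beta_reduce
          rw [ENNReal.ofReal_mul (by positivity), mul_assoc]
        · exact ((by fun_prop : Measurable fun t : ℝ => t ^ (s - 1)).mul
            (measurable_heat.comp (by fun_prop : Measurable fun t : ℝ => (t, z)))).ennreal_ofReal
    _ = ∫⁻ τ in Ioi (0 : ℝ), ∫⁻ z, ENNReal.ofReal (τ ^ (s - 1)) *
          (ENNReal.ofReal (heat N τ z) * f (x - z)) := by
        refine lintegral_lintegral_swap (Measurable.aemeasurable ?_)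
        refine Measurable.mul (by fun_prop) (Measurable.mul ?_ (hf.comp (by fun_prop)))
        exact (measurable_heat.comp (by fun_prop : Measurable fun q : EuclideanSpace ℝ (Fin N) × ℝ =>
          (q.2, q.1))).ennreal_ofReal
    _ = _ := by
        refine lintegral_congr fun τ => ?_
        rw [lintegral_const_mul' _ _ ENNReal.ofReal_ne_top]
        rfl

theorem lintegral_Ioo_rpow_mul_rpow (hs : 0 < s) {δ r : ℝ} (hδ : 0 < δ) (hr : δ < r) :
    ∫⁻ t in Ioo δ r, ENNReal.ofReal (t ^ (-s - 1) * (r - t) ^ (s - 1)) =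
      ENNReal.ofReal ((r - δ) ^ s / (s * r * δ ^ s)) := by
  have hr0 : 0 < r := hδ.trans hr
  -- an antiderivative of the integrand
  set A : ℝ → ℝ := fun t => -((r - t) ^ s * t ^ (-s) / (s * r)) with hA
  have hcont : ContinuousOn A (Icc δ r) := by
    refine ContinuousOn.neg (ContinuousOn.div_const (ContinuousOn.mul ?_ ?_) _)
    · exact (continuousOn_const.sub continuousOn_id).rpow_const fun t _ => Or.inr hs.le
    · exact continuousOn_id.rpow_const fun t ht => Or.inl (hδ.trans_le ht.1).ne'
  have hder : ∀ t ∈ Ioo δ r, HasDerivAt A (t ^ (-s - 1) * (r - t) ^ (s - 1)) t := by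
    intro t ht
    have ht0 : 0 < t := hδ.trans ht.1
    have hrt : 0 < r - t := sub_pos.2 ht.2
    have d1 : HasDerivAt (fun t => (r - t) ^ s) (-1 * s * (r - t) ^ (s - 1)) t :=
      ((hasDerivAt_id t).const_sub r).rpow_const (Or.inl hrt.ne')
    have d2 : HasDerivAt (fun t : ℝ => t ^ (-s)) (1 * (-s) * t ^ (-s - 1)) t :=
      (hasDerivAt_id t).rpow_const (Or.inl ht0.ne')
    refine (((d1.mul d2).div_const (s * r)).neg).congr_deriv ?_
    have e1 : (r - t) ^ s = (r - t) ^ (s - 1) * (r - t) := by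
      rw [← Real.rpow_add_one hrt.ne']; congr 1; ring
    have e2 : t ^ (-s) = t ^ (-s - 1) * t := by
      rw [← Real.rpow_add_one ht0.ne']; congr 1; ring
    rw [e1, e2]
    field_simp
    ring
  have hnn : ∀ t ∈ Ioo δ r, 0 ≤ t ^ (-s - 1) * (r - t) ^ (s - 1) := fun t ht =>
    mul_nonneg (Real.rpow_nonneg (hδ.trans ht.1).le _) (Real.rpow_nonneg (sub_pos.2 ht.2).le _)
  have hI := intervalIntegral.integrableOn_deriv_of_nonneg hcont hder hnn
  have hint := intervalIntegral.integral_eq_sub_of_hasDerivAt_of_le hr.le hcont hder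
    ((intervalIntegrable_iff_integrableOn_Ioc_of_le hr.le).2 hI)
  rw [intervalIntegral.integral_of_le hr.le, integral_Ioc_eq_integral_Ioo] at hint
  rw [← ofReal_integral_eq_lintegral_ofReal (hI.mono_set Ioo_subset_Ioc_self), hint]
  · congr 1
    simp only [hA, sub_self, Real.zero_rpow hs.ne', zero_mul, zero_div, neg_zero, zero_sub, neg_neg]
    rw [Real.rpow_neg hδ.le]
    field_simp
  · exact (ae_restrict_iff' measurableSet_Ioo).2 (Eventually.of_forall hnn)

/-- The convolution of the truncated kernel with a Riesz potential, as a mixture of Gaussian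
averages of the density. -/
theorem lintegral_truncKernel_mul_rieszE (hN : 0 < N) (hs0 : 0 < s) (hs : s < N / 2)
    (hf : Measurable f) {δ : ℝ} (hδ : 0 < δ) (x : EuclideanSpace ℝ (Fin N)) :
    ∫⁻ y, truncKernel s δ y * (ENNReal.ofReal (subordConst N s) * rieszE s f (x - y)) =
      ∫⁻ r in Ioi δ, ENNReal.ofReal ((r - δ) ^ s / (s * r * δ ^ s)) * heatAvg f x r := by
  have hm := measurable_heat_right (N := N)
  have hF := measurable_heatAvg hf
  have hFx := measurable_heatAvg_right hf x
  have mheat : Measurable fun q : EuclideanSpace ℝ (Fin N) × ℝ => ENNReal.ofReal (heat N q.2 q.1) :=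
    (measurable_heat.comp (by fun_prop : Measurable fun q : EuclideanSpace ℝ (Fin N) × ℝ =>
      (q.2, q.1))).ennreal_ofReal
  have mW : Measurable fun y : EuclideanSpace ℝ (Fin N) =>
      ∫⁻ τ in Ioi (0 : ℝ), ENNReal.ofReal (τ ^ (s - 1)) * heatAvg f (x - y) τ := by
    refine Measurable.lintegral_prod_right' (f := fun q : EuclideanSpace ℝ (Fin N) × ℝ =>
      ENNReal.ofReal (q.2 ^ (s - 1)) * heatAvg f (x - q.1) q.2) ?_
    exact Measurable.mul (by fun_prop) (hF.comp (by fun_prop :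
      Measurable fun q : EuclideanSpace ℝ (Fin N) × ℝ => (x - q.1, q.2)))
  calc ∫⁻ y, truncKernel s δ y * (ENNReal.ofReal (subordConst N s) * rieszE s f (x - y))
      = ∫⁻ y, ∫⁻ t in Ioi δ, ENNReal.ofReal (t ^ (-s - 1)) * (ENNReal.ofReal (heat N t y) *
          ∫⁻ τ in Ioi (0 : ℝ), ENNReal.ofReal (τ ^ (s - 1)) * heatAvg f (x - y) τ) := by
        refine lintegral_congr fun y => ?_
        rw [rieszE_eq_heatAvg hN hs hf, truncKernel, ← lintegral_mul_const]
        · simp_rw [mul_assoc]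
        · exact Measurable.mul (by fun_prop) (mheat.comp (by fun_prop : Measurable fun t : ℝ => (y, t)))
    _ = ∫⁻ t in Ioi δ, ∫⁻ y, ENNReal.ofReal (t ^ (-s - 1)) * (ENNReal.ofReal (heat N t y) *
          ∫⁻ τ in Ioi (0 : ℝ), ENNReal.ofReal (τ ^ (s - 1)) * heatAvg f (x - y) τ) := by
        refine lintegral_lintegral_swap (Measurable.aemeasurable ?_)
        exact Measurable.mul (by fun_prop) (mheat.mul (mW.comp measurable_fst))
    _ = ∫⁻ t in Ioi δ, ∫⁻ r in Ioi δ, ENNReal.ofReal (t ^ (-s - 1)) *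
          ((Ioi t).indicator (fun r => ENNReal.ofReal ((r - t) ^ (s - 1))) r * heatAvg f x r) := by
        refine setLIntegral_congr_fun measurableSet_Ioi fun t ht => ?_
        have ht0 : 0 < t := hδ.trans ht
        beta_reduce
        rw [lintegral_const_mul' _ _ ENNReal.ofReal_ne_top,
          lintegral_const_mul' _ _ ENNReal.ofReal_ne_top]
        congr 1
        calc ∫⁻ y, ENNReal.ofReal (heat N t y) *
              ∫⁻ τ in Ioi (0 : ℝ), ENNReal.ofReal (τ ^ (s - 1)) * heatAvg f (x - y) τ
            = ∫⁻ y, ∫⁻ τ in Ioi (0 : ℝ), ENNReal.ofReal (heat N t y) *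
                (ENNReal.ofReal (τ ^ (s - 1)) * heatAvg f (x - y) τ) := by
              refine lintegral_congr fun y => ?_
              rw [lintegral_const_mul' _ _ ENNReal.ofReal_ne_top]
          _ = ∫⁻ τ in Ioi (0 : ℝ), ∫⁻ y, ENNReal.ofReal (heat N t y) *
                (ENNReal.ofReal (τ ^ (s - 1)) * heatAvg f (x - y) τ) := by
              refine lintegral_lintegral_swap (Measurable.aemeasurable ?_)
              exact ((hm t).comp measurable_fst).ennreal_ofReal.mul
                (Measurable.mul (by fun_prop) (hF.comp (by fun_prop :
                Measurable fun q : EuclideanSpace ℝ (Fin N) × ℝ => (x - q.1, q.2))))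
          _ = ∫⁻ τ in Ioi (0 : ℝ), ENNReal.ofReal (τ ^ (s - 1)) * heatAvg f x (t + τ) := by
              refine setLIntegral_congr_fun measurableSet_Ioi fun τ hτ => ?_
              beta_reduce
              rw [← heatAvg_heatAvg hf ht0 hτ, ← lintegral_const_mul' _ _ ENNReal.ofReal_ne_top]
              refine lintegral_congr fun y => ?_
              ring
          _ = ∫⁻ r, (Ioi t).indicator (fun r => ENNReal.ofReal ((r - t) ^ (s - 1)) *
                heatAvg f x r) r := by
              rw [← lintegral_indicator measurableSet_Ioi, ← lintegral_sub_right_eq_self _ t]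
              refine lintegral_congr fun r => ?_
              simp only [indicator, mem_Ioi, sub_pos, add_sub_cancel]
          _ = _ := by
              rw [← lintegral_indicator measurableSet_Ioi]
              refine lintegral_congr fun r => ?_
              simp only [indicator, mem_Ioi]
              have : δ < t := ht
              split_ifs with h1 h2 h2
              · rfl
              · exact absurd (this.trans h1) h2
              · simp
              · rfl
    _ = ∫⁻ r in Ioi δ, ∫⁻ t in Ioi δ, ENNReal.ofReal (t ^ (-s - 1)) *
          ((Ioi t).indicator (fun r => ENNReal.ofReal ((r - t) ^ (s - 1))) r * heatAvg f x r) := by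
        refine lintegral_lintegral_swap (Measurable.aemeasurable ?_)
        refine Measurable.mul (by fun_prop) (Measurable.mul ?_ (hFx.comp measurable_snd))
        have : (fun q : ℝ × ℝ => (Ioi q.1).indicator
            (fun r => ENNReal.ofReal ((r - q.1) ^ (s - 1))) q.2) =
            {q : ℝ × ℝ | q.1 < q.2}.indicator fun q => ENNReal.ofReal ((q.2 - q.1) ^ (s - 1)) := by
          funext q
          simp [indicator]
        rw [this]
        exact Measurable.indicator (by fun_prop)
          (measurableSet_lt measurable_fst measurable_snd)
    _ = _ := by
        refine setLIntegral_congr_fun measurableSet_Ioi fun r hr => ?_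
        rw [← lintegral_Ioo_rpow_mul_rpow hs0 hδ hr, ← lintegral_mul_const]
        · rw [← lintegral_indicator measurableSet_Ioi, ← lintegral_indicator measurableSet_Ioo]
          refine lintegral_congr fun t => ?_
          simp only [indicator, mem_Ioi, mem_Ioo]
          by_cases h1 : δ < t
          · by_cases h2 : t < r
            · have : 0 < t := hδ.trans h1
              simp only [h1, h2, and_self, if_true]
              rw [ENNReal.ofReal_mul (by positivity), mul_assoc]
            · simp [h1, h2]
          · simp [h1]
        · fun_prop

/-- The kernel `r ↦ r^(s-1)/s - (r-1)₊^s/(s r)` on `(0, ∞)`, whose dilates form the approximate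
identity that expresses the truncated fractional Laplacian of a Riesz potential through Gaussian
averages of its density. -/
def profile (s r : ℝ) : ℝ := (r ^ s - (max (r - 1) 0) ^ s) / (s * r)

theorem profile_nonneg (hs : 0 < s) {r : ℝ} (hr : 0 < r) : 0 ≤ profile s r := by
  unfold profile
  have : (max (r - 1) 0) ^ s ≤ r ^ s :=
    Real.rpow_le_rpow (le_max_right _ _) (max_le (by linarith) hr.le) hs.le
  have := sub_nonneg.2 this
  positivity

theorem profile_le_of_le_one (hs : 0 < s) {r : ℝ} (hr : 0 < r) (hr1 : r ≤ 1) :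
    profile s r = r ^ (s - 1) / s := by
  unfold profile
  rw [max_eq_right (by linarith), Real.zero_rpow hs.ne', sub_zero, Real.rpow_sub_one hr.ne']
  field_simp

theorem profile_le_of_one_lt (hs : s ∈ Ioo (0 : ℝ) 1) {r : ℝ} (hr1 : 1 < r) :
    profile s r ≤ r ^ (s - 2) / s := by
  have hr : 0 < r := by linarith
  have hs0 := hs.1
  have h1 : r ^ s * (1 - r⁻¹) ≤ (r - 1) ^ s := by
    have hx0 : 0 < 1 - r⁻¹ := by
      have := inv_lt_one_of_one_lt₀ hr1
      linarith
    have hx1 : 1 - r⁻¹ ≤ 1 := by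
      have := inv_pos.2 hr
      linarith
    have h2 : 1 - r⁻¹ ≤ (1 - r⁻¹) ^ s := by
      simpa using Real.rpow_le_rpow_of_exponent_ge hx0 hx1 hs.2.le
    calc r ^ s * (1 - r⁻¹) ≤ r ^ s * (1 - r⁻¹) ^ s := by gcongr
      _ = (r - 1) ^ s := by
        rw [← Real.mul_rpow hr.le hx0.le, mul_sub, mul_one, mul_inv_cancel₀ hr.ne']
  unfold profile
  rw [max_eq_left (by linarith), div_le_div_iff₀ (by positivity) hs0]
  have h3 : r ^ s = r ^ (s - 2) * r * r := by
    rw [← Real.rpow_add_one hr.ne', ← Real.rpow_add_one hr.ne']; congr 1; ring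
  have h4 : r ^ s * r⁻¹ = r ^ (s - 2) * r := by
    rw [h3]; field_simp
  have h5 : r ^ s - (r - 1) ^ s ≤ r ^ (s - 2) * r := by rw [← h4]; linarith
  calc (r ^ s - (r - 1) ^ s) * s ≤ r ^ (s - 2) * r * s := by gcongr
    _ = _ := by ring

theorem measurable_profile : Measurable (profile s) := by unfold profile; fun_prop

theorem lintegral_profile_lt_top (hs : s ∈ Ioo (0 : ℝ) 1) :
    ∫⁻ r in Ioi (0 : ℝ), ENNReal.ofReal (profile s r) < ∞ := by
  have h1 : IntegrableOn (fun r : ℝ => r ^ (s - 1) / s) (Ioo 0 1) :=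
    ((intervalIntegral.integrableOn_Ioo_rpow_iff one_pos).2 (by linarith [hs.1])).div_const _
  have h2 : IntegrableOn (fun r : ℝ => r ^ (s - 2) / s) (Ioi (1 / 2)) :=
    (integrableOn_Ioi_rpow_of_lt (by linarith [hs.2]) (by norm_num)).div_const _
  have hsub : Ioi (0 : ℝ) ⊆ Ioo 0 1 ∪ (Ioi 1 ∪ {1}) := by
    intro r hr
    have : 0 < r := hr
    rcases lt_trichotomy r 1 with h | h | h
    · exact Or.inl ⟨this, h⟩
    · exact Or.inr (Or.inr h)
    · exact Or.inr (Or.inl h)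
  refine (lintegral_mono_set hsub).trans_lt ((lintegral_union_le _ _ _).trans_lt ?_)
  refine ENNReal.add_lt_top.2 ⟨?_, (lintegral_union_le _ _ _).trans_lt ?_⟩
  · refine lt_of_le_of_lt ?_ h1.lintegral_lt_top
    exact setLIntegral_mono' measurableSet_Ioo fun r hr =>
      ENNReal.ofReal_le_ofReal (profile_le_of_le_one hs.1 hr.1 hr.2.le).le
  · simp only [Measure.restrict_singleton, Real.volume_singleton, zero_smul, lintegral_zero_measure,
      add_zero]
    refine lt_of_le_of_lt ?_ (h2.mono_set (Ioi_subset_Ioi (by norm_num : (1 / 2 : ℝ) ≤ 1))).lintegral_lt_top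
    exact setLIntegral_mono' measurableSet_Ioi fun r hr =>
      ENNReal.ofReal_le_ofReal (profile_le_of_one_lt hs hr)

theorem lintegral_profile_pos (hs : s ∈ Ioo (0 : ℝ) 1) :
    0 < ∫⁻ r in Ioi (0 : ℝ), ENNReal.ofReal (profile s r) := by
  have h1 : IntegrableOn (fun r : ℝ => r ^ (s - 1) / s) (Ioo 0 1) :=
    ((intervalIntegral.integrableOn_Ioo_rpow_iff one_pos).2 (by linarith [hs.1])).div_const _
  refine lt_of_lt_of_le ?_ (lintegral_mono_set (fun r hr => hr.1 : Ioo (0 : ℝ) 1 ⊆ Ioi 0))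
  have hpos : ∀ r ∈ Ioo (0 : ℝ) 1, 0 < ENNReal.ofReal (profile s r) := fun r hr => by
    rw [profile_le_of_le_one hs.1 hr.1 hr.2.le, ENNReal.ofReal_pos]
    have := hs.1; have := hr.1
    positivity
  rw [lintegral_pos_iff_support measurable_profile.ennreal_ofReal,
    Measure.restrict_apply' measurableSet_Ioo]
  exact lt_of_lt_of_le (b := volume (Ioo (0 : ℝ) 1)) (by simp)
    (measure_mono fun r hr => ⟨(hpos r hr).ne', hr⟩)

theorem lintegral_truncKernel (δ : ℝ) (hδ : 0 < δ) (hs : 0 < s) :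
    ∫⁻ y : EuclideanSpace ℝ (Fin N), truncKernel s δ y = ENNReal.ofReal (δ ^ (-s) / s) := by
  have mheat : Measurable fun q : EuclideanSpace ℝ (Fin N) × ℝ => ENNReal.ofReal (heat N q.2 q.1) :=
    (measurable_heat.comp (by fun_prop : Measurable fun q : EuclideanSpace ℝ (Fin N) × ℝ =>
      (q.2, q.1))).ennreal_ofReal
  have hsw : AEMeasurable (Function.uncurry fun (y : EuclideanSpace ℝ (Fin N)) (t : ℝ) =>
      ENNReal.ofReal (t ^ (-s - 1)) * ENNReal.ofReal (heat N t y))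
      (volume.prod (volume.restrict (Ioi δ))) :=
    (Measurable.mul (by fun_prop) mheat).aemeasurable
  unfold truncKernel
  rw [lintegral_lintegral_swap hsw]
  calc ∫⁻ t in Ioi δ, ∫⁻ y : EuclideanSpace ℝ (Fin N), ENNReal.ofReal (t ^ (-s - 1)) * ENNReal.ofReal (heat N t y)
      = ∫⁻ t in Ioi δ, ENNReal.ofReal (t ^ (-s - 1)) := by
        refine setLIntegral_congr_fun measurableSet_Ioi fun t ht => ?_
        beta_reduce
        rw [lintegral_const_mul' _ _ ENNReal.ofReal_ne_top, lintegral_heat (hδ.trans ht), mul_one]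
    _ = _ := by
        rw [← ofReal_integral_eq_lintegral_ofReal (integrableOn_Ioi_rpow_of_lt (by linarith) hδ),
          integral_Ioi_rpow_of_lt (by linarith) hδ]
        · congr 1
          rw [show -s - 1 + 1 = -s by ring, neg_div_neg_eq]
        · refine (ae_restrict_iff' measurableSet_Ioi).2 (Eventually.of_forall fun t ht => ?_)
          exact Real.rpow_nonneg (hδ.trans ht).le _

/-- For the truncated kernel `k_δ` of mass `m_δ` and a Riesz potential `v`, the function
`m_δ v - k_δ * v` is a mixture of Gaussian averages of the density of `v`. -/
theorem truncated_fracLaplacian_rieszE (hN : 0 < N) (hs0 : 0 < s) (hs : s < N / 2)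
    (hf : Measurable f) {δ : ℝ} (hδ : 0 < δ) (x : EuclideanSpace ℝ (Fin N)) :
    (∫⁻ y, truncKernel s δ y * (ENNReal.ofReal (subordConst N s) * rieszE s f (x - y))) +
      ∫⁻ r in Ioi (0 : ℝ), ENNReal.ofReal (profile s r) * heatAvg f x (δ * r) =
    ENNReal.ofReal (δ ^ (-s) / s) * (ENNReal.ofReal (subordConst N s) * rieszE s f x) := by
  have hFx := measurable_heatAvg_right hf x
  have hsc : ∫⁻ r in Ioi (0 : ℝ), ENNReal.ofReal (profile s r) * heatAvg f x (δ * r) =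
      ∫⁻ r in Ioi (0 : ℝ), ENNReal.ofReal (δ⁻¹ * profile s (δ⁻¹ * r)) * heatAvg f x r := by
    have h := lintegral_comp_smul_euclidean (volume : Measure ℝ) hδ
      ((Ioi (0 : ℝ)).indicator fun r => ENNReal.ofReal (profile s (δ⁻¹ * r)) * heatAvg f x r)
    simp only [Module.finrank_self, pow_one, smul_eq_mul] at h
    rw [lintegral_indicator measurableSet_Ioi, ← lintegral_const_mul' _ _ ENNReal.ofReal_ne_top] at h
    rw [← lintegral_indicator measurableSet_Ioi]
    calc _ = ∫⁻ z, (Ioi (0 : ℝ)).indicator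
          (fun r => ENNReal.ofReal (profile s (δ⁻¹ * r)) * heatAvg f x r) (δ * z) := by
          refine lintegral_congr fun r => ?_
          simp only [indicator, mem_Ioi, mul_pos_iff_of_pos_left hδ]
          rw [inv_mul_cancel_left₀ hδ.ne']
      _ = _ := by
          rw [h]
          refine lintegral_congr fun r => ?_
          rw [← mul_assoc, ← ENNReal.ofReal_mul (by positivity)]
  rw [hsc, lintegral_truncKernel_mul_rieszE hN hs0 hs hf hδ, rieszE_eq_heatAvg hN hs hf,
    ← lintegral_const_mul' _ _ ENNReal.ofReal_ne_top, ← lintegral_indicator measurableSet_Ioi,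
    ← lintegral_indicator measurableSet_Ioi, ← lintegral_indicator measurableSet_Ioi,
    ← lintegral_add_left]
  · refine lintegral_congr fun r => ?_
    simp only [indicator, mem_Ioi]
    by_cases hr : 0 < r
    · have e1 : δ⁻¹ * r - 1 = δ⁻¹ * (r - δ) := by field_simp
      have key : δ ^ (-s) / s * r ^ (s - 1) = (if δ < r then (r - δ) ^ s / (s * r * δ ^ s) else 0) +
          δ⁻¹ * profile s (δ⁻¹ * r) := by
        unfold profile
        rw [Real.mul_rpow (by positivity) hr.le, Real.inv_rpow hδ.le, Real.rpow_neg hδ.le,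
          Real.rpow_sub_one hr.ne', e1]
        split_ifs with h
        · rw [max_eq_left (by have := sub_pos.2 h; positivity), Real.mul_rpow (by positivity)
            (sub_pos.2 h).le, Real.inv_rpow hδ.le]
          field_simp
          ring
        · rw [max_eq_right (mul_nonpos_of_nonneg_of_nonpos (by positivity) (by linarith)),
            Real.zero_rpow hs0.ne']
          field_simp
          ring
      have hp : 0 ≤ δ⁻¹ * profile s (δ⁻¹ * r) :=
        mul_nonneg (by positivity) (profile_nonneg hs0 (by positivity))
      simp only [hr, if_true]
      rw [← mul_assoc, ← ENNReal.ofReal_mul (by positivity), key]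
      split_ifs with h
      · have : 0 ≤ (r - δ) ^ s := Real.rpow_nonneg (sub_pos.2 h).le _
        rw [ENNReal.ofReal_add (by positivity) hp, add_mul]
      · simp
    · have : ¬ δ < r := fun h => hr (hδ.trans h)
      simp [hr, this]
  · exact Measurable.indicator (Measurable.mul (by fun_prop) hFx) measurableSet_Ioi

theorem tendsto_lintegral_profile_mul_heatAvg (hs : s ∈ Ioo (0 : ℝ) 1) (hf : Continuous f)
    {M : ℝ≥0∞} (hMt : M ≠ ∞) (hM : ∀ x, f x ≤ M) (x : EuclideanSpace ℝ (Fin N)) :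
    Tendsto (fun δ : ℝ => ∫⁻ r in Ioi (0 : ℝ), ENNReal.ofReal (profile s r) * heatAvg f x (δ * r))
      (𝓝[>] 0) (𝓝 ((∫⁻ r in Ioi (0 : ℝ), ENNReal.ofReal (profile s r)) * f x)) := by
  have hp := (measurable_profile (s := s)).ennreal_ofReal
  rw [← lintegral_mul_const _ hp]
  refine tendsto_lintegral_filter_of_dominated_convergence
    (fun r => ENNReal.ofReal (profile s r) * M) (Eventually.of_forall fun δ => ?_) ?_ ?_ ?_
  · exact hp.mul ((measurable_heatAvg_right hf.measurable x).comp (by fun_prop))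
  · filter_upwards [self_mem_nhdsWithin] with δ hδ
    refine (ae_restrict_iff' measurableSet_Ioi).2 (Eventually.of_forall fun r hr => ?_)
    gcongr
    exact heatAvg_le hM (mul_pos hδ hr) x
  · rw [lintegral_mul_const _ hp]
    exact ENNReal.mul_ne_top (lintegral_profile_lt_top hs).ne hMt
  · refine (ae_restrict_iff' measurableSet_Ioi).2 (Eventually.of_forall fun r hr => ?_)
    refine ENNReal.Tendsto.const_mul ?_ (Or.inr ENNReal.ofReal_ne_top)
    refine (tendsto_heatAvg_zero hf hMt hM x).comp ?_
    refine tendsto_nhdsWithin_iff.2 ⟨?_, ?_⟩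
    · have : Tendsto (fun δ : ℝ => δ * r) (𝓝 0) (𝓝 (0 * r)) := tendsto_id.mul_const r
      rw [zero_mul] at this
      exact this.mono_left nhdsWithin_le_nhds
    · filter_upwards [self_mem_nhdsWithin] with δ hδ
      exact mul_pos hδ (mem_Ioi.1 hr)

end FracSchrodinger

end

noncomputable section

namespace FracSchrodinger

variable {N : ℕ} {s : ℝ}

/-- The constant `C` in `(-Δ)^s (|·|^(2s - N) * f) = C f`. -/
def fracConst (N : ℕ) (s : ℝ) : ℝ :=
  (∫⁻ r in Ioi (0 : ℝ), ENNReal.ofReal (profile s r)).toReal /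
    (subordConst N s * subordConst N (-s))

theorem fracConst_pos (hs : s ∈ Ioo (0 : ℝ) 1) (hN : 2 * s < N) : 0 < fracConst N s := by
  have hs0 := hs.1
  exact div_pos (ENNReal.toReal_pos (lintegral_profile_pos hs).ne' (lintegral_profile_lt_top hs).ne)
    (mul_pos (subordConst_pos (by linarith)) (subordConst_pos (by linarith)))

theorem truncKernel_neg (δ : ℝ) (y : EuclideanSpace ℝ (Fin N)) :
    truncKernel s δ (-y) = truncKernel s δ y := by
  simp only [truncKernel, heat_neg]

theorem measurable_truncKernel (δ : ℝ) :
    Measurable (truncKernel (N := N) s δ) := by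
  refine Measurable.lintegral_prod_right' (f := fun q : EuclideanSpace ℝ (Fin N) × ℝ =>
      ENNReal.ofReal (q.2 ^ (-s - 1)) * ENNReal.ofReal (heat N q.2 q.1)) ?_
  exact Measurable.mul (by fun_prop)
    (measurable_heat.comp (by fun_prop : Measurable fun q : EuclideanSpace ℝ (Fin N) × ℝ =>
      (q.2, q.1))).ennreal_ofReal

theorem truncKernel_zero (hs : 0 < s) {y : EuclideanSpace ℝ (Fin N)} (hy : y ≠ 0) :
    truncKernel s 0 y = ENNReal.ofReal (subordConst N (-s) * ‖y‖ ^ (-((N : ℝ) + 2 * s))) := by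
  have h := lintegral_rpow_mul_heat (N := N) (b := -s)
    (by have : (0 : ℝ) ≤ N := Nat.cast_nonneg N
        linarith) hy
  rw [show 2 * -s - (N : ℝ) = -((N : ℝ) + 2 * s) by ring] at h
  rw [← h, truncKernel]
  refine setLIntegral_congr_fun measurableSet_Ioi fun t ht => ?_
  have : (0 : ℝ) < t := ht
  exact (ENNReal.ofReal_mul (by positivity)).symm

theorem truncKernel_le (hs : 0 < s) {δ : ℝ} (hδ : 0 ≤ δ) {y : EuclideanSpace ℝ (Fin N)} (hy : y ≠ 0) :
    truncKernel s δ y ≤ ENNReal.ofReal (subordConst N (-s) * ‖y‖ ^ (-((N : ℝ) + 2 * s))) := by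
  rw [← truncKernel_zero hs hy]
  exact lintegral_mono_set (Ioi_subset_Ioi hδ)

theorem tendsto_truncKernel (hs : 0 < s) {y : EuclideanSpace ℝ (Fin N)} (hy : y ≠ 0) :
    Tendsto (fun δ => truncKernel s δ y) (𝓝[>] 0)
      (𝓝 (ENNReal.ofReal (subordConst N (-s) * ‖y‖ ^ (-((N : ℝ) + 2 * s))))) := by
  rw [← truncKernel_zero hs hy]
  have hm : Measurable fun t : ℝ => ENNReal.ofReal (t ^ (-s - 1)) * ENNReal.ofReal (heat N t y) :=
    Measurable.mul (by fun_prop)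
      (measurable_heat.comp (by fun_prop : Measurable fun t : ℝ => (t, y))).ennreal_ofReal
  unfold truncKernel
  simp_rw [← lintegral_indicator measurableSet_Ioi]
  refine tendsto_lintegral_filter_of_dominated_convergence
    ((Ioi (0 : ℝ)).indicator fun t => ENNReal.ofReal (t ^ (-s - 1)) * ENNReal.ofReal (heat N t y))
    (Eventually.of_forall fun δ => hm.indicator measurableSet_Ioi) ?_ ?_
    (Eventually.of_forall fun t => ?_)
  · filter_upwards [self_mem_nhdsWithin] with δ hδ
    refine Eventually.of_forall fun t => ?_
    exact indicator_le_indicator_of_subset (Ioi_subset_Ioi (mem_Ioi.1 hδ).le) (fun _ => zero_le) t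
  · rw [lintegral_indicator measurableSet_Ioi]
    have := truncKernel_zero hs hy
    unfold truncKernel at this
    rw [this]
    exact ENNReal.ofReal_ne_top
  · rcases le_or_gt t 0 with ht | ht
    · refine tendsto_const_nhds.congr' ?_
      filter_upwards [self_mem_nhdsWithin] with δ hδ
      have : (0 : ℝ) < δ := hδ
      rw [indicator_of_notMem (by simpa using ht), indicator_of_notMem (by simpa using ht.trans this.le)]
    · refine tendsto_const_nhds.congr' ?_
      filter_upwards [mem_nhdsWithin_of_mem_nhds (Iio_mem_nhds ht)] with δ hδ
      rw [indicator_of_mem (by simpa using ht), indicator_of_mem (by simpa using hδ)]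

/-- The fractional Laplacian of the Riesz potential of a nonnegative density is a positive multiple
of the density. For the truncated kernel one has a mixture of Gaussian averages of the density
instead, and as the truncation is removed, the averages tend to the density. -/
theorem hasFracLaplacian_riesz (hs : s ∈ Ioo (0 : ℝ) 1) (hN : 2 * s < N)
    {Ψ v : EuclideanSpace ℝ (Fin N) → ℝ} (hΨ : Continuous Ψ) (hΨ0 : ∀ x, 0 ≤ Ψ x) {M : ℝ}
    (hΨM : ∀ x, Ψ x ≤ M) (hv : ContDiff ℝ 2 v) (hv0 : ∀ x, 0 ≤ v x) {M' : ℝ}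
    (hvM : ∀ x, v x ≤ M')
    (hvΨ : ∀ x, ENNReal.ofReal (v x) = rieszE s (fun y => ENNReal.ofReal (Ψ y)) x)
    (x : EuclideanSpace ℝ (Fin N)) :
    HasFracLaplacian s v x (fracConst N s * Ψ x) := by
  have hs0 := hs.1
  have hN0 : 0 < N := by
    have : (0 : ℝ) < N := by linarith
    exact_mod_cast this
  have := nontrivial_euclidean hN0
  have hvb : ∀ x, |v x| ≤ M' := fun x => by rw [abs_of_nonneg (hv0 x)]; exact hvM x
  have hM' : 0 ≤ M' := (hv0 0).trans (hvM 0)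
  have hlap := hasFracLaplacian_of_contDiff hs hN0 hv hvb x
  have hDI := integrable_secondDiff hs hN0 hv hvb x
  set Ks := subordConst N s with hKs
  set Kn := subordConst N (-s) with hKn
  have hKs0 : 0 < Ks := subordConst_pos (by linarith)
  have hKn0 : 0 < Kn := subordConst_pos (by linarith)
  set Q := (∫⁻ r in Ioi (0 : ℝ), ENNReal.ofReal (profile s r)) with hQ
  set f : EuclideanSpace ℝ (Fin N) → ℝ≥0∞ := fun y => ENNReal.ofReal (Ψ y) with hf
  have hfc : Continuous f := ENNReal.continuous_ofReal.comp hΨ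
  have hfM : ∀ y, f y ≤ ENNReal.ofReal M := fun y => ENNReal.ofReal_le_ofReal (hΨM y)
  have h0 : ∀ᵐ z : EuclideanSpace ℝ (Fin N), z ≠ 0 := by simp [ae_iff]
  set kd : ℝ → EuclideanSpace ℝ (Fin N) → ℝ := fun δ y => (truncKernel s δ y).toReal with hkd
  have mkd : ∀ δ, Measurable (kd δ) := fun δ => (measurable_truncKernel δ).ennreal_toReal
  -- the truncated identity, in terms of real integrals
  have step : ∀ δ : ℝ, 0 < δ → Ks * (1 / 2 * ∫ y, kd δ y * secondDiff v x y) =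
      (∫⁻ r in Ioi (0 : ℝ), ENNReal.ofReal (profile s r) * heatAvg f x (δ * r)).toReal := by
    intro δ hδ
    have hmass := lintegral_truncKernel (N := N) δ hδ hs0
    have hfin : ∫⁻ y : EuclideanSpace ℝ (Fin N), truncKernel s δ y ≠ ∞ := by
      rw [hmass]; exact ENNReal.ofReal_ne_top
    have hae : ∀ᵐ y : EuclideanSpace ℝ (Fin N), truncKernel s δ y < ∞ :=
      ae_lt_top (measurable_truncKernel δ) hfin
    have hkI : Integrable (kd δ) :=
      integrable_toReal_of_lintegral_ne_top (measurable_truncKernel δ).aemeasurable hfin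
    have hkint : ∫ y, kd δ y = δ ^ (-s) / s := by
      rw [hkd, integral_toReal (measurable_truncKernel δ).aemeasurable hae, hmass,
        ENNReal.toReal_ofReal (by positivity)]
    have hvk : ∀ g : EuclideanSpace ℝ (Fin N) → EuclideanSpace ℝ (Fin N), Continuous g →
        Integrable fun y => kd δ y * v (g y) := fun g hg => by
      refine (hkI.const_mul M').mono' ?_ (Eventually.of_forall fun y => ?_)
      · exact ((mkd δ).mul ((hv.continuous.comp hg).measurable)).aestronglyMeasurable
      · rw [norm_mul, mul_comm, Real.norm_eq_abs, Real.norm_of_nonneg ENNReal.toReal_nonneg]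
        exact mul_le_mul_of_nonneg_right (hvb _) ENNReal.toReal_nonneg
    have i1 := hvk (fun y => x + y) (by fun_prop)
    have i2 := hvk (fun y => x - y) (by fun_prop)
    have e1 : ∫ y, kd δ y * v (x + y) = ∫ y, kd δ y * v (x - y) := by
      rw [← integral_neg_eq_self]
      refine integral_congr_ae (Eventually.of_forall fun y => ?_)
      simp [hkd, truncKernel_neg, sub_eq_add_neg]
    have e2 : ∫ y, kd δ y * secondDiff v x y = 2 * (v x * (δ ^ (-s) / s) - ∫ y, kd δ y * v (x - y)) := by
      have : (fun y => kd δ y * secondDiff v x y) =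
          fun y => (2 * v x) * kd δ y - kd δ y * v (x + y) - kd δ y * v (x - y) := by
        funext y; unfold secondDiff; ring
      have j : Integrable fun y => (2 * v x) * kd δ y - kd δ y * v (x + y) :=
        (hkI.const_mul _).sub i1
      rw [this, integral_sub j i2, integral_sub (hkI.const_mul _) i1, e1,
        integral_const_mul, hkint]
      ring
    have e3 : ∫⁻ y, truncKernel s δ y * (ENNReal.ofReal Ks * rieszE s f (x - y)) =
        ENNReal.ofReal (Ks * ∫ y, kd δ y * v (x - y)) := by
      rw [← integral_const_mul, ofReal_integral_eq_lintegral_ofReal (i2.const_mul _)]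
      · refine lintegral_congr_ae ?_
        filter_upwards [hae] with y hy
        rw [← hvΨ, ENNReal.ofReal_mul hKs0.le, ENNReal.ofReal_mul ENNReal.toReal_nonneg,
          ENNReal.ofReal_toReal hy.ne]
        ring
      · exact Eventually.of_forall fun y => mul_nonneg hKs0.le
          (mul_nonneg ENNReal.toReal_nonneg (hv0 _))
    have key := truncated_fracLaplacian_rieszE hN0 hs0 (by linarith : s < N / 2) hfc.measurable hδ x
    rw [e3, ← hvΨ, ← ENNReal.ofReal_mul hKs0.le, ← ENNReal.ofReal_mul (by positivity)] at key
    have hnn : 0 ≤ ∫ y, kd δ y * v (x - y) :=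
      integral_nonneg fun y => mul_nonneg ENNReal.toReal_nonneg (hv0 _)
    have hR : ∫⁻ r in Ioi (0 : ℝ), ENNReal.ofReal (profile s r) * heatAvg f x (δ * r) ≠ ∞ := by
      intro hc
      rw [hc, add_top] at key
      exact ENNReal.ofReal_ne_top key.symm
    have key2 := congrArg ENNReal.toReal key
    rw [ENNReal.toReal_add ENNReal.ofReal_ne_top hR, ENNReal.toReal_ofReal (by positivity),
      ENNReal.toReal_ofReal (by have := hv0 x; positivity)] at key2
    rw [e2]
    linear_combination -key2
  -- both sides converge as the truncation is removed
  have lim1 : Tendsto (fun δ => ∫ y, kd δ y * secondDiff v x y) (𝓝[>] 0)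
      (𝓝 (∫ y, Kn * (secondDiff v x y / ‖y‖ ^ ((N : ℝ) + 2 * s)))) := by
    refine tendsto_integral_filter_of_dominated_convergence
      (fun y => Kn * ‖secondDiff v x y / ‖y‖ ^ ((N : ℝ) + 2 * s)‖) (Eventually.of_forall fun δ => ?_)
      ?_ (hDI.norm.const_mul _) ?_
    · refine ((mkd δ).mul ?_).aestronglyMeasurable
      have := hv.continuous
      unfold secondDiff
      fun_prop
    · filter_upwards [self_mem_nhdsWithin] with δ hδ
      filter_upwards [h0] with y hy
      have hb := ENNReal.toReal_mono ENNReal.ofReal_ne_top (truncKernel_le hs0 (mem_Ioi.1 hδ).le hy)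
      rw [ENNReal.toReal_ofReal (by positivity), Real.rpow_neg (norm_nonneg _)] at hb
      rw [norm_mul, norm_div, Real.norm_of_nonneg ENNReal.toReal_nonneg,
        Real.norm_of_nonneg (by positivity : 0 ≤ ‖y‖ ^ ((N : ℝ) + 2 * s))]
      calc kd δ y * ‖secondDiff v x y‖ ≤ (Kn * (‖y‖ ^ ((N : ℝ) + 2 * s))⁻¹) * ‖secondDiff v x y‖ := by
            gcongr
        _ = _ := by ring
    · filter_upwards [h0] with y hy
      have ht := (ENNReal.tendsto_toReal ENNReal.ofReal_ne_top).comp (tendsto_truncKernel hs0 hy)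
      rw [ENNReal.toReal_ofReal (by positivity), Real.rpow_neg (norm_nonneg _)] at ht
      have := ht.mul_const (secondDiff v x y)
      refine this.trans_eq ?_
      congr 1; rw [← hKn]; ring
  have lim2 := (ENNReal.tendsto_toReal (ENNReal.mul_ne_top (lintegral_profile_lt_top hs).ne
    (ENNReal.ofReal_ne_top (r := Ψ x)))).comp
    (tendsto_lintegral_profile_mul_heatAvg hs hfc ENNReal.ofReal_ne_top hfM x)
  have lim3 := (lim1.const_mul (1 / 2)).const_mul Ks
  have heq := tendsto_nhds_unique (lim3.congr' (by
    filter_upwards [self_mem_nhdsWithin] with δ hδ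
    exact step δ hδ)) lim2
  rw [integral_const_mul, ENNReal.toReal_mul, ENNReal.toReal_ofReal (hΨ0 x)] at heq
  convert hlap using 1
  unfold fracConst
  rw [← hQ, ← hKs, ← hKn]
  field_simp
  linear_combination (-2) * heq

/-! ### Continuous potentials and their mollification -/

/-- `IsPotential s Ψ u`: the bounded continuous function `u ≥ 0` is the Riesz potential of the
bounded continuous density `Ψ ≥ 0`. -/
structure IsPotential (s : ℝ) (Ψ u : EuclideanSpace ℝ (Fin N) → ℝ) : Prop where
  continuous_density : Continuous Ψ
  density_nonneg : ∀ x, 0 ≤ Ψ x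
  density_bounded : ∃ M, ∀ x, Ψ x ≤ M
  continuous : Continuous u
  nonneg : ∀ x, 0 ≤ u x
  bounded : ∃ M, ∀ x, u x ≤ M
  eq_riesz : ∀ x, ENNReal.ofReal (u x) = rieszE s (fun y => ENNReal.ofReal (Ψ y)) x

/-- Mollification by a normalized smooth bump function. -/
def moll (φ : ContDiffBump (0 : EuclideanSpace ℝ (Fin N))) (u : EuclideanSpace ℝ (Fin N) → ℝ) :
    EuclideanSpace ℝ (Fin N) → ℝ :=
  convolution (φ.normed volume) u (ContinuousLinearMap.lsmul ℝ ℝ) volume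

section Moll

variable {φ : ContDiffBump (0 : EuclideanSpace ℝ (Fin N))} {u : EuclideanSpace ℝ (Fin N) → ℝ}

theorem moll_apply (x : EuclideanSpace ℝ (Fin N)) :
    moll φ u x = ∫ t, φ.normed volume t * u (x - t) := rfl

theorem contDiff_moll (hu : Continuous u) : ContDiff ℝ 2 (moll φ u) :=
  HasCompactSupport.contDiff_convolution_left (n := 2) _ φ.hasCompactSupport_normed φ.contDiff_normed
    hu.locallyIntegrable

theorem continuous_moll (hu : Continuous u) : Continuous (moll φ u) := (contDiff_moll hu).continuous

theorem integrable_moll (hu : Continuous u) (x : EuclideanSpace ℝ (Fin N)) :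
    Integrable fun t => φ.normed volume t * u (x - t) := by
  have : Continuous fun t => φ.normed volume t * u (x - t) :=
    φ.continuous_normed.mul (hu.comp (by fun_prop))
  exact this.integrable_of_hasCompactSupport φ.hasCompactSupport_normed.mul_right

theorem moll_nonneg (hu : ∀ x, 0 ≤ u x) (x : EuclideanSpace ℝ (Fin N)) : 0 ≤ moll φ u x :=
  integral_nonneg fun t => mul_nonneg (φ.nonneg_normed t) (hu _)

theorem normed_eq_zero_of_le {t : EuclideanSpace ℝ (Fin N)} (ht : φ.rOut ≤ ‖t‖) :
    φ.normed volume t = 0 := by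
  have := φ.support_normed_eq (μ := (volume : Measure (EuclideanSpace ℝ (Fin N))))
  by_contra hc
  have h2 : t ∈ Function.support (φ.normed (volume : Measure (EuclideanSpace ℝ (Fin N)))) := hc
  rw [this] at h2
  have : ‖t‖ < φ.rOut := by simpa using h2
  linarith

theorem moll_mono (hu : Continuous u) {v : EuclideanSpace ℝ (Fin N) → ℝ} (hv : Continuous v)
    {x : EuclideanSpace ℝ (Fin N)} (h : ∀ t, ‖t‖ < φ.rOut → u (x - t) ≤ v (x - t)) :
    moll φ u x ≤ moll φ v x := by
  refine integral_mono (integrable_moll hu x) (integrable_moll hv x) fun t => ?_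
  by_cases ht : ‖t‖ < φ.rOut
  · exact mul_le_mul_of_nonneg_left (h t ht) (φ.nonneg_normed t)
  · change φ.normed volume t * u (x - t) ≤ φ.normed volume t * v (x - t)
    rw [normed_eq_zero_of_le (not_lt.1 ht)]; simp

theorem moll_const (c : ℝ) (x : EuclideanSpace ℝ (Fin N)) : moll φ (fun _ => c) x = c := by
  rw [moll_apply, integral_mul_const, φ.integral_normed, one_mul]

theorem moll_le (hu : Continuous u) {M : ℝ} {x : EuclideanSpace ℝ (Fin N)}
    (h : ∀ t, ‖t‖ < φ.rOut → u (x - t) ≤ M) : moll φ u x ≤ M :=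
  (moll_mono hu continuous_const h).trans_eq (moll_const M x)

theorem le_moll (hu : Continuous u) {M : ℝ} {x : EuclideanSpace ℝ (Fin N)}
    (h : ∀ t, ‖t‖ < φ.rOut → M ≤ u (x - t)) : M ≤ moll φ u x :=
  (moll_const M x).symm.trans_le (moll_mono continuous_const hu h)

theorem abs_moll_sub_le (hu : Continuous u) {ε : ℝ} {x : EuclideanSpace ℝ (Fin N)}
    (h : ∀ t, ‖t‖ < φ.rOut → |u (x - t) - u x| ≤ ε) : |moll φ u x - u x| ≤ ε := by
  rw [abs_le]
  constructor
  · have : u x - ε ≤ moll φ u x := le_moll hu fun t ht => by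
      have := (abs_le.1 (h t ht)).1; linarith
    linarith
  · have : moll φ u x ≤ u x + ε := moll_le hu fun t ht => by
      have := (abs_le.1 (h t ht)).2; linarith
    linarith

theorem exists_moll_close (hu : UniformContinuous u) {ε : ℝ} (hε : 0 < ε) :
    ∃ η > 0, ∀ φ : ContDiffBump (0 : EuclideanSpace ℝ (Fin N)), φ.rOut ≤ η →
      ∀ x, |moll φ u x - u x| ≤ ε := by
  obtain ⟨η, hη, h⟩ := Metric.uniformContinuous_iff.1 hu ε hε
  refine ⟨η, hη, fun φ hφ x => abs_moll_sub_le hu.continuous fun t ht => ?_⟩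
  have := h (a := x - t) (b := x) (by rw [dist_eq_norm]; simpa using ht.trans_le hφ)
  exact this.le

/-- A bump function of arbitrarily small outer radius. -/
theorem exists_bump_rOut_le {η : ℝ} (hη : 0 < η) :
    ∃ φ : ContDiffBump (0 : EuclideanSpace ℝ (Fin N)), φ.rOut ≤ η :=
  ⟨⟨η / 2, η, by linarith, by linarith⟩, le_rfl⟩

theorem norm_convolution_le {A B F : Type*} [NormedAddCommGroup A] [NormedSpace ℝ A]
    [NormedAddCommGroup B] [NormedSpace ℝ B] [NormedAddCommGroup F] [NormedSpace ℝ F]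
    (L : A →L[ℝ] B →L[ℝ] F) {f : EuclideanSpace ℝ (Fin N) → A} (hf : Integrable f)
    {g : EuclideanSpace ℝ (Fin N) → B} {M : ℝ} (hM : ∀ x, ‖g x‖ ≤ M)
    (x : EuclideanSpace ℝ (Fin N)) :
    ‖convolution f g L volume x‖ ≤ ‖L‖ * M * ∫ t, ‖f t‖ := by
  rw [convolution_def, ← integral_const_mul]
  refine norm_integral_le_of_norm_le (hf.norm.const_mul _) (Eventually.of_forall fun t => ?_)
  calc ‖L (f t) (g (x - t))‖ ≤ ‖L‖ * ‖f t‖ * ‖g (x - t)‖ := L.le_opNorm₂ _ _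
    _ ≤ ‖L‖ * ‖f t‖ * M := by gcongr; exact hM _
    _ = _ := by ring

/-- The convolution of a compactly supported `C¹` function with a bounded function is Lipschitz,
and its derivative is the convolution of the derivative. -/
theorem convolution_fderiv_bound {A F : Type*} [NormedAddCommGroup A] [NormedSpace ℝ A]
    [NormedAddCommGroup F] [NormedSpace ℝ F] (L : A →L[ℝ] ℝ →L[ℝ] F)
    {g : EuclideanSpace ℝ (Fin N) → A} (hg : ContDiff ℝ 1 g) (hgs : HasCompactSupport g)
    (hu : Continuous u) {M : ℝ} (hM : ∀ x, ‖u x‖ ≤ M) :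
    fderiv ℝ (convolution g u L volume) =
        convolution (fderiv ℝ g) u (L.precompL (EuclideanSpace ℝ (Fin N))) volume ∧
      (∃ C, ∀ x, ‖fderiv ℝ (convolution g u L volume) x‖ ≤ C) ∧
      ∃ K, LipschitzWith K (convolution g u L volume) := by
  have hi : Integrable (fderiv ℝ g) :=
    (hg.continuous_fderiv (by norm_num)).integrable_of_hasCompactSupport (hgs.fderiv ℝ)
  have d1 : ∀ x, HasFDerivAt (convolution g u L volume)
      (convolution (fderiv ℝ g) u (L.precompL _) volume x) x :=
    fun x => HasCompactSupport.hasFDerivAt_convolution_left L hgs hg hu.locallyIntegrable x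
  obtain ⟨C, hb⟩ : ∃ C, ∀ x, ‖convolution (fderiv ℝ g) u
      (L.precompL (EuclideanSpace ℝ (Fin N))) volume x‖ ≤ C := ⟨_, norm_convolution_le _ hi hM⟩
  have hK0 := (norm_nonneg _).trans (hb 0)
  refine ⟨funext fun x => (d1 x).fderiv, ⟨C, fun x => ?_⟩, ⟨⟨C, hK0⟩,
    lipschitzWith_of_nnnorm_fderiv_le (𝕜 := ℝ) (fun x => (d1 x).differentiableAt) fun x => ?_⟩⟩
  · rw [(d1 x).fderiv]; exact hb x
  · rw [(d1 x).fderiv]; exact hb x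

/-- The mollification of a bounded function has uniform `C^{1,1}` bounds. -/
theorem isUniformC11_moll (hu : Continuous u) {M : ℝ} (hM : ∀ x, |u x| ≤ M) :
    IsUniformC11 (moll φ u) := by
  have hg2 : ContDiff ℝ 2 (φ.normed (volume : Measure (EuclideanSpace ℝ (Fin N)))) :=
    φ.contDiff_normed
  have hgs := φ.hasCompactSupport_normed (μ := (volume : Measure (EuclideanSpace ℝ (Fin N))))
  obtain ⟨e, ⟨C, hC⟩, -⟩ := convolution_fderiv_bound (ContinuousLinearMap.lsmul ℝ ℝ)
    (hg2.of_le (by norm_num)) hgs hu hM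
  obtain ⟨-, -, K, hK⟩ := convolution_fderiv_bound
    ((ContinuousLinearMap.lsmul ℝ ℝ : ℝ →L[ℝ] ℝ →L[ℝ] ℝ).precompL (EuclideanSpace ℝ (Fin N)))
    (hg2.fderiv_right (m := 1) (by norm_num)) (hgs.fderiv ℝ) hu hM
  refine ⟨(contDiff_moll hu).of_le (by norm_num), ⟨max M C, fun x => ⟨le_max_of_le_left ?_,
    le_max_of_le_right (hC x)⟩⟩, K, ?_⟩
  · exact abs_le.2 ⟨le_moll hu fun t _ => (abs_le.1 (hM _)).1, moll_le hu fun t _ => (abs_le.1 (hM _)).2⟩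
  · have : fderiv ℝ (moll φ u) = _ := e
    rw [this]
    exact hK

end Moll

namespace IsPotential

variable {Ψ u Ψ' u' : EuclideanSpace ℝ (Fin N) → ℝ}

theorem measurable_ofReal (h : IsPotential s Ψ u) : Measurable fun y => ENNReal.ofReal (Ψ y) :=
  h.continuous_density.measurable.ennreal_ofReal

theorem moll (h : IsPotential s Ψ u) (φ : ContDiffBump (0 : EuclideanSpace ℝ (Fin N))) :
    IsPotential s (moll φ Ψ) (moll φ u) where
  continuous_density := continuous_moll h.continuous_density
  density_nonneg := moll_nonneg h.density_nonneg
  density_bounded := h.density_bounded.imp fun _ hM _ =>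
    moll_le h.continuous_density fun _ _ => hM _
  continuous := continuous_moll h.continuous
  nonneg := moll_nonneg h.nonneg
  bounded := h.bounded.imp fun _ hM _ => moll_le h.continuous fun _ _ => hM _
  eq_riesz := fun x => by
    have e : ∀ (v : EuclideanSpace ℝ (Fin N) → ℝ), Continuous v → (∀ x, 0 ≤ v x) → ∀ x,
        ENNReal.ofReal (FracSchrodinger.moll φ v x) =
          ∫⁻ t, ENNReal.ofReal (φ.normed volume t) * ENNReal.ofReal (v (x - t)) := by
      intro v hv hv0 x
      rw [moll_apply, ofReal_integral_eq_lintegral_ofReal (integrable_moll hv x)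
        (Eventually.of_forall fun t => mul_nonneg (φ.nonneg_normed t) (hv0 _))]
      exact lintegral_congr fun t => ENNReal.ofReal_mul (φ.nonneg_normed t)
    rw [e u h.continuous h.nonneg]
    unfold rieszE
    simp_rw [e Ψ h.continuous_density h.density_nonneg, h.eq_riesz]
    unfold rieszE
    simp_rw [← lintegral_const_mul' _ _ (ENNReal.ofReal_ne_top)]
    have hφ := (φ.continuous_normed (μ := (volume : Measure (EuclideanSpace ℝ (Fin N))))).measurable
    have hm := h.measurable_ofReal
    have hsw : AEMeasurable (Function.uncurry fun (t z : EuclideanSpace ℝ (Fin N)) =>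
        ENNReal.ofReal (φ.normed volume t) * (ENNReal.ofReal (‖z‖ ^ (2 * s - N)) *
          ENNReal.ofReal (Ψ (x - t - z)))) (volume.prod volume) := by
      refine Measurable.aemeasurable ?_
      exact ((hφ.comp measurable_fst).ennreal_ofReal).mul
        (Measurable.mul (by fun_prop) (hm.comp (by fun_prop)))
    rw [lintegral_lintegral_swap hsw]
    refine lintegral_congr fun z => lintegral_congr fun t => ?_
    rw [mul_left_comm, sub_right_comm]

theorem add (h : IsPotential s Ψ u) (h' : IsPotential s Ψ' u') :
    IsPotential s (fun x => Ψ x + Ψ' x) (fun x => u x + u' x) where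
  continuous_density := h.continuous_density.add h'.continuous_density
  density_nonneg := fun x => add_nonneg (h.density_nonneg x) (h'.density_nonneg x)
  density_bounded := by
    obtain ⟨M, hM⟩ := h.density_bounded
    obtain ⟨M', hM'⟩ := h'.density_bounded
    exact ⟨M + M', fun x => add_le_add (hM x) (hM' x)⟩
  continuous := h.continuous.add h'.continuous
  nonneg := fun x => add_nonneg (h.nonneg x) (h'.nonneg x)
  bounded := by
    obtain ⟨M, hM⟩ := h.bounded
    obtain ⟨M', hM'⟩ := h'.bounded
    exact ⟨M + M', fun x => add_le_add (hM x) (hM' x)⟩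
  eq_riesz := fun x => by
    rw [ENNReal.ofReal_add (h.nonneg x) (h'.nonneg x), h.eq_riesz, h'.eq_riesz]
    unfold rieszE
    rw [← lintegral_add_left]
    · refine lintegral_congr fun z => ?_
      beta_reduce
      rw [ENNReal.ofReal_add (h.density_nonneg _) (h'.density_nonneg _), mul_add]
    · exact Measurable.mul (by fun_prop) (h.measurable_ofReal.comp (by fun_prop))

theorem hasFracLaplacian (hs : s ∈ Ioo (0 : ℝ) 1) (hN : 2 * s < N) (h : IsPotential s Ψ u)
    (hu : ContDiff ℝ 2 u) (x : EuclideanSpace ℝ (Fin N)) :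
    HasFracLaplacian s u x (fracConst N s * Ψ x) := by
  obtain ⟨M, hM⟩ := h.density_bounded
  obtain ⟨M', hM'⟩ := h.bounded
  exact hasFracLaplacian_riesz hs hN h.continuous_density h.density_nonneg hM hu h.nonneg hM'
    h.eq_riesz x

end IsPotential

/-! ### Rules for the fractional Laplacian -/

section Rules

variable {u v : EuclideanSpace ℝ (Fin N) → ℝ} {x : EuclideanSpace ℝ (Fin N)} {ℓ m : ℝ}

theorem HasFracLaplacian.const_mul (h : HasFracLaplacian s u x ℓ) (c : ℝ) :
    HasFracLaplacian s (fun y => c * u y) x (c * ℓ) := by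
  have e : ∀ y, (c * u x - c * u y) / ‖x - y‖ ^ ((N : ℝ) + 2 * s) =
      c * ((u x - u y) / ‖x - y‖ ^ ((N : ℝ) + 2 * s)) := fun y => by ring
  refine ⟨fun r hr => ?_, ?_⟩
  · simp_rw [e]; exact (h.1 r hr).const_mul c
  · simp_rw [e, integral_const_mul]; exact h.2.const_mul c

theorem HasFracLaplacian.add (h : HasFracLaplacian s u x ℓ) (h' : HasFracLaplacian s v x m) :
    HasFracLaplacian s (fun y => u y + v y) x (ℓ + m) := by
  have e : ∀ y, (u x + v x - (u y + v y)) / ‖x - y‖ ^ ((N : ℝ) + 2 * s) =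
      (u x - u y) / ‖x - y‖ ^ ((N : ℝ) + 2 * s) + (v x - v y) / ‖x - y‖ ^ ((N : ℝ) + 2 * s) :=
    fun y => by ring
  refine ⟨fun r hr => ?_, ?_⟩
  · simp_rw [e]; exact (h.1 r hr).add (h'.1 r hr)
  · refine (h.2.add h'.2).congr' ?_
    filter_upwards [self_mem_nhdsWithin] with r hr
    simp_rw [e]
    exact (integral_add (h.1 r hr) (h'.1 r hr)).symm

theorem HasFracLaplacian.sub (h : HasFracLaplacian s u x ℓ) (h' : HasFracLaplacian s v x m) :
    HasFracLaplacian s (fun y => u y - v y) x (ℓ - m) := by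
  have := h.add (h'.const_mul (-1))
  simpa [sub_eq_add_neg] using this

/-- If `u ≤ v` with equality at `x`, then the fractional Laplacians at `x` are ordered the other
way round. -/
theorem HasFracLaplacian.le_of_touching (h : HasFracLaplacian s u x ℓ)
    (h' : HasFracLaplacian s v x m) (hle : ∀ y, u y ≤ v y) (heq : u x = v x) : m ≤ ℓ := by
  refine le_of_tendsto_of_tendsto h'.2 h.2 ?_
  filter_upwards [self_mem_nhdsWithin] with r hr
  refine integral_mono (h'.1 r hr) (h.1 r hr) fun y => ?_
  beta_reduce
  gcongr
  · exact heq.ge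
  · exact hle y

/-- At a global maximum point the fractional Laplacian is positive, unless the function is
constant. -/
theorem HasFracLaplacian.pos_of_max (hu : Continuous u) (h : HasFracLaplacian s u x ℓ)
    (hmax : ∀ y, u y ≤ u x) {z : EuclideanSpace ℝ (Fin N)} (hz : u z < u x) : 0 < ℓ := by
  have hzx : z ≠ x := fun hc => by rw [hc] at hz; exact lt_irrefl _ hz
  set r₀ := ‖x - z‖ / 2 with hr₀
  have hd : 0 < ‖x - z‖ := norm_pos_iff.2 (sub_ne_zero.2 hzx.symm)
  have hr₀0 : 0 < r₀ := by positivity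
  set F := fun y => (u x - u y) / ‖x - y‖ ^ ((N : ℝ) + 2 * s) with hF
  have hFnn : ∀ y, 0 ≤ F y := fun y => div_nonneg (sub_nonneg.2 (hmax y)) (by positivity)
  have hpos : 0 < ∫ y in (Metric.ball x r₀)ᶜ, F y := by
    rw [integral_pos_iff_support_of_nonneg hFnn (h.1 r₀ hr₀0),
      Measure.restrict_apply' Metric.isOpen_ball.measurableSet.compl]
    have hopen : IsOpen ({y | u y < u x} ∩ (Metric.closedBall x r₀)ᶜ) :=
      (isOpen_lt hu continuous_const).inter Metric.isClosed_closedBall.isOpen_compl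
    refine (hopen.measure_pos volume ⟨z, hz, ?_⟩).trans_le (measure_mono ?_)
    · simp only [mem_compl_iff, Metric.mem_closedBall, not_le, dist_eq_norm, norm_sub_rev z x]
      linarith
    · rintro y ⟨hy1, hy2⟩
      refine ⟨?_, fun hc => hy2 (Metric.ball_subset_closedBall hc)⟩
      have hy3 : r₀ < ‖x - y‖ := by
        simpa [dist_eq_norm, norm_sub_rev] using hy2
      have : 0 < ‖x - y‖ := hr₀0.trans hy3
      exact (div_pos (sub_pos.2 hy1) (by positivity)).ne'
  refine hpos.trans_le (ge_of_tendsto h.2 ?_)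
  have : ∀ᶠ r in 𝓝[>] (0 : ℝ), r < r₀ := mem_nhdsWithin_of_mem_nhds (Iio_mem_nhds hr₀0)
  filter_upwards [self_mem_nhdsWithin, this] with r hr hr2
  refine setIntegral_mono_set (h.1 r hr) (Eventually.of_forall hFnn) ?_
  exact (compl_subset_compl.2 (Metric.ball_subset_ball hr2.le)).eventuallyLE

end Rules

/-! ### Riesz potentials of compactly supported functions -/

/-- The Riesz potential `∫ |z|^(2s - N) Ψ(x - z) dz` of a real function, without a normalizing
constant. -/
def riesz (s : ℝ) (Ψ : EuclideanSpace ℝ (Fin N) → ℝ) (x : EuclideanSpace ℝ (Fin N)) : ℝ :=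
  ∫ z, ‖z‖ ^ (2 * s - N) * Ψ (x - z)

theorem pos_dim (hs : 0 < s) (hN : 2 * s < N) : 0 < N := by
  have : (0 : ℝ) < N := by linarith
  exact_mod_cast this

theorem locallyIntegrable_rieszKernel (hs : 0 < s) (hN : 2 * s < N) :
    LocallyIntegrable fun z : EuclideanSpace ℝ (Fin N) => ‖z‖ ^ (2 * s - N) := by
  rw [locallyIntegrable_iff]
  intro k hk
  obtain ⟨r, hr⟩ := hk.isBounded.subset_ball 0
  have := integrableOn_ball_norm_rpow (pos_dim hs hN) (a := N - 2 * s) (by linarith) r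
  simp only [neg_sub] at this
  exact this.mono_set hr

section CompactSupport

variable {Ψ : EuclideanSpace ℝ (Fin N) → ℝ}

theorem integrable_riesz (hs : 0 < s) (hN : 2 * s < N) (hΨ : Continuous Ψ) (hc : HasCompactSupport Ψ)
    (x : EuclideanSpace ℝ (Fin N)) : Integrable fun z => ‖z‖ ^ (2 * s - N) * Ψ (x - z) :=
  HasCompactSupport.convolutionExists_right (ContinuousLinearMap.mul ℝ ℝ) hc
    (locallyIntegrable_rieszKernel hs hN) hΨ x

theorem continuous_riesz (hs : 0 < s) (hN : 2 * s < N) (hΨ : Continuous Ψ)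
    (hc : HasCompactSupport Ψ) : Continuous (riesz s Ψ) :=
  HasCompactSupport.continuous_convolution_right (ContinuousLinearMap.mul ℝ ℝ) hc
    (locallyIntegrable_rieszKernel hs hN) hΨ

theorem riesz_nonneg (hΨ0 : ∀ x, 0 ≤ Ψ x) (x : EuclideanSpace ℝ (Fin N)) : 0 ≤ riesz s Ψ x :=
  integral_nonneg fun z => mul_nonneg (by positivity) (hΨ0 _)

/-- Away from the support of the density, its potential is bounded by the total mass. -/
theorem riesz_le_of_dist (hs : 0 < s) (hN : 2 * s < N) (hΨ : Continuous Ψ)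
    (hc : HasCompactSupport Ψ) (hΨ0 : ∀ x, 0 ≤ Ψ x) {x : EuclideanSpace ℝ (Fin N)} {d : ℝ} (hd : 0 < d)
    (h : ∀ y, Ψ y ≠ 0 → d ≤ ‖x - y‖) : riesz s Ψ x ≤ d ^ (2 * s - N) * ∫ y, Ψ y := by
  have hi : Integrable Ψ := hΨ.integrable_of_hasCompactSupport hc
  rw [← integral_const_mul, riesz, ← integral_sub_left_eq_self (fun y => d ^ (2 * s - N) * Ψ y) _ x]
  refine integral_mono (integrable_riesz hs hN hΨ hc x) ((hi.const_mul _).comp_sub_left x) fun z => ?_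
  beta_reduce
  by_cases hz : Ψ (x - z) = 0
  · simp [hz]
  · have := h _ hz
    rw [sub_sub_cancel] at this
    refine mul_le_mul_of_nonneg_right ?_ (hΨ0 _)
    exact Real.rpow_le_rpow_of_nonpos hd this (by linarith)

/-- The total mass of a density is controlled by the value of its potential at any point near the
support. -/
theorem mass_le_riesz (hs : 0 < s) (hN : 2 * s < N) (hΨ : Continuous Ψ)
    (hc : HasCompactSupport Ψ) (hΨ0 : ∀ x, 0 ≤ Ψ x) {x : EuclideanSpace ℝ (Fin N)} {r : ℝ}
    (h : ∀ y, Ψ y ≠ 0 → ‖x - y‖ ≤ r) : ∫ y, Ψ y ≤ r ^ (N - 2 * s) * riesz s Ψ x := by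
  have := nontrivial_euclidean (pos_dim hs hN)
  have hi : Integrable Ψ := hΨ.integrable_of_hasCompactSupport hc
  rw [riesz, ← integral_const_mul, ← integral_sub_left_eq_self Ψ _ x]
  refine integral_mono_ae (hi.comp_sub_left x) ((integrable_riesz hs hN hΨ hc x).const_mul _) ?_
  have h0 : ∀ᵐ z : EuclideanSpace ℝ (Fin N), z ≠ 0 := by simp [ae_iff]
  filter_upwards [h0] with z hz
  by_cases hz' : Ψ (x - z) = 0
  · simp [hz']
  · have h1 := h _ hz'
    rw [sub_sub_cancel] at h1
    have hz0 : 0 < ‖z‖ := norm_pos_iff.2 hz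
    have h2 : 1 ≤ r ^ (N - 2 * s) * ‖z‖ ^ (2 * s - N) := by
      rw [show 2 * s - (N : ℝ) = -(N - 2 * s) by ring, Real.rpow_neg hz0.le, ← div_eq_mul_inv,
        one_le_div (by positivity)]
      exact Real.rpow_le_rpow hz0.le h1 (by linarith)
    calc Ψ (x - z) = 1 * Ψ (x - z) := (one_mul _).symm
      _ ≤ (r ^ (N - 2 * s) * ‖z‖ ^ (2 * s - N)) * Ψ (x - z) :=
        mul_le_mul_of_nonneg_right h2 (hΨ0 _)
      _ = _ := by ring

theorem abs_riesz_le (hs : 0 < s) (hN : 2 * s < N) (hΨ : Continuous Ψ) (hc : HasCompactSupport Ψ)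
    (x : EuclideanSpace ℝ (Fin N)) : |riesz s Ψ x| ≤ riesz s (fun y => |Ψ y|) x := by
  have hca : HasCompactSupport fun y => |Ψ y| := hc.comp_left (g := fun t : ℝ => |t|) abs_zero
  rw [riesz, riesz, ← Real.norm_eq_abs]
  refine norm_integral_le_of_norm_le (integrable_riesz hs hN hΨ.abs hca x)
    (Eventually.of_forall fun z => ?_)
  rw [norm_mul, Real.norm_of_nonneg (by positivity), Real.norm_eq_abs]

theorem tendsto_riesz_cobounded (hs : 0 < s) (hN : 2 * s < N) (hΨ : Continuous Ψ)
    (hc : HasCompactSupport Ψ) :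
    Tendsto (riesz s Ψ) (Bornology.cobounded (EuclideanSpace ℝ (Fin N))) (𝓝 0) := by
  have hca : HasCompactSupport fun y => |Ψ y| := hc.comp_left (g := fun t : ℝ => |t|) abs_zero
  obtain ⟨R, hR⟩ := hc.isCompact.isBounded.subset_closedBall 0
  have hb : ∀ᶠ x in Bornology.cobounded (EuclideanSpace ℝ (Fin N)),
      |riesz s Ψ x| ≤ (‖x‖ / 2) ^ (2 * s - N) * ∫ y, |Ψ y| := by
    have h1 : ∀ᶠ x : EuclideanSpace ℝ (Fin N) in Bornology.cobounded _, max (2 * R) 1 ≤ ‖x‖ :=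
      tendsto_norm_cobounded_atTop.eventually_ge_atTop _
    filter_upwards [h1] with x hx
    have hx1 : 1 ≤ ‖x‖ := (le_max_right _ _).trans hx
    have hx2 : 2 * R ≤ ‖x‖ := (le_max_left _ _).trans hx
    refine (abs_riesz_le hs hN hΨ hc x).trans
      (riesz_le_of_dist (d := ‖x‖ / 2) hs hN hΨ.abs hca (fun _ => abs_nonneg _) (by linarith) fun y hy => ?_)
    have : y ∈ Metric.closedBall (0 : EuclideanSpace ℝ (Fin N)) R :=
      hR (subset_tsupport _ (by simpa using hy))
    rw [mem_closedBall_zero_iff] at this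
    have := norm_sub_norm_le x y
    linarith
  have hlim : Tendsto (fun x : EuclideanSpace ℝ (Fin N) => (‖x‖ / 2) ^ (2 * s - N) * ∫ y, |Ψ y|)
      (Bornology.cobounded _) (𝓝 0) := by
    have h2 : Tendsto (fun x : EuclideanSpace ℝ (Fin N) => ‖x‖ / 2) (Bornology.cobounded _) atTop :=
      tendsto_norm_cobounded_atTop.atTop_div_const (by norm_num)
    have h3 := (tendsto_rpow_neg_atTop (y := N - 2 * s) (by linarith)).comp h2
    have h4 := h3.mul_const (∫ y, |Ψ y|)
    rw [zero_mul] at h4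
    refine h4.congr fun x => ?_
    simp only [Function.comp, neg_sub]
  exact squeeze_zero_norm' (by simpa using hb) hlim

theorem exists_bound_of_tendsto_cobounded {u : EuclideanSpace ℝ (Fin N) → ℝ} (hu : Continuous u)
    (h : Tendsto u (Bornology.cobounded (EuclideanSpace ℝ (Fin N))) (𝓝 0)) : ∃ M, ∀ x, |u x| ≤ M := by
  have h1 : ∀ᶠ x in Bornology.cobounded (EuclideanSpace ℝ (Fin N)), |u x| ≤ 1 := by
    have := h.abs
    rw [abs_zero] at this
    exact (this.eventually (Iio_mem_nhds one_pos)).mono fun x hx => le_of_lt hx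
  rw [Filter.Eventually, ← Bornology.isCobounded_def] at h1
  obtain ⟨R, hR⟩ := (Bornology.isBounded_compl_iff.2 h1).subset_closedBall 0
  obtain ⟨M, hM⟩ := (isCompact_closedBall (0 : EuclideanSpace ℝ (Fin N)) R).bddAbove_image
    hu.abs.continuousOn
  refine ⟨max M 1, fun x => ?_⟩
  by_cases hx : |u x| ≤ 1
  · exact le_max_of_le_right hx
  · exact le_max_of_le_left (hM ⟨x, hR hx, rfl⟩)

/-- A nonnegative continuous compactly supported density has a bounded continuous potential. -/
theorem isPotential_riesz (hs : 0 < s) (hN : 2 * s < N) (hΨ : Continuous Ψ)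
    (hc : HasCompactSupport Ψ) (hΨ0 : ∀ x, 0 ≤ Ψ x) : IsPotential s Ψ (riesz s Ψ) where
  continuous_density := hΨ
  density_nonneg := hΨ0
  density_bounded := by
    obtain ⟨C, hC⟩ := hc.exists_bound_of_continuous hΨ
    exact ⟨C, fun x => (le_abs_self _).trans (hC x)⟩
  continuous := continuous_riesz hs hN hΨ hc
  nonneg := riesz_nonneg hΨ0
  bounded := by
    obtain ⟨M, hM⟩ := exists_bound_of_tendsto_cobounded (continuous_riesz hs hN hΨ hc)
      (tendsto_riesz_cobounded hs hN hΨ hc)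
    exact ⟨M, fun x => (le_abs_self _).trans (hM x)⟩
  eq_riesz := fun x => by
    rw [riesz, ofReal_integral_eq_lintegral_ofReal (integrable_riesz hs hN hΨ hc x)
      (Eventually.of_forall fun z => mul_nonneg (by positivity) (hΨ0 _))]
    exact lintegral_congr fun z => ENNReal.ofReal_mul (by positivity)

end CompactSupport

/-! ### A positive potential with prescribed power decay -/

theorem setLIntegral_norm_rpow_scale {a r : ℝ} (hr : 0 < r) {A B : Set (EuclideanSpace ℝ (Fin N))}
    (hA : MeasurableSet A) (hB : MeasurableSet B) (h : ∀ z, r⁻¹ • z ∈ A ↔ z ∈ B) :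
    ∫⁻ y in B, ENNReal.ofReal (‖y‖ ^ (-a)) =
      ENNReal.ofReal (r ^ (N - a)) * ∫⁻ y in A, ENNReal.ofReal (‖y‖ ^ (-a)) := by
  set F := A.indicator fun y : EuclideanSpace ℝ (Fin N) =>
    ENNReal.ofReal (r ^ (-a)) * ENNReal.ofReal (‖y‖ ^ (-a)) with hF
  have hsc := lintegral_comp_smul_euclidean (volume : Measure (EuclideanSpace ℝ (Fin N)))
    (inv_pos.2 hr) F
  have e1 : ∫⁻ y in B, ENNReal.ofReal (‖y‖ ^ (-a)) = ∫⁻ z, F (r⁻¹ • z) := by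
    rw [← lintegral_indicator hB]
    refine lintegral_congr fun z => ?_
    rw [hF]
    by_cases hz : z ∈ B
    · rw [indicator_of_mem hz, indicator_of_mem ((h z).2 hz), ← ENNReal.ofReal_mul (by positivity),
        ← Real.mul_rpow hr.le (by positivity), norm_smul,
        norm_inv, Real.norm_of_nonneg hr.le, mul_inv_cancel_left₀ hr.ne']
    · rw [indicator_of_notMem hz, indicator_of_notMem (fun h' => hz ((h z).1 h'))]
  rw [e1, hsc, hF, lintegral_indicator hA, lintegral_const_mul' _ _ ENNReal.ofReal_ne_top,
    ← mul_assoc, ← ENNReal.ofReal_mul (by positivity), finrank_euclideanSpace, Fintype.card_fin,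
    inv_pow, inv_inv, Real.rpow_sub hr, Real.rpow_neg hr.le, Real.rpow_natCast, div_eq_mul_inv]

theorem lintegral_ball_norm_rpow_scale {a r : ℝ} (hr : 0 < r) :
    ∫⁻ y in Metric.ball (0 : EuclideanSpace ℝ (Fin N)) r, ENNReal.ofReal (‖y‖ ^ (-a)) =
      ENNReal.ofReal (r ^ (N - a)) *
        ∫⁻ y in Metric.ball (0 : EuclideanSpace ℝ (Fin N)) 1, ENNReal.ofReal (‖y‖ ^ (-a)) :=
  setLIntegral_norm_rpow_scale hr Metric.isOpen_ball.measurableSet Metric.isOpen_ball.measurableSet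
    fun z => by
      rw [mem_ball_zero_iff, mem_ball_zero_iff, norm_smul, norm_inv, Real.norm_of_nonneg hr.le,
        inv_mul_lt_one₀ hr]

theorem lintegral_compl_ball_norm_rpow_scale {a r : ℝ} (hr : 0 < r) :
    ∫⁻ y in (Metric.ball (0 : EuclideanSpace ℝ (Fin N)) r)ᶜ, ENNReal.ofReal (‖y‖ ^ (-a)) =
      ENNReal.ofReal (r ^ (N - a)) *
        ∫⁻ y in (Metric.ball (0 : EuclideanSpace ℝ (Fin N)) 1)ᶜ, ENNReal.ofReal (‖y‖ ^ (-a)) :=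
  setLIntegral_norm_rpow_scale hr Metric.isOpen_ball.measurableSet.compl
    Metric.isOpen_ball.measurableSet.compl fun z => by
      rw [mem_compl_iff, mem_compl_iff, mem_ball_zero_iff, mem_ball_zero_iff, norm_smul, norm_inv,
        Real.norm_of_nonneg hr.le, inv_mul_lt_one₀ hr]

theorem lintegral_ball_norm_rpow_lt_top (hN : 0 < N) {a : ℝ} (ha : a < N) (r : ℝ) :
    ∫⁻ y in Metric.ball (0 : EuclideanSpace ℝ (Fin N)) r, ENNReal.ofReal (‖y‖ ^ (-a)) < ∞ :=
  (integrableOn_ball_norm_rpow hN ha r).lintegral_lt_top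

theorem lintegral_compl_ball_norm_rpow_lt_top (hN : 0 < N) {a : ℝ} (ha : N < a) {r : ℝ} (hr : 0 < r) :
    ∫⁻ y in (Metric.ball (0 : EuclideanSpace ℝ (Fin N)) r)ᶜ, ENNReal.ofReal (‖y‖ ^ (-a)) < ∞ :=
  (integrableOn_compl_ball_norm_rpow hN ha hr).lintegral_lt_top

/-- The density `(1 + |x|)^(-α - 2s)` has a potential of order at most `(1 + |x|)^(-α)`. -/
theorem exists_rieszE_power_le (hs : 0 < s) {α : ℝ} (hα : 0 < α) (hαN : α < N - 2 * s) :
    ∃ C : ℝ, 0 < C ∧ ∀ x : EuclideanSpace ℝ (Fin N),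
      rieszE s (fun y => ENNReal.ofReal ((1 + ‖y‖) ^ (-(α + 2 * s)))) x ≤
        ENNReal.ofReal (C * (1 + ‖x‖) ^ (-α)) := by
  have hN : 2 * s < N := by linarith
  have hN0 := pos_dim hs hN
  set β := α + 2 * s with hβ
  set γ := (N : ℝ) - 2 * s with hγ
  set I1 := ∫⁻ y in Metric.ball (0 : EuclideanSpace ℝ (Fin N)) 1, ENNReal.ofReal (‖y‖ ^ (-γ)) with hI1
  set I2 := ∫⁻ y in Metric.ball (0 : EuclideanSpace ℝ (Fin N)) 1, ENNReal.ofReal (‖y‖ ^ (-β)) with hI2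
  set I3 := ∫⁻ y in (Metric.ball (0 : EuclideanSpace ℝ (Fin N)) 1)ᶜ,
    ENNReal.ofReal (‖y‖ ^ (-(γ + β))) with hI3
  have f1 : I1 < ∞ := lintegral_ball_norm_rpow_lt_top hN0 (by linarith) 1
  have f2 : I2 < ∞ := lintegral_ball_norm_rpow_lt_top hN0 (by linarith) 1
  have f3 : I3 < ∞ := lintegral_compl_ball_norm_rpow_lt_top hN0 (by linarith) one_pos
  set c1 := (1 / 2 : ℝ) ^ (2 * s - β) with hc1
  set c2 := (1 / 2 : ℝ) ^ (-γ) * 4 ^ (N - β) with hc2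
  set c3 := (1 / 2 : ℝ) ^ (-β) * 3 ^ (N - (γ + β)) with hc3
  have e1 : 2 * s - β = -α := by rw [hβ]; ring
  refine ⟨c1 * I1.toReal + c2 * I2.toReal + c3 * I3.toReal + 1, by positivity, fun x => ?_⟩
  set X := 1 + ‖x‖ with hX
  have hX0 : 0 < X := by positivity
  set g : EuclideanSpace ℝ (Fin N) → ℝ≥0∞ := fun z => ENNReal.ofReal (‖z‖ ^ (2 * s - N)) *
    ENNReal.ofReal ((1 + ‖x - z‖) ^ (-β)) with hg
  have hker : ∀ z : EuclideanSpace ℝ (Fin N), ‖z‖ ^ (2 * s - N) = ‖z‖ ^ (-γ) := fun z => by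
    rw [hγ, neg_sub]
  -- near the singularity of the kernel
  have r1 : ∫⁻ z in Metric.ball 0 (X / 2), g z ≤ ENNReal.ofReal (c1 * I1.toReal * X ^ (-α)) := by
    calc ∫⁻ z in Metric.ball 0 (X / 2), g z
        ≤ ∫⁻ z in Metric.ball (0 : EuclideanSpace ℝ (Fin N)) (X / 2),
            ENNReal.ofReal ((X / 2) ^ (-β)) * ENNReal.ofReal (‖z‖ ^ (-γ)) := by
          refine setLIntegral_mono' Metric.isOpen_ball.measurableSet fun z hz => ?_
          rw [mem_ball_zero_iff] at hz
          rw [hg]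
          beta_reduce
          rw [hker, mul_comm (ENNReal.ofReal (‖z‖ ^ (-γ)))]
          refine mul_le_mul_left (ENNReal.ofReal_le_ofReal ?_) _
          refine Real.rpow_le_rpow_of_nonpos (by positivity) ?_ (by linarith)
          have := norm_sub_norm_le x z
          linarith
      _ = ENNReal.ofReal (c1 * I1.toReal * X ^ (-α)) := by
          rw [lintegral_const_mul' _ _ ENNReal.ofReal_ne_top, lintegral_ball_norm_rpow_scale (by positivity),
            ← hI1, ← mul_assoc, ← ENNReal.ofReal_mul (by positivity), ← Real.rpow_add (by positivity),
            show -β + (N - γ) = 2 * s - β by rw [hγ]; ring, ← ENNReal.ofReal_toReal f1.ne,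
            ← ENNReal.ofReal_mul (by positivity), div_eq_mul_one_div, Real.mul_rpow hX0.le (by norm_num)]
          rw [hc1, e1, ENNReal.toReal_ofReal ENNReal.toReal_nonneg]
          congr 1; ring
  -- at distance comparable to `1 + |x|`
  have r2 : ∫⁻ z in Metric.ball 0 (3 * X) \ Metric.ball 0 (X / 2), g z ≤
      ENNReal.ofReal (c2 * I2.toReal * X ^ (-α)) := by
    have hm : MeasurableSet (Metric.ball (0 : EuclideanSpace ℝ (Fin N)) (3 * X) \ Metric.ball 0 (X / 2)) :=
      Metric.isOpen_ball.measurableSet.diff Metric.isOpen_ball.measurableSet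
    calc ∫⁻ z in Metric.ball 0 (3 * X) \ Metric.ball 0 (X / 2), g z
        ≤ ∫⁻ z in Metric.ball 0 (3 * X) \ Metric.ball 0 (X / 2), ENNReal.ofReal ((X / 2) ^ (-γ)) *
            (Metric.ball 0 (4 * X)).indicator (fun y => ENNReal.ofReal (‖y‖ ^ (-β))) (x - z) := by
          have hae : ∀ᵐ z : EuclideanSpace ℝ (Fin N), z ≠ x := by
            have := nontrivial_euclidean hN0
            simp [ae_iff]
          refine lintegral_mono_ae ((ae_restrict_iff' hm).2 ?_)
          filter_upwards [hae] with z hzx hz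
          have hz1 : ‖z‖ < 3 * X := by simpa using hz.1
          have hz2 : X / 2 ≤ ‖z‖ := by simpa using hz.2
          have hxz : 0 < ‖x - z‖ := norm_pos_iff.2 (sub_ne_zero.2 hzx.symm)
          have hmem : x - z ∈ Metric.ball (0 : EuclideanSpace ℝ (Fin N)) (4 * X) := by
            rw [mem_ball_zero_iff]
            have := norm_sub_le x z
            linarith
          rw [indicator_of_mem hmem, hg]
          beta_reduce
          rw [hker]
          refine mul_le_mul' (ENNReal.ofReal_le_ofReal ?_) (ENNReal.ofReal_le_ofReal ?_)
          · exact Real.rpow_le_rpow_of_nonpos (by positivity) hz2 (by linarith)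
          · exact Real.rpow_le_rpow_of_nonpos hxz (by linarith) (by linarith)
      _ ≤ ∫⁻ z, ENNReal.ofReal ((X / 2) ^ (-γ)) *
            (Metric.ball 0 (4 * X)).indicator (fun y => ENNReal.ofReal (‖y‖ ^ (-β))) (x - z) :=
          setLIntegral_le_lintegral _ _
      _ = ENNReal.ofReal (c2 * I2.toReal * X ^ (-α)) := by
          rw [lintegral_const_mul' _ _ ENNReal.ofReal_ne_top,
            lintegral_sub_left_eq_self ((Metric.ball 0 (4 * X)).indicator
              (fun y : EuclideanSpace ℝ (Fin N) => ENNReal.ofReal (‖y‖ ^ (-β)))) x,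
            lintegral_indicator Metric.isOpen_ball.measurableSet,
            lintegral_ball_norm_rpow_scale (by positivity), ← hI2, ← mul_assoc,
            ← ENNReal.ofReal_mul (by positivity), div_eq_mul_one_div, Real.mul_rpow hX0.le (by norm_num),
            Real.mul_rpow (by norm_num) hX0.le, ← ENNReal.ofReal_toReal f2.ne,
            ← ENNReal.ofReal_mul (by positivity), hc2, ENNReal.toReal_ofReal ENNReal.toReal_nonneg]
          congr 1
          have : X ^ (-α) = X ^ (-γ) * X ^ (N - β) := by
            rw [← Real.rpow_add hX0]; congr 1; rw [hγ, hβ]; ring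
          rw [this]; ring
  -- far away
  have r3 : ∫⁻ z in (Metric.ball 0 (3 * X))ᶜ, g z ≤ ENNReal.ofReal (c3 * I3.toReal * X ^ (-α)) := by
    calc ∫⁻ z in (Metric.ball 0 (3 * X))ᶜ, g z
        ≤ ∫⁻ z in (Metric.ball (0 : EuclideanSpace ℝ (Fin N)) (3 * X))ᶜ, ENNReal.ofReal ((1 / 2) ^ (-β)) *
            ENNReal.ofReal (‖z‖ ^ (-(γ + β))) := by
          refine setLIntegral_mono' Metric.isOpen_ball.measurableSet.compl fun z hz => ?_
          have hz1 : 3 * X ≤ ‖z‖ := by simpa using hz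
          have hz0 : 0 < ‖z‖ := by linarith
          have e : ‖z‖ ^ (-(γ + β)) = ‖z‖ ^ (-γ) * ‖z‖ ^ (-β) := by
            rw [neg_add γ β, Real.rpow_add hz0]
          rw [hg]
          beta_reduce
          rw [hker, e, ENNReal.ofReal_mul (by positivity), mul_left_comm]
          refine mul_le_mul_right ?_ _
          rw [← ENNReal.ofReal_mul (by positivity), ← Real.mul_rpow (by norm_num) hz0.le]
          refine ENNReal.ofReal_le_ofReal (Real.rpow_le_rpow_of_nonpos (by positivity) ?_ (by linarith))
          have := norm_sub_norm_le z x
          rw [norm_sub_rev] at this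
          have : ‖x‖ ≤ X := by rw [hX]; linarith
          linarith
      _ = ENNReal.ofReal (c3 * I3.toReal * X ^ (-α)) := by
          rw [lintegral_const_mul' _ _ ENNReal.ofReal_ne_top,
            lintegral_compl_ball_norm_rpow_scale (by positivity), ← hI3, ← mul_assoc,
            ← ENNReal.ofReal_mul (by positivity), Real.mul_rpow (by norm_num) hX0.le,
            ← ENNReal.ofReal_toReal f3.ne, ← ENNReal.ofReal_mul (by positivity), hc3,
            ENNReal.toReal_ofReal ENNReal.toReal_nonneg]
          congr 1
          rw [show (N : ℝ) - (γ + β) = -α by rw [hγ, hβ]; ring]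
          ring
  have hcover : (univ : Set (EuclideanSpace ℝ (Fin N))) ⊆ Metric.ball 0 (X / 2) ∪
      ((Metric.ball 0 (3 * X) \ Metric.ball 0 (X / 2)) ∪ (Metric.ball 0 (3 * X))ᶜ) := by
    intro z _
    by_cases h1 : z ∈ Metric.ball (0 : EuclideanSpace ℝ (Fin N)) (X / 2)
    · exact Or.inl h1
    · by_cases h2 : z ∈ Metric.ball (0 : EuclideanSpace ℝ (Fin N)) (3 * X)
      · exact Or.inr (Or.inl ⟨h2, h1⟩)
      · exact Or.inr (Or.inr h2)
  calc rieszE s (fun y => ENNReal.ofReal ((1 + ‖y‖) ^ (-β))) x = ∫⁻ z in univ, g z := by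
        rw [setLIntegral_univ]; rfl
    _ ≤ _ := (lintegral_mono_set hcover).trans ((lintegral_union_le _ _ _).trans
        (add_le_add r1 ((lintegral_union_le _ _ _).trans (add_le_add r2 r3))))
    _ ≤ ENNReal.ofReal ((c1 * I1.toReal + c2 * I2.toReal + c3 * I3.toReal + 1) * X ^ (-α)) := by
        rw [← ENNReal.ofReal_add (by positivity) (by positivity),
          ← ENNReal.ofReal_add (by positivity) (by positivity)]
        refine ENNReal.ofReal_le_ofReal ?_
        have : 0 < X ^ (-α) := by positivity
        nlinarith

local notation "𝔼" => EuclideanSpace ℝ (Fin N)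

theorem weight_le_of_dist {b : ℝ} (hb : 0 ≤ b) {x y : 𝔼} (h : ‖x - y‖ ≤ 1) :
    (1 + ‖x‖) ^ (-b) ≤ 2 ^ b * (1 + ‖y‖) ^ (-b) := by
  have h1 : (1 + ‖y‖) / 2 ≤ 1 + ‖x‖ := by
    have := norm_sub_norm_le y x
    rw [norm_sub_rev] at this
    have := norm_nonneg x
    linarith
  calc (1 + ‖x‖) ^ (-b) ≤ ((1 + ‖y‖) / 2) ^ (-b) :=
        Real.rpow_le_rpow_of_nonpos (by positivity) h1 (by linarith)
    _ = _ := by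
        have h2 : 0 ≤ 1 + ‖y‖ := by positivity
        have h3 : ((2 : ℝ)⁻¹) ^ (-b) = 2 ^ b := by
          rw [Real.inv_rpow (by norm_num), Real.rpow_neg (by norm_num), inv_inv]
        rw [div_eq_mul_inv, Real.mul_rpow h2 (by norm_num), h3, mul_comm]

theorem continuous_weight (b : ℝ) : Continuous fun x : 𝔼 => (1 + ‖x‖) ^ (-b) :=
  (continuous_const.add continuous_norm).rpow_const fun x =>
    Or.inl (by have := norm_nonneg x; linarith : (0 : ℝ) < 1 + ‖x‖).ne'

theorem weight_le_moll {φ : ContDiffBump (0 : 𝔼)} (hφ : φ.rOut ≤ 1) {u : 𝔼 → ℝ} (hu : Continuous u)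
    {b c : ℝ} (hb : 0 ≤ b) (hc : 0 ≤ c) (h : ∀ x, c * (1 + ‖x‖) ^ (-b) ≤ u x) (x : 𝔼) :
    c * (2 ^ b)⁻¹ * (1 + ‖x‖) ^ (-b) ≤ moll φ u x := by
  refine le_moll hu fun t ht => le_trans ?_ (h _)
  rw [mul_assoc]
  refine mul_le_mul_of_nonneg_left ?_ hc
  rw [inv_mul_le_iff₀ (by positivity)]
  exact weight_le_of_dist hb (by simpa using (ht.trans_le hφ).le)

theorem moll_le_weight {φ : ContDiffBump (0 : 𝔼)} (hφ : φ.rOut ≤ 1) {u : 𝔼 → ℝ} (hu : Continuous u)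
    {b c : ℝ} (hb : 0 ≤ b) (hc : 0 ≤ c) (h : ∀ x, u x ≤ c * (1 + ‖x‖) ^ (-b)) (x : 𝔼) :
    moll φ u x ≤ c * 2 ^ b * (1 + ‖x‖) ^ (-b) := by
  refine moll_le hu fun t ht => (h _).trans ?_
  rw [mul_assoc]
  refine mul_le_mul_of_nonneg_left ?_ hc
  exact weight_le_of_dist hb (by simpa using (ht.trans_le hφ).le)

/-- `w` is the potential of `f`, of class `C²`, and both have exactly the order of a power:
`w ~ (1 + |x|)^(-α)` and `f ~ (1 + |x|)^(-α - 2s)`. -/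
structure IsPowerPotential (s α c C : ℝ) (f w : 𝔼 → ℝ) : Prop where
  isPotential : IsPotential s f w
  contDiff : ContDiff ℝ 2 w
  c_pos : 0 < c
  C_pos : 0 < C
  lower : ∀ x, c * (1 + ‖x‖) ^ (-α) ≤ w x
  upper : ∀ x, w x ≤ C * (1 + ‖x‖) ^ (-α)
  density_lower : ∀ x, c * (1 + ‖x‖) ^ (-(α + 2 * s)) ≤ f x
  density_upper : ∀ x, f x ≤ C * (1 + ‖x‖) ^ (-(α + 2 * s))

/-- A positive supersolution of order `(1 + |x|)^(-α)` for every `0 < α < N - 2s`. -/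
theorem exists_base (hs : s ∈ Ioo (0 : ℝ) 1) {α : ℝ} (hα : 0 < α) (hαN : α < N - 2 * s) :
    ∃ (f w : 𝔼 → ℝ) (c C : ℝ), IsPowerPotential s α c C f w ∧ IsUniformC11 w := by
  have hs0 := hs.1
  have hN : 2 * s < N := by linarith
  have hN0 := pos_dim hs0 hN
  have := nontrivial_euclidean hN0
  obtain ⟨C, hC, hle⟩ := exists_rieszE_power_le hs0 hα hαN
  set β := α + 2 * s with hβ
  have hβ0 : 0 < β := by linarith
  set f : 𝔼 → ℝ := fun y => (1 + ‖y‖) ^ (-β) with hf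
  have hf0 : ∀ y, 0 ≤ f y := fun y => by rw [hf]; positivity
  have hfc : Continuous f := continuous_weight β
  have hF0 : ∀ x z : 𝔼, 0 ≤ ‖z‖ ^ (2 * s - N) * f (x - z) := fun x z =>
    mul_nonneg (by positivity) (hf0 _)
  have hmeas : ∀ x : 𝔼, AEStronglyMeasurable (fun z => ‖z‖ ^ (2 * s - N) * f (x - z)) volume :=
    fun x => by
      have h1 : Measurable fun z : 𝔼 => ‖z‖ ^ (2 * s - N) := measurable_norm.pow_const _
      exact (h1.mul (hfc.measurable.comp (measurable_const.sub measurable_id))).aestronglyMeasurable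
  have hrE : ∀ x : 𝔼, ∫⁻ z, ENNReal.ofReal (‖z‖ ^ (2 * s - N) * f (x - z)) =
      rieszE s (fun y => ENNReal.ofReal (f y)) x := fun x =>
    lintegral_congr fun z => ENNReal.ofReal_mul (by positivity)
  have hint : ∀ x : 𝔼, Integrable fun z => ‖z‖ ^ (2 * s - N) * f (x - z) := fun x => by
    refine ⟨hmeas x, ?_⟩
    rw [hasFiniteIntegral_iff_ofReal (Eventually.of_forall (hF0 x)), hrE]
    exact (hle x).trans_lt ENNReal.ofReal_lt_top
  have heq : ∀ x : 𝔼, ENNReal.ofReal (riesz s f x) = rieszE s (fun y => ENNReal.ofReal (f y)) x :=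
    fun x => by
      rw [← hrE, riesz, ofReal_integral_eq_lintegral_ofReal (hint x) (Eventually.of_forall (hF0 x))]
  have hup : ∀ x : 𝔼, riesz s f x ≤ C * (1 + ‖x‖) ^ (-α) := fun x => by
    have h1 := hle x
    rw [← heq] at h1
    exact (ENNReal.ofReal_le_ofReal_iff (by positivity)).1 h1
  have hcont : Continuous (riesz s f) := by
    rw [continuous_iff_continuousAt]
    intro x₀
    refine continuousAt_of_dominated (bound := fun z => 2 ^ β * (‖z‖ ^ (2 * s - N) * f (x₀ - z)))
      (Eventually.of_forall hmeas) ?_ ((hint x₀).const_mul _) ?_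
    · filter_upwards [Metric.ball_mem_nhds x₀ one_pos] with x hx
      refine Eventually.of_forall fun z => ?_
      rw [Real.norm_of_nonneg (hF0 x z), mul_left_comm]
      refine mul_le_mul_of_nonneg_left ?_ (by positivity)
      refine weight_le_of_dist hβ0.le ?_
      rw [sub_sub_sub_cancel_right, ← dist_eq_norm]
      exact (Metric.mem_ball.1 hx).le
    · refine Eventually.of_forall fun z => ?_
      exact (continuous_const.mul (hfc.comp (continuous_id.sub continuous_const))).continuousAt
  set J := (volume (Metric.ball (0 : 𝔼) 1)).toReal with hJ
  have hJ0 : 0 < J := ENNReal.toReal_pos (Metric.measure_ball_pos _ _ one_pos).ne'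
    measure_ball_lt_top.ne
  have hlow : ∀ x : 𝔼, (2 ^ (-β) * J) * (1 + ‖x‖) ^ (-α) ≤ riesz s f x := fun x => by
    set X := 1 + ‖x‖ with hX
    have hX0 : 0 < X := by positivity
    have h1 : ∫ z in Metric.ball (0 : 𝔼) X, X ^ (2 * s - N) * (2 * X) ^ (-β) ≤
        ∫ z in Metric.ball (0 : 𝔼) X, ‖z‖ ^ (2 * s - N) * f (x - z) := by
      refine setIntegral_mono_on_ae (integrableOn_const (measure_ball_lt_top.ne))
        (hint x).integrableOn Metric.isOpen_ball.measurableSet ?_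
      have h0 : ∀ᵐ z : 𝔼, z ≠ 0 := by simp [ae_iff]
      filter_upwards [h0] with z hz0 hz
      rw [mem_ball_zero_iff] at hz
      refine mul_le_mul ?_ ?_ (by positivity) (by positivity)
      · exact Real.rpow_le_rpow_of_nonpos (norm_pos_iff.2 hz0) hz.le (by linarith)
      · refine Real.rpow_le_rpow_of_nonpos (by positivity) ?_ (by linarith)
        have := norm_sub_le x z
        linarith
    have h2 : ∫ z in Metric.ball (0 : 𝔼) X, ‖z‖ ^ (2 * s - N) * f (x - z) ≤ riesz s f x :=
      setIntegral_le_integral (hint x) (Eventually.of_forall (hF0 x))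
    refine le_trans (le_of_eq ?_) (h1.trans h2)
    rw [setIntegral_const, smul_eq_mul, Measure.real, Measure.addHaar_ball _ _ hX0.le,
      ENNReal.toReal_mul, ENNReal.toReal_ofReal (by positivity), finrank_euclideanSpace,
      Fintype.card_fin, ← hJ, Real.mul_rpow (by norm_num) hX0.le, ← Real.rpow_natCast]
    have : X ^ (-α) = X ^ (N : ℝ) * (X ^ (2 * s - N) * X ^ (-β)) := by
      rw [← Real.rpow_add hX0, ← Real.rpow_add hX0]; congr 1; rw [hβ]; ring
    rw [this]; ring
  have hf1 : ∀ x, f x ≤ 1 := fun x =>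
    Real.rpow_le_one_of_one_le_of_nonpos (by linarith [norm_nonneg x]) (by linarith)
  have hw1 : ∀ x : 𝔼, (1 + ‖x‖) ^ (-α) ≤ 1 := fun x =>
    Real.rpow_le_one_of_one_le_of_nonpos (by linarith [norm_nonneg x]) (by linarith)
  have hnn := riesz_nonneg (s := s) hf0
  have hubd : ∀ x : 𝔼, riesz s f x ≤ C := fun x => (hup x).trans
    (mul_le_of_le_one_right hC.le (hw1 x))
  have hpot : IsPotential s f (riesz s f) :=
    ⟨hfc, hf0, ⟨1, hf1⟩, hcont, hnn, ⟨C, hubd⟩, heq⟩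
  obtain ⟨φ, hφ⟩ := exists_bump_rOut_le (N := N) one_pos
  set c := min (2 ^ (-β) * J * (2 ^ α)⁻¹) (1 * (2 ^ β)⁻¹) with hc
  have hc0 : 0 < c := lt_min (by positivity) (by positivity)
  set C' := max (C * 2 ^ α) (1 * 2 ^ β) with hC'
  refine ⟨moll φ f, moll φ (riesz s f), c, C', ⟨hpot.moll φ, contDiff_moll hcont, hc0,
    lt_max_of_lt_left (by positivity), fun x => ?_, fun x => ?_, fun x => ?_, fun x => ?_⟩,
    isUniformC11_moll hcont (M := C) fun x => by rw [abs_of_nonneg (hnn x)]; exact hubd x⟩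
  · refine le_trans ?_ (weight_le_moll hφ hcont hα.le (by positivity) hlow x)
    exact mul_le_mul_of_nonneg_right (min_le_left _ _) (by positivity)
  · refine (moll_le_weight hφ hcont hα.le hC.le hup x).trans ?_
    exact mul_le_mul_of_nonneg_right (le_max_left _ _) (by positivity)
  · refine le_trans ?_ (weight_le_moll hφ hfc hβ0.le zero_le_one (fun y => (one_mul _).le) x)
    exact mul_le_mul_of_nonneg_right (min_le_right _ _) (by positivity)
  · refine (moll_le_weight hφ hfc hβ0.le zero_le_one (fun y => (one_mul _).ge) x).trans ?_
    exact mul_le_mul_of_nonneg_right (le_max_right _ _) (by positivity)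

/-! ### The maximum principle for differences of potentials -/

theorem moll_sub {φ : ContDiffBump (0 : 𝔼)} {u v : 𝔼 → ℝ} (hu : Continuous u) (hv : Continuous v)
    (x : 𝔼) : moll φ (fun y => u y - v y) x = moll φ u x - moll φ v x := by
  rw [moll_apply, moll_apply, moll_apply, ← integral_sub (integrable_moll hu x) (integrable_moll hv x)]
  refine integral_congr_ae (Eventually.of_forall fun t => ?_)
  ring

theorem uniformContinuous_of_tendsto_cobounded {u : 𝔼 → ℝ} (hu : Continuous u)
    (h : Tendsto u (Bornology.cobounded 𝔼) (𝓝 0)) : UniformContinuous u := by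
  rw [Metric.cobounded_eq_cocompact] at h
  exact hu.uniformContinuous_of_tendsto_cocompact h

/-- A difference `u` of potentials that vanishes at infinity and satisfies `u ≤ m` wherever its
density is positive, satisfies `u ≤ m` everywhere. Otherwise a mollification of `u` has a maximum
point, where its fractional Laplacian is positive; then the density is positive at some point nearby,
although `u > m` there. -/
theorem potential_sub_le (hs : s ∈ Ioo (0 : ℝ) 1) (hN : 2 * s < N) {Ψ₁ Ψ₂ u₁ u₂ : 𝔼 → ℝ}
    (h₁ : IsPotential s Ψ₁ u₁) (h₂ : IsPotential s Ψ₂ u₂)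
    (hlim : Tendsto (fun x => u₁ x - u₂ x) (Bornology.cobounded 𝔼) (𝓝 0)) {m : ℝ} (hm : 0 ≤ m)
    (H : ∀ x, Ψ₂ x < Ψ₁ x → u₁ x - u₂ x ≤ m) (x : 𝔼) : u₁ x - u₂ x ≤ m := by
  by_contra! hx
  have := nontrivial_euclidean (pos_dim hs.1 hN)
  set u : 𝔼 → ℝ := fun x => u₁ x - u₂ x with hu
  have huc : Continuous u := h₁.continuous.sub h₂.continuous
  have huu : UniformContinuous u := uniformContinuous_of_tendsto_cobounded huc hlim
  set ε := (u x - m) / 4 with hε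
  have hε0 : 0 < ε := by rw [hε]; have : m < u x := hx; linarith
  obtain ⟨η₁, hη₁, hclose⟩ := exists_moll_close huu hε0
  obtain ⟨η₂, hη₂, hunif⟩ := Metric.uniformContinuous_iff.1 huu ε hε0
  obtain ⟨φ, hφ⟩ := exists_bump_rOut_le (N := N) (lt_min hη₁ hη₂)
  have hcl : ∀ y, |moll φ u y - u y| ≤ ε := hclose φ (hφ.trans (min_le_left _ _))
  have hUx : m + 3 * ε ≤ moll φ u x := by
    have := (abs_le.1 (hcl x)).1
    rw [hε] at this ⊢
    linarith
  have hfar : ∀ᶠ y in cocompact 𝔼, moll φ u y < moll φ u x := by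
    rw [Metric.cobounded_eq_cocompact] at hlim
    filter_upwards [hlim.eventually (Iio_mem_nhds hε0)] with y hy
    have h3 : u y < ε := hy
    have := (abs_le.1 (hcl y)).2
    linarith
  obtain ⟨x₀, hx₀⟩ := (continuous_moll (φ := φ) huc).exists_forall_ge' x (hfar.mono fun _ h => h.le)
  obtain ⟨z, hz⟩ := hfar.exists
  have e : moll φ u = fun y => moll φ u₁ y - moll φ u₂ y :=
    funext fun y => moll_sub h₁.continuous h₂.continuous y
  have hL : HasFracLaplacian s (moll φ u) x₀
      (fracConst N s * moll φ Ψ₁ x₀ - fracConst N s * moll φ Ψ₂ x₀) := by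
    rw [e]
    exact ((h₁.moll φ).hasFracLaplacian hs hN (contDiff_moll h₁.continuous) x₀).sub
      ((h₂.moll φ).hasFracLaplacian hs hN (contDiff_moll h₂.continuous) x₀)
  have hpos := hL.pos_of_max (continuous_moll huc) hx₀ (hz.trans_le (hx₀ x))
  have hlt : moll φ Ψ₂ x₀ < moll φ Ψ₁ x₀ :=
    lt_of_mul_lt_mul_left (sub_pos.1 hpos) (fracConst_pos hs hN).le
  have hex : ∃ t : 𝔼, ‖t‖ < φ.rOut ∧ Ψ₂ (x₀ - t) < Ψ₁ (x₀ - t) := by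
    by_contra! hc
    exact not_le_of_gt hlt (moll_mono h₁.continuous_density h₂.continuous_density hc)
  obtain ⟨t, ht, hΨt⟩ := hex
  have h4 : u (x₀ - t) ≤ m := H _ hΨt
  have h5 : dist (u (x₀ - t)) (u x₀) < ε :=
    hunif (by rw [dist_eq_norm]; simpa using ht.trans_le (hφ.trans (min_le_right _ _)))
  rw [Real.dist_eq] at h5
  have h6 := (abs_lt.1 h5).1
  have h7 := (abs_le.1 (hcl x₀)).2
  have h8 := hx₀ x
  linarith

/-! ### The equation with an absorption term of compact support -/

open scoped BoundedContinuousFunction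

theorem riesz_add (hs : 0 < s) (hN : 2 * s < N) {f g : 𝔼 → ℝ} (hf : Continuous f)
    (hfc : HasCompactSupport f) (hg : Continuous g) (hgc : HasCompactSupport g) (x : 𝔼) :
    riesz s (fun y => f y + g y) x = riesz s f x + riesz s g x := by
  rw [riesz, riesz, riesz, ← integral_add (integrable_riesz hs hN hf hfc x)
    (integrable_riesz hs hN hg hgc x)]
  simp_rw [mul_add]

theorem riesz_const_mul (c : ℝ) (f : 𝔼 → ℝ) (x : 𝔼) :
    riesz s (fun y => c * f y) x = c * riesz s f x := by
  rw [riesz, riesz, ← integral_const_mul]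
  simp_rw [mul_left_comm]

theorem riesz_mono (hs : 0 < s) (hN : 2 * s < N) {f g : 𝔼 → ℝ} (hf : Continuous f)
    (hfc : HasCompactSupport f) (hg : Continuous g) (hgc : HasCompactSupport g)
    (h : ∀ y, f y ≤ g y) (x : 𝔼) : riesz s f x ≤ riesz s g x :=
  integral_mono (integrable_riesz hs hN hf hfc x) (integrable_riesz hs hN hg hgc x) fun _ =>
    mul_le_mul_of_nonneg_left (h _) (by positivity)

theorem riesz_posPart_sub_negPart (hs : 0 < s) (hN : 2 * s < N) {f : 𝔼 → ℝ} (hf : Continuous f)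
    (hfc : HasCompactSupport f) (x : 𝔼) :
    riesz s (fun y => max (f y) 0) x - riesz s (fun y => max (-f y) 0) x = riesz s f x := by
  rw [riesz, riesz, riesz, ← integral_sub
    (integrable_riesz hs hN (hf.max continuous_const) (hfc.comp_left (g := fun t : ℝ => max t 0)
      (max_self 0)) x)
    (integrable_riesz (Ψ := fun y => max (-f y) 0) hs hN (hf.neg.max continuous_const) (hfc.comp_left
      (g := fun t : ℝ => max (-t) 0) (by simp)) x)]
  refine integral_congr_ae (Eventually.of_forall fun z => ?_)
  beta_reduce
  rw [← mul_sub]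
  congr 1
  rcases le_total 0 (f (x - z)) with h | h
  · rw [max_eq_left h, max_eq_right (by linarith), sub_zero]
  · rw [max_eq_right h, max_eq_left (by linarith)]; ring

/-- The maximum principle of `potential_sub_le` for the potential of a density of variable sign. -/
theorem riesz_le_of_pos (hs : s ∈ Ioo (0 : ℝ) 1) (hN : 2 * s < N) {f : 𝔼 → ℝ} (hf : Continuous f)
    (hfc : HasCompactSupport f) {m : ℝ} (hm : 0 ≤ m) (H : ∀ x, 0 < f x → riesz s f x ≤ m) (x : 𝔼) :
    riesz s f x ≤ m := by
  have e := riesz_posPart_sub_negPart hs.1 hN hf hfc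
  have h1 := isPotential_riesz hs.1 hN (hf.max continuous_const) (hfc.comp_left
    (g := fun t : ℝ => max t 0) (max_self 0)) (fun x => le_max_right _ _)
  have h2 := isPotential_riesz hs.1 hN (hf.neg.max continuous_const) (hfc.comp_left
    (g := fun t : ℝ => max (-t) 0) (by simp)) (fun x => le_max_right _ _)
  have := potential_sub_le hs hN h1 h2 (by
    refine (tendsto_riesz_cobounded hs.1 hN hf hfc).congr fun y => ?_
    exact (e y).symm) hm (fun y hy => by
      refine (e y).trans_le (H y ?_)
      by_contra! hc
      rw [max_eq_right hc] at hy
      exact not_lt_of_ge (le_max_right _ _) hy) x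
  exact (e x).symm.trans_le this

/-- The method of continuity along `1 + l T`, `0 ≤ l ≤ 1`, in finitely many steps of a length
determined by the a priori bound. -/
theorem isUnit_one_add_of_norm_le {X : Type*} [NormedAddCommGroup X] [NormedSpace ℝ X]
    [CompleteSpace X] {T : X →L[ℝ] X}
    (h : ∀ l : ℝ, 0 ≤ l → ∀ v, ‖v‖ ≤ 2 * ‖v + l • T v‖) : IsUnit (1 + T) := by
  rcases subsingleton_or_nontrivial X with hX | hX
  · exact isUnit_of_subsingleton _
  obtain ⟨K, hK⟩ := exists_nat_gt (2 * ‖T‖)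
  have hK0 : (0 : ℝ) < K := (by positivity : 0 ≤ 2 * ‖T‖).trans_lt hK
  have step : ∀ n : ℕ, IsUnit (1 + ((n : ℝ) / K) • T) := fun n => by
    induction n with
    | zero => simp
    | succ n ih =>
      obtain ⟨U, hU⟩ := ih
      have hinv : ‖(↑U⁻¹ : X →L[ℝ] X)‖ ≤ 2 := by
        refine ContinuousLinearMap.opNorm_le_bound _ (by norm_num) fun b => ?_
        have h1 := h ((n : ℝ) / K) (by positivity) ((↑U⁻¹ : X →L[ℝ] X) b)
        have h2 : ((U : X →L[ℝ] X) * (↑U⁻¹ : X →L[ℝ] X)) b = b := by rw [U.mul_inv]; rfl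
        rw [hU] at h2
        have h3 : (↑U⁻¹ : X →L[ℝ] X) b + ((n : ℝ) / K) • T ((↑U⁻¹ : X →L[ℝ] X) b) = b := h2
        rwa [h3] at h1
      have hpos : 0 < ‖(↑U⁻¹ : X →L[ℝ] X)‖ := Units.norm_pos U⁻¹
      have hd : 1 + (((n + 1 : ℕ) : ℝ) / K) • T - (U : X →L[ℝ] X) = (1 / (K : ℝ)) • T := by
        rw [hU, add_sub_add_left_eq_sub, ← sub_smul]
        congr 1
        push_cast
        ring
      have hlt : ‖1 + (((n + 1 : ℕ) : ℝ) / K) • T - (U : X →L[ℝ] X)‖ < ‖(↑U⁻¹ : X →L[ℝ] X)‖⁻¹ := by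
        rw [hd, norm_smul, Real.norm_of_nonneg (by positivity)]
        have h4 : (2 : ℝ)⁻¹ ≤ ‖(↑U⁻¹ : X →L[ℝ] X)‖⁻¹ := inv_anti₀ hpos hinv
        refine lt_of_lt_of_le ?_ h4
        rw [div_mul_eq_mul_div, one_mul, div_lt_iff₀ hK0]
        linarith
      exact ⟨U.ofNearby _ hlt, rfl⟩
  have := step K
  rwa [div_self hK0.ne', one_smul] at this

section Absorption

variable {W : EuclideanSpace ℝ (Fin N) → ℝ}

theorem norm_riesz_mul_le (hs : 0 < s) (hN : 2 * s < N) (hW : Continuous W)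
    (hWc : HasCompactSupport W) (hW0 : ∀ x, 0 ≤ W x) {M : ℝ} (hM : ∀ x, riesz s W x ≤ M)
    (v : 𝔼 →ᵇ ℝ) (x : 𝔼) : ‖riesz s (fun y => W y * v y) x‖ ≤ M * ‖v‖ := by
  have hcont : Continuous fun y => W y * v y := hW.mul v.continuous
  have hcs : HasCompactSupport fun y => W y * v y := hWc.mul_right
  calc ‖riesz s (fun y => W y * v y) x‖ ≤ riesz s (fun y => |W y * v y|) x :=
        abs_riesz_le hs hN hcont hcs x
    _ ≤ riesz s (fun y => ‖v‖ * W y) x := by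
        refine riesz_mono hs hN hcont.abs (hcs.comp_left (g := fun t : ℝ => |t|) abs_zero)
          (continuous_const.mul hW) hWc.mul_left (fun y => ?_) x
        rw [abs_mul, abs_of_nonneg (hW0 y), mul_comm]
        exact mul_le_mul_of_nonneg_right (v.norm_coe_le_norm y) (hW0 y)
    _ = ‖v‖ * riesz s W x := riesz_const_mul _ _ _
    _ ≤ M * ‖v‖ := by rw [mul_comm]; exact mul_le_mul_of_nonneg_right (hM x) (norm_nonneg v)

/-- A bounded operator of the form `v ↦ riesz (W v)` on bounded continuous functions. -/
theorem exists_absorption_operator (hs : 0 < s) (hN : 2 * s < N) (hW : Continuous W)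
    (hWc : HasCompactSupport W) (hW0 : ∀ x, 0 ≤ W x) :
    ∃ T : (𝔼 →ᵇ ℝ) →L[ℝ] (𝔼 →ᵇ ℝ), ∀ v x, T v x = riesz s (fun y => W y * v y) x := by
  obtain ⟨M, hM⟩ := (isPotential_riesz hs hN hW hWc hW0).bounded
  have hcont : ∀ v : 𝔼 →ᵇ ℝ, Continuous fun y => W y * v y := fun v => hW.mul v.continuous
  have hcs : ∀ v : 𝔼 →ᵇ ℝ, HasCompactSupport fun y => W y * v y := fun v => hWc.mul_right
  have hb := norm_riesz_mul_le hs hN hW hWc hW0 hM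
  let T₀ : (𝔼 →ᵇ ℝ) →ₗ[ℝ] (𝔼 →ᵇ ℝ) :=
    { toFun := fun v => BoundedContinuousFunction.ofNormedAddCommGroup _
        (continuous_riesz hs hN (hcont v) (hcs v)) _ (hb v)
      map_add' := fun v v' => by
        ext x
        have := riesz_add hs hN (hcont v) (hcs v) (hcont v') (hcs v') x
        simp only [← mul_add] at this
        exact this
      map_smul' := fun c v => by
        ext x
        have := riesz_const_mul (s := s) c (fun y => W y * v y) x
        simp only [mul_left_comm c] at this
        exact this }
  have hM0 : 0 ≤ M := (riesz_nonneg hW0 0).trans (hM 0)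
  refine ⟨T₀.mkContinuous M fun v => ?_, fun v x => rfl⟩
  exact (BoundedContinuousFunction.norm_le (by positivity)).2 (hb v)

/-- The a priori bound for `v + l riesz (W v) = b`: where the density `W v` is positive, `v` is
positive, hence the potential is at most `b`; by the maximum principle it is at most `‖b‖`
everywhere. -/
theorem norm_le_of_add_absorption (hs : s ∈ Ioo (0 : ℝ) 1) (hN : 2 * s < N) (hW : Continuous W)
    (hWc : HasCompactSupport W) (hW0 : ∀ x, 0 ≤ W x) {T : (𝔼 →ᵇ ℝ) →L[ℝ] (𝔼 →ᵇ ℝ)}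
    (hT : ∀ v x, T v x = riesz s (fun y => W y * v y) x) {l : ℝ} (hl : 0 ≤ l) (v : 𝔼 →ᵇ ℝ) :
    ‖v‖ ≤ 2 * ‖v + l • T v‖ := by
  set b := v + l • T v with hb
  have key : ∀ (v b : 𝔼 →ᵇ ℝ), b = v + l • T v → ∀ x, (l • T v) x ≤ ‖b‖ := fun v b hb x => by
    have e : ∀ x, (l • T v) x = riesz s (fun y => l * (W y * v y)) x := fun x => by
      rw [riesz_const_mul, ← hT]; rfl
    rw [e]
    refine riesz_le_of_pos hs hN (continuous_const.mul (hW.mul v.continuous))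
      (hWc.mul_right.mul_left) (norm_nonneg b) (fun y hy => ?_) x
    have hv : 0 < v y := by
      by_contra! hc
      exact not_lt_of_ge (mul_nonpos_of_nonneg_of_nonpos hl
        (mul_nonpos_of_nonneg_of_nonpos (hW0 y) hc)) hy
    have h1 : b y = v y + (l • T v) y := by rw [hb]; rfl
    change riesz s (fun y => l * (W y * v y)) y ≤ ‖b‖
    rw [← e]
    have h2 : b y ≤ ‖b‖ := (le_abs_self _).trans (b.norm_coe_le_norm y)
    linarith
  have hle : ‖l • T v‖ ≤ ‖b‖ := by
    refine (BoundedContinuousFunction.norm_le (norm_nonneg b)).2 fun x => abs_le.2 ⟨?_, key v b hb x⟩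
    have := key (-v) (-b) (by rw [hb, map_neg, smul_neg, neg_add]) x
    rw [norm_neg, map_neg, smul_neg] at this
    have h2 : (-(l • T v)) x = -((l • T v) x) := rfl
    rw [h2] at this
    linarith
  calc ‖v‖ = ‖b - l • T v‖ := by rw [hb, add_sub_cancel_right]
    _ ≤ ‖b‖ + ‖l • T v‖ := norm_sub_le _ _
    _ ≤ 2 * ‖b‖ := by linarith

theorem isUnit_one_add_absorption (hs : s ∈ Ioo (0 : ℝ) 1) (hN : 2 * s < N) (hW : Continuous W)
    (hWc : HasCompactSupport W) (hW0 : ∀ x, 0 ≤ W x) {T : (𝔼 →ᵇ ℝ) →L[ℝ] (𝔼 →ᵇ ℝ)}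
    (hT : ∀ v x, T v x = riesz s (fun y => W y * v y) x) : IsUnit (1 + T) :=
  isUnit_one_add_of_norm_le fun _ hl v => norm_le_of_add_absorption hs hN hW hWc hW0 hT hl v

/-- The equation `v + riesz (W v) = w` has a solution with `0 ≤ v ≤ w`, for every potential `w` that
vanishes at infinity. -/
theorem exists_absorption_solution (hs : s ∈ Ioo (0 : ℝ) 1) (hN : 2 * s < N) (hW : Continuous W)
    (hWc : HasCompactSupport W) (hW0 : ∀ x, 0 ≤ W x) {f w : 𝔼 → ℝ} (h : IsPotential s f w)
    (hw : Tendsto w (Bornology.cobounded 𝔼) (𝓝 0)) :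
    ∃ v : 𝔼 → ℝ, Continuous v ∧ (∀ x, 0 ≤ v x) ∧ (∀ x, v x ≤ w x) ∧
      ∀ x, v x + riesz s (fun y => W y * v y) x = w x := by
  obtain ⟨T, hT⟩ := exists_absorption_operator hs.1 hN hW hWc hW0
  obtain ⟨U, hU⟩ := isUnit_one_add_absorption hs hN hW hWc hW0 hT
  obtain ⟨M, hM⟩ := h.bounded
  let b : 𝔼 →ᵇ ℝ := BoundedContinuousFunction.ofNormedAddCommGroup w h.continuous M
    fun x => by rw [Real.norm_of_nonneg (h.nonneg x)]; exact hM x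
  set v : 𝔼 →ᵇ ℝ := (U⁻¹).1 b with hv
  have h2 : (U.1 * (U⁻¹).1) b = b := by rw [U.mul_inv]; rfl
  rw [hU] at h2
  have h3 : v + T v = b := h2
  have heq : ∀ x, v x + riesz s (fun y => W y * v y) x = w x := fun x => by
    rw [← hT]
    exact DFunLike.congr_fun h3 x
  have hcont : Continuous fun y => W y * v y := hW.mul v.continuous
  have hcs : HasCompactSupport fun y => W y * v y := hWc.mul_right
  have e := riesz_posPart_sub_negPart hs.1 hN hcont hcs
  have p1 := isPotential_riesz hs.1 hN (hcont.max continuous_const) (hcs.comp_left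
    (g := fun t : ℝ => max t 0) (max_self 0)) (fun x => le_max_right _ _)
  have p2 := isPotential_riesz hs.1 hN (hcont.neg.max continuous_const) (hcs.comp_left
    (g := fun t : ℝ => max (-t) 0) (by simp)) (fun x => le_max_right _ _)
  have hneg : ∀ x, -v x = riesz s (fun y => max (W y * v y) 0) x -
      (riesz s (fun y => max (-(W y * v y)) 0) x + w x) := fun x => by
    have := e x
    have := heq x
    linarith
  have hv0 : ∀ x, 0 ≤ v x := fun x => by
    have := potential_sub_le hs hN p1 (p2.add h) (by
      have h4 := (tendsto_riesz_cobounded hs.1 hN hcont hcs).sub hw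
      rw [sub_zero] at h4
      refine h4.congr fun y => ?_
      rw [← e y]
      exact sub_sub _ _ _) le_rfl (fun y hy => by
        refine (hneg y).symm.trans_le ?_
        have h5 : 0 < W y * v y := by
          by_contra! hc
          rw [max_eq_right hc] at hy
          exact not_lt_of_ge (add_nonneg (le_max_right _ _) (h.density_nonneg y)) hy
        have : 0 < v y := pos_of_mul_pos_right h5 (hW0 y)
        linarith) x
    have h6 := (hneg x).trans_le this
    linarith
  refine ⟨v, v.continuous, hv0, fun x => ?_, heq⟩
  have h7 : 0 ≤ riesz s (fun y => W y * v y) x := riesz_nonneg (fun y => mul_nonneg (hW0 y) (hv0 y)) x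
  have := heq x
  linarith

end Absorption

/-! ### The energy of a potential -/

theorem measurable_gagliardo_integrand {u : 𝔼 → ℝ} (hu : Measurable u) :
    Measurable fun z : 𝔼 × 𝔼 =>
      ENNReal.ofReal ((u z.1 - u z.2) ^ 2 / ‖z.1 - z.2‖ ^ ((N : ℝ) + 2 * s)) := by
  refine Measurable.ennreal_ofReal ?_
  exact (((hu.comp measurable_fst).sub (hu.comp measurable_snd)).pow_const 2).div
    ((measurable_fst.sub measurable_snd).norm.pow_const _)

theorem gagliardo_eq_lintegral_shift {u : 𝔼 → ℝ} (hu : Measurable u) :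
    gagliardo s u =
      ∫⁻ y : 𝔼, ∫⁻ x : 𝔼, ENNReal.ofReal ((u x - u (x + y)) ^ 2 / ‖y‖ ^ ((N : ℝ) + 2 * s)) := by
  rw [gagliardo, Measure.volume_eq_prod,
    lintegral_prod _ (measurable_gagliardo_integrand hu).aemeasurable]
  rw [lintegral_lintegral_swap (f := fun y x =>
    ENNReal.ofReal ((u x - u (x + y)) ^ 2 / ‖y‖ ^ ((N : ℝ) + 2 * s)))]
  · refine lintegral_congr fun x => ?_
    rw [← lintegral_add_left_eq_self _ x]
    refine lintegral_congr fun y => ?_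
    rw [sub_add_cancel_left, norm_neg]
  · refine Measurable.aemeasurable (Measurable.ennreal_ofReal ?_)
    exact (((hu.comp measurable_snd).sub
      (hu.comp (measurable_snd.add measurable_fst))).pow_const 2).div
      (measurable_fst.norm.pow_const _)

theorem HasFracLaplacian.unique {u : 𝔼 → ℝ} {x : 𝔼} {ℓ m : ℝ} (h : HasFracLaplacian s u x ℓ)
    (h' : HasFracLaplacian s u x m) : ℓ = m :=
  tendsto_nhds_unique h.2 h'.2

theorem integrable_sq_increment {φ : 𝔼 → ℝ} (hφc : Continuous φ) (hφs : HasCompactSupport φ) (y : 𝔼) :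
    Integrable fun x => (φ x - φ (x + y)) ^ 2 := by
  have hφy : HasCompactSupport fun x => φ (x + y) := hφs.comp_homeomorph (Homeomorph.addRight y)
  have hc : Continuous fun x => φ x - φ (x + y) := hφc.sub (hφc.comp (by fun_prop))
  have hs : HasCompactSupport fun x => φ x - φ (x + y) := hφs.sub hφy
  simp_rw [sq]
  exact (hc.mul hc).integrable_of_hasCompactSupport hs.mul_right

/-- Truncation `t ↦ (t - δ)₊` is monotone and a contraction. -/
theorem sq_posPart_sub_le (δ a b : ℝ) :
    (max (a - δ) 0 - max (b - δ) 0) ^ 2 ≤ (max (a - δ) 0 - max (b - δ) 0) * (a - b) := by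
  rcases le_total (a - δ) 0 with ha | ha <;> rcases le_total (b - δ) 0 with hb | hb
  · simp [max_eq_right ha, max_eq_right hb]
  · rw [max_eq_right ha, max_eq_left hb]; nlinarith
  · rw [max_eq_left ha, max_eq_right hb]; nlinarith
  · rw [max_eq_left ha, max_eq_left hb]; nlinarith

/-- Summation by parts for a fixed increment `y`. -/
theorem integral_sq_increment_le {φ u : 𝔼 → ℝ} (hφc : Continuous φ) (hφs : HasCompactSupport φ)
    (hu : Continuous u) (h : ∀ x y, (φ x - φ y) ^ 2 ≤ (φ x - φ y) * (u x - u y)) (y : 𝔼) :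
    ∫ x, (φ x - φ (x + y)) ^ 2 ≤ ∫ x, φ x * secondDiff u x y := by
  have hφy : HasCompactSupport fun x => φ (x + y) :=
    hφs.comp_homeomorph (Homeomorph.addRight y)
  have hcy : Continuous fun x => φ (x + y) := hφc.comp (by fun_prop)
  have huy : Continuous fun x => u (x + y) := hu.comp (by fun_prop)
  have hu' : Continuous fun x => u (x - y) := hu.comp (by fun_prop)
  have i1 : Integrable fun x => φ x * (u x - u (x + y)) :=
    (hφc.mul (hu.sub huy)).integrable_of_hasCompactSupport hφs.mul_right
  have i2 : Integrable fun x => φ x * (u x - u (x - y)) :=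
    (hφc.mul (hu.sub hu')).integrable_of_hasCompactSupport hφs.mul_right
  have i3 : Integrable fun x => φ (x + y) * (u (x + y) - u x) :=
    (hcy.mul (huy.sub hu)).integrable_of_hasCompactSupport hφy.mul_right
  have e2 : ∫ x, φ x * (u x - u (x - y)) = ∫ x, φ (x + y) * (u (x + y) - u x) := by
    rw [← integral_add_right_eq_self _ y]
    simp only [add_sub_cancel_right]
  have e1 : ∫ x, φ x * secondDiff u x y =
      (∫ x, φ x * (u x - u (x + y))) + ∫ x, φ (x + y) * (u (x + y) - u x) := by
    rw [← e2, ← integral_add i1 i2]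
    refine integral_congr_ae (Eventually.of_forall fun x => ?_)
    simp only [secondDiff]
    ring
  rw [e1, ← integral_add i1 i3]
  refine integral_mono (integrable_sq_increment hφc hφs y) (i1.add i3) fun x => ?_
  refine (h _ _).trans (le_of_eq ?_)
  change _ = φ x * (u x - u (x + y)) + φ (x + y) * (u (x + y) - u x)
  ring

/-- Testing `(-Δ)^s u` with the compactly supported function `(u - δ)₊` controls the energy of that
function. -/
theorem gagliardo_posPart_sub_le (hs : s ∈ Ioo (0 : ℝ) 1) (hN : 2 * s < N) {Ψ u : 𝔼 → ℝ}
    (h : IsPotential s Ψ u) (hu : ContDiff ℝ 2 u) (hlim : Tendsto u (Bornology.cobounded 𝔼) (𝓝 0))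
    {δ : ℝ} (hδ : 0 < δ) :
    gagliardo s (fun x => max (u x - δ) 0) ≤
      ENNReal.ofReal (2 * fracConst N s) * ∫⁻ x, ENNReal.ofReal (Ψ x * u x) := by
  have hN0 := pos_dim hs.1 hN
  obtain ⟨M, hM⟩ := h.bounded
  have hM' : ∀ x, |u x| ≤ M := fun x => by rw [abs_of_nonneg (h.nonneg x)]; exact hM x
  set φ : 𝔼 → ℝ := fun x => max (u x - δ) 0 with hφ
  have hφc : Continuous φ := (h.continuous.sub continuous_const).max continuous_const
  have hφ0 : ∀ x, 0 ≤ φ x := fun x => le_max_right _ _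
  have hφu : ∀ x, φ x ≤ u x := fun x => max_le (by linarith) (h.nonneg x)
  have hφs : HasCompactSupport φ := by
    have h1 : ∀ᶠ x in cocompact 𝔼, u x < δ := by
      rw [Metric.cobounded_eq_cocompact] at hlim
      exact hlim.eventually (Iio_mem_nhds hδ)
    rw [hasCompactSupport_iff_eventuallyEq]
    rw [coclosedCompact_eq_cocompact]
    filter_upwards [h1] with x hx
    exact max_eq_right (by linarith)
  obtain ⟨ρ, hρ⟩ := hφs.isCompact.isBounded.subset_closedBall 0
  have hφρ : ∀ x, φ x ≠ 0 → x ∈ Metric.closedBall (0 : 𝔼) ρ := fun x hx =>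
    hρ (subset_tsupport _ hx)
  obtain ⟨d, hdi, hd0, hd⟩ := exists_integrable_majorant_secondDiff hs hN0 hu hM' ρ
  -- the product integrand
  set F : 𝔼 → 𝔼 → ℝ := fun x y => φ x * (secondDiff u x y / ‖y‖ ^ ((N : ℝ) + 2 * s)) with hF
  have hsd : Continuous fun p : 𝔼 × 𝔼 => secondDiff u p.1 p.2 := by
    unfold secondDiff
    have := h.continuous
    fun_prop
  have hFi : Integrable (Function.uncurry F) ((volume : Measure 𝔼).prod volume) := by
    have hφi : Integrable φ := hφc.integrable_of_hasCompactSupport hφs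
    refine (hφi.mul_prod hdi).mono' ?_ (Eventually.of_forall fun p => ?_)
    · refine Measurable.aestronglyMeasurable ?_
      exact (hφc.measurable.comp measurable_fst).mul
        (hsd.measurable.div (measurable_snd.norm.pow_const _))
    · simp only [Function.uncurry, hF]
      rw [norm_mul, Real.norm_of_nonneg (hφ0 _), Real.norm_eq_abs]
      by_cases hp : φ p.1 = 0
      · rw [hp, zero_mul, zero_mul]
      · exact mul_le_mul_of_nonneg_left (hd _ (hφρ _ hp) _) (hφ0 _)
  have hLap : ∀ x, ∫ y, secondDiff u x y / ‖y‖ ^ ((N : ℝ) + 2 * s) = 2 * fracConst N s * Ψ x :=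
    fun x => by
      have := (hasFracLaplacian_of_contDiff hs hN0 hu hM' x).unique (h.hasFracLaplacian hs hN hu x)
      linarith
  -- integration by parts for a fixed increment
  have hfix : ∀ y, ∫ x, (φ x - φ (x + y)) ^ 2 / ‖y‖ ^ ((N : ℝ) + 2 * s) ≤ ∫ x, F x y := fun y => by
    have hK : 0 ≤ (‖y‖ ^ ((N : ℝ) + 2 * s))⁻¹ := by positivity
    have e1 : ∀ x, F x y = φ x * secondDiff u x y * (‖y‖ ^ ((N : ℝ) + 2 * s))⁻¹ := fun x => by
      simp only [hF, div_eq_mul_inv, mul_assoc]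
    simp_rw [e1, div_eq_mul_inv, integral_mul_const]
    exact mul_le_mul_of_nonneg_right (integral_sq_increment_le hφc hφs h.continuous
      (fun x y => sq_posPart_sub_le δ (u x) (u y)) y) hK
  have hfix' : ∀ y, ∫⁻ x, ENNReal.ofReal ((φ x - φ (x + y)) ^ 2 / ‖y‖ ^ ((N : ℝ) + 2 * s)) ≤
      ENNReal.ofReal (∫ x, F x y) := fun y => by
    rw [← ofReal_integral_eq_lintegral_ofReal ((integrable_sq_increment hφc hφs y).div_const _)
      (Eventually.of_forall fun x => by positivity)]
    exact ENNReal.ofReal_le_ofReal (hfix y)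
  have hG0 : ∀ y, 0 ≤ ∫ x, F x y := fun y =>
    (integral_nonneg fun x => by positivity).trans (hfix y)
  have hΨφ : Integrable fun x => Ψ x * φ x :=
    (h.continuous_density.mul hφc).integrable_of_hasCompactSupport hφs.mul_left
  calc gagliardo s φ ≤ ∫⁻ y, ENNReal.ofReal (∫ x, F x y) := by
        rw [gagliardo_eq_lintegral_shift hφc.measurable]
        exact lintegral_mono hfix'
    _ = ENNReal.ofReal (∫ y, ∫ x, F x y) :=
        (ofReal_integral_eq_lintegral_ofReal hFi.integral_prod_right (Eventually.of_forall hG0)).symm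
    _ = ENNReal.ofReal (2 * fracConst N s * ∫ x, Ψ x * φ x) := by
        rw [← integral_integral_swap hFi, ← integral_const_mul]
        congr 1
        refine integral_congr_ae (Eventually.of_forall fun x => ?_)
        simp only [hF]
        rw [integral_const_mul, hLap]
        ring
    _ = ENNReal.ofReal (2 * fracConst N s) * ∫⁻ x, ENNReal.ofReal (Ψ x * φ x) := by
        rw [ENNReal.ofReal_mul (by have := fracConst_pos hs hN; positivity),
          ofReal_integral_eq_lintegral_ofReal hΨφ
          (Eventually.of_forall fun x => mul_nonneg (h.density_nonneg x) (hφ0 x))]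
    _ ≤ _ := by
        gcongr with x
        · exact h.density_nonneg x
        · exact hφu x

/-- The energy of a potential that vanishes at infinity is at most `∫ u (-Δ)^s u`, up to the factor
`2`. It is obtained by testing with `(u - δ)₊` and letting `δ` tend to `0`. -/
theorem gagliardo_le_of_isPotential (hs : s ∈ Ioo (0 : ℝ) 1) (hN : 2 * s < N) {Ψ u : 𝔼 → ℝ}
    (h : IsPotential s Ψ u) (hu : ContDiff ℝ 2 u)
    (hlim : Tendsto u (Bornology.cobounded 𝔼) (𝓝 0)) :
    gagliardo s u ≤ ENNReal.ofReal (2 * fracConst N s) * ∫⁻ x, ENNReal.ofReal (Ψ x * u x) := by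
  obtain ⟨δ, hδ, hδt⟩ : ∃ δ : ℕ → ℝ, (∀ n, 0 < δ n) ∧ Tendsto δ atTop (𝓝 0) :=
    ⟨_, fun _ => Nat.one_div_pos_of_nat, tendsto_one_div_add_atTop_nhds_zero_nat (𝕜 := ℝ)⟩
  have hc : ∀ n : ℕ, Measurable fun x => max (u x - δ n) 0 := fun n =>
    ((h.continuous.sub continuous_const).max continuous_const).measurable
  have ht : ∀ x, Tendsto (fun n : ℕ => max (u x - δ n) 0) atTop (𝓝 (u x)) := fun x => by
    have h1 := (tendsto_const_nhds (x := u x)).sub hδt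
    have h2 := h1.max (tendsto_const_nhds (x := (0 : ℝ)))
    rwa [sub_zero, max_eq_left (h.nonneg x)] at h2
  have hle : ∀ n, gagliardo s (fun x => max (u x - δ n) 0) ≤
      ENNReal.ofReal (2 * fracConst N s) * ∫⁻ x, ENNReal.ofReal (Ψ x * u x) := fun n =>
    gagliardo_posPart_sub_le hs hN h hu hlim (hδ n)
  have hF : gagliardo s u ≤
      liminf (fun n : ℕ => gagliardo s (fun x => max (u x - δ n) 0)) atTop := by
    calc gagliardo s u = ∫⁻ z : 𝔼 × 𝔼, liminf (fun n : ℕ =>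
          ENNReal.ofReal ((max (u z.1 - δ n) 0 - max (u z.2 - δ n) 0) ^ 2 /
            ‖z.1 - z.2‖ ^ ((N : ℝ) + 2 * s))) atTop := by
          refine lintegral_congr fun z => ?_
          refine (Tendsto.liminf_eq ?_).symm
          exact ENNReal.tendsto_ofReal ((((ht z.1).sub (ht z.2)).pow 2).div_const _)
      _ ≤ _ := lintegral_liminf_le fun n => measurable_gagliardo_integrand (hc n)
  refine hF.trans (liminf_le_of_le (by isBoundedDefault) fun b hb => ?_)
  obtain ⟨n, hn⟩ := hb.exists
  exact hn.trans (hle n)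

/-! ### A supersolution that is small on one annulus -/

namespace IsPowerPotential

variable {α c C : ℝ} {f w : EuclideanSpace ℝ (Fin N) → ℝ}

theorem pos (h : IsPowerPotential s α c C f w) (x : 𝔼) : 0 < w x :=
  lt_of_lt_of_le (mul_pos h.c_pos (Real.rpow_pos_of_pos (by positivity) _)) (h.lower x)

theorem lower_of_le (h : IsPowerPotential s α c C f w) (hα : 0 < α) {x : 𝔼} {r : ℝ}
    (hx : 1 + ‖x‖ ≤ r) : c * r ^ (-α) ≤ w x := by
  refine le_trans (mul_le_mul_of_nonneg_left ?_ h.c_pos.le) (h.lower x)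
  exact Real.rpow_le_rpow_of_nonpos (by positivity) hx (by linarith)

theorem upper_of_le (h : IsPowerPotential s α c C f w) (hα : 0 < α) {x : 𝔼} {r : ℝ} (hr : 0 < r)
    (hx : r ≤ ‖x‖) : w x ≤ C * r ^ (-α) := by
  refine (h.upper x).trans (mul_le_mul_of_nonneg_left ?_ h.C_pos.le)
  exact Real.rpow_le_rpow_of_nonpos hr (by linarith) (by linarith)

theorem tendsto (h : IsPowerPotential s α c C f w) (hα : 0 < α) :
    Tendsto w (Bornology.cobounded 𝔼) (𝓝 0) := by
  have h1 : Tendsto (fun x : 𝔼 => 1 + ‖x‖) (Bornology.cobounded 𝔼) atTop :=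
    tendsto_atTop_add_const_left _ _ tendsto_norm_cobounded_atTop
  have h2 := ((tendsto_rpow_neg_atTop hα).comp h1).const_mul C
  rw [mul_zero] at h2
  exact squeeze_zero (fun x => (h.pos x).le) h.upper h2

end IsPowerPotential

/-- A continuous cutoff of an annulus. -/
theorem exists_annulus_cutoff {ρ B : ℝ} (hρ : 0 < ρ) (hB : 1 ≤ B) :
    ∃ χ : 𝔼 → ℝ, Continuous χ ∧ (∀ x, 0 ≤ χ x) ∧ (∀ x, χ x ≤ 1) ∧
      (∀ x, ρ ≤ ‖x‖ → ‖x‖ ≤ B * ρ → χ x = 1) ∧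
      ∀ x, χ x ≠ 0 → 3 / 4 * ρ ≤ ‖x‖ ∧ ‖x‖ ≤ 3 / 2 * (B * ρ) := by
  have hBρ : 0 < B * ρ := by positivity
  refine ⟨fun x => max 0 (min 1 (4 * ‖x‖ / ρ - 3)) * max 0 (min 1 (3 - 2 * ‖x‖ / (B * ρ))), ?_,
    fun x => by positivity, fun x => ?_, fun x h1 h2 => ?_, fun x hx => ⟨?_, ?_⟩⟩
  · fun_prop
  · refine mul_le_one₀ (max_le zero_le_one (min_le_left _ _)) (le_max_left _ _)
      (max_le zero_le_one (min_le_left _ _))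
  · have e1 : 1 ≤ 4 * ‖x‖ / ρ - 3 := by
      have : 4 ≤ 4 * ‖x‖ / ρ := by rw [le_div_iff₀ hρ]; linarith
      linarith
    have e2 : 1 ≤ 3 - 2 * ‖x‖ / (B * ρ) := by
      have : 2 * ‖x‖ / (B * ρ) ≤ 2 := by rw [div_le_iff₀ hBρ]; linarith
      linarith
    beta_reduce
    rw [min_eq_left e1, min_eq_left e2]
    norm_num
  · by_contra! hc
    have : 4 * ‖x‖ / ρ - 3 ≤ 0 := by
      have : 4 * ‖x‖ / ρ ≤ 3 := by rw [div_le_iff₀ hρ]; linarith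
      linarith
    refine hx ?_
    beta_reduce
    rw [max_eq_left ((min_le_right _ _).trans this), zero_mul]
  · by_contra! hc
    have : 3 - 2 * ‖x‖ / (B * ρ) ≤ 0 := by
      have : 3 ≤ 2 * ‖x‖ / (B * ρ) := by rw [le_div_iff₀ hBρ]; linarith
      linarith
    refine hx ?_
    beta_reduce
    rw [max_eq_left (b := min 1 (3 - 2 * ‖x‖ / (B * ρ))) ((min_le_right _ _).trans this), mul_zero]

theorem moll_ne_zero {φ : ContDiffBump (0 : 𝔼)} {u : 𝔼 → ℝ} {x : 𝔼} (h : moll φ u x ≠ 0) :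
    ∃ t : 𝔼, ‖t‖ < φ.rOut ∧ u (x - t) ≠ 0 := by
  by_contra! hc
  refine h ?_
  rw [moll_apply]
  refine integral_eq_zero_of_ae (Eventually.of_forall fun t => ?_)
  by_cases ht : ‖t‖ < φ.rOut
  · simp [hc t ht]
  · simp [normed_eq_zero_of_le (not_lt.1 ht)]

theorem IsPotential.eq {Ψ u v : 𝔼 → ℝ} (h : IsPotential s Ψ u) (h' : IsPotential s Ψ v) : u = v := by
  funext x
  have := (h.eq_riesz x).trans (h'.eq_riesz x).symm
  exact (ENNReal.ofReal_eq_ofReal_iff (h.nonneg x) (h'.nonneg x)).1 this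

section Annulus

variable {α c C : ℝ} {f w : EuclideanSpace ℝ (Fin N) → ℝ}

/-- A density on an annulus whose potential is dominated by the power potential `w` has small mass,
and its potential is much smaller than `w` away from the annulus. -/
theorem IsPowerPotential.exists_decay (hs : s ∈ Ioo (0 : ℝ) 1) (h : IsPowerPotential s α c C f w)
    (hα : 0 < α) (hαN : α < N - 2 * s) :
    ∃ κ₁ κ₂ K : ℝ, 0 < κ₁ ∧ 4 ≤ κ₂ ∧ 0 < K ∧ ∀ (B ρ : ℝ) (η : 𝔼 → ℝ), 1 ≤ B → 1 ≤ ρ → Continuous η →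
      (∀ x, 0 ≤ η x) → (∀ x, η x ≠ 0 → ρ / 2 ≤ ‖x‖ ∧ ‖x‖ ≤ 2 * (B * ρ)) →
      (∀ x, ‖x‖ ≤ κ₂ * (B * ρ) → riesz s η x ≤ 2 * w x) →
      HasCompactSupport η ∧
      (∫ x, η x * w x ≤ K * B ^ (N - 2 * s - α) * ρ ^ (N - 2 * s - 2 * α)) ∧
      ∀ x, (1 + ‖x‖ ≤ κ₁ * (ρ * B ^ (-((N - 2 * s - α) / α))) ∨ κ₂ * (B * ρ) ≤ ‖x‖) →
        riesz s η x ≤ w x / 2 := by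
  have hN : 2 * s < N := by linarith
  have := nontrivial_euclidean (pos_dim hs.1 hN)
  have hc := h.c_pos
  have hC := h.C_pos
  set γ := (N : ℝ) - 2 * s with hγ
  have hγ0 : 0 < γ := by linarith
  have hd : 0 < γ - α := by linarith
  set K₁ := 2 * C * 4 ^ γ with hK₁
  have hK₁0 : 0 < K₁ := by positivity
  set Q := 2 * 4 ^ γ * K₁ / c with hQ
  have hQ0 : 0 < Q := by positivity
  set Q₂ := 2 ^ (γ + α + 1) * K₁ / c with hQ₂
  have hQ₂0 : 0 < Q₂ := by positivity
  refine ⟨min (1 / 4) (Q ^ (-(1 / α))), max 4 (Q₂ ^ (1 / (γ - α))), C * 2 ^ α * K₁,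
    lt_min (by norm_num) (by positivity), le_max_left _ _, by positivity,
    fun B ρ η hB hρ hηc hη0 hηs hle => ?_⟩
  set κ₁ := min (1 / 4) (Q ^ (-(1 / α))) with hκ₁
  set κ₂ := max 4 (Q₂ ^ (1 / (γ - α))) with hκ₂
  have hκ₂4 : 4 ≤ κ₂ := le_max_left _ _
  have hB0 : 0 < B := by linarith
  have hρ0 : 0 < ρ := by linarith
  have hBρ : 0 < B * ρ := by positivity
  have hcs : HasCompactSupport η := by
    refine HasCompactSupport.intro (isCompact_closedBall (0 : 𝔼) (2 * (B * ρ))) fun x hx => ?_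
    by_contra hne
    exact hx (by rw [mem_closedBall_zero_iff]; exact (hηs x hne).2)
  -- the value of the potential at one point of norm `2 B ρ` controls the mass
  have hmass : ∫ y, η y ≤ K₁ * (B * ρ) ^ (γ - α) := by
    obtain ⟨x₀, hx₀⟩ := exists_norm_eq 𝔼 (by positivity : 0 ≤ 2 * (B * ρ))
    have h1 := mass_le_riesz hs.1 hN hηc hcs hη0 (x := x₀) (r := 4 * (B * ρ)) fun y hy => by
      have := norm_sub_le x₀ y
      have := (hηs y hy).2
      linarith
    have h2 : riesz s η x₀ ≤ 2 * (C * (B * ρ) ^ (-α)) := by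
      refine (hle x₀ (by rw [hx₀]; nlinarith)).trans ?_
      refine mul_le_mul_of_nonneg_left (h.upper_of_le hα hBρ ?_) (by norm_num)
      rw [hx₀]; linarith
    refine (h1.trans (mul_le_mul_of_nonneg_left h2 (by positivity))).trans (le_of_eq ?_)
    rw [Real.mul_rpow (by norm_num) hBρ.le, sub_eq_add_neg γ α, Real.rpow_add hBρ, hK₁]
    ring
  have hmass0 : 0 ≤ ∫ y, η y := integral_nonneg hη0
  refine ⟨hcs, ?_, fun x hx => ?_⟩
  · have h3 : ∀ x, η x * w x ≤ (C * 2 ^ α * ρ ^ (-α)) * η x := fun x => by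
      by_cases hx : η x = 0
      · simp [hx]
      · rw [mul_comm]
        refine mul_le_mul_of_nonneg_right ?_ (hη0 x)
        refine (h.upper_of_le hα (by positivity) (hηs x hx).1).trans (le_of_eq ?_)
        have e : ((2 : ℝ)⁻¹) ^ (-α) = 2 ^ α := by
          rw [Real.inv_rpow (by norm_num), Real.rpow_neg (by norm_num), inv_inv]
        rw [div_eq_mul_inv, Real.mul_rpow hρ0.le (by norm_num), e]
        ring
    have hηi : Integrable η := hηc.integrable_of_hasCompactSupport hcs
    calc ∫ x, η x * w x ≤ ∫ x, (C * 2 ^ α * ρ ^ (-α)) * η x :=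
          integral_mono ((hηc.mul h.isPotential.continuous).integrable_of_hasCompactSupport
            hcs.mul_right) (hηi.const_mul _) h3
      _ = (C * 2 ^ α * ρ ^ (-α)) * ∫ x, η x := integral_const_mul _ _
      _ ≤ (C * 2 ^ α * ρ ^ (-α)) * (K₁ * (B * ρ) ^ (γ - α)) :=
          mul_le_mul_of_nonneg_left hmass (by positivity)
      _ = C * 2 ^ α * K₁ * B ^ (γ - α) * ρ ^ (γ - 2 * α) := by
          rw [Real.mul_rpow hB0.le hρ0.le, show γ - 2 * α = -α + (γ - α) by ring, Real.rpow_add hρ0]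
          ring
  -- away from the annulus the potential is at most the mass times the kernel; inside, this is
  -- compared with the lower bound `c (1 + |x|)^(-α)` for `w`, outside with its decay, as `α < γ`
  · rcases hx with hx | hx
    · have hBθ : B ^ (-((γ - α) / α)) ≤ 1 :=
        Real.rpow_le_one_of_one_le_of_nonpos hB (by
          have : 0 < (γ - α) / α := by positivity
          linarith)
      have hx4 : ‖x‖ ≤ ρ / 4 := by
        have h5 : κ₁ * (ρ * B ^ (-((γ - α) / α))) ≤ 1 / 4 * (ρ * 1) := by
          refine mul_le_mul (min_le_left _ _) (mul_le_mul_of_nonneg_left hBθ hρ0.le) (by positivity)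
            (by norm_num)
        linarith
      have h6 : riesz s η x ≤ (ρ / 4) ^ (2 * s - N) * ∫ y, η y :=
        riesz_le_of_dist hs.1 hN hηc hcs hη0 (by positivity) fun y hy => by
          have := norm_sub_norm_le y x
          rw [norm_sub_rev] at this
          have := (hηs y hy).1
          linarith
      rw [show 2 * s - (N : ℝ) = -γ by rw [hγ]; ring] at h6
      have h7 : (1 + ‖x‖) ^ α * Q * B ^ (γ - α) ≤ ρ ^ α := by
        have h8 : (1 + ‖x‖) ^ α ≤ (κ₁ * (ρ * B ^ (-((γ - α) / α)))) ^ α :=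
          Real.rpow_le_rpow (by positivity) hx hα.le
        have hκ₁0 : 0 < κ₁ := lt_min (by norm_num) (by positivity)
        have h9 : κ₁ ^ α ≤ Q⁻¹ := by
          calc κ₁ ^ α ≤ (Q ^ (-(1 / α))) ^ α := Real.rpow_le_rpow hκ₁0.le (min_le_right _ _) hα.le
            _ = Q⁻¹ := by
              rw [← Real.rpow_mul hQ0.le, neg_mul, one_div, inv_mul_cancel₀ hα.ne', Real.rpow_neg_one]
        have h10 : (B ^ (-((γ - α) / α))) ^ α = (B ^ (γ - α))⁻¹ := by
          rw [← Real.rpow_mul hB0.le, neg_mul, div_mul_cancel₀ _ hα.ne', Real.rpow_neg hB0.le]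
        rw [Real.mul_rpow hκ₁0.le (by positivity), Real.mul_rpow hρ0.le (by positivity), h10] at h8
        calc (1 + ‖x‖) ^ α * Q * B ^ (γ - α)
            ≤ (Q⁻¹ * (ρ ^ α * (B ^ (γ - α))⁻¹)) * Q * B ^ (γ - α) := by
              refine mul_le_mul_of_nonneg_right (mul_le_mul_of_nonneg_right (h8.trans ?_) hQ0.le)
                (by positivity)
              exact mul_le_mul_of_nonneg_right h9 (by positivity)
          _ = ρ ^ α := by
              have : B ^ (γ - α) ≠ 0 := (Real.rpow_pos_of_pos hB0 _).ne'
              field_simp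
      have h11 := h.lower x
      have hX : 0 < (1 + ‖x‖) ^ α := by positivity
      rw [Real.rpow_neg (by positivity)] at h11
      calc riesz s η x ≤ (ρ / 4) ^ (-γ) * (K₁ * (B * ρ) ^ (γ - α)) :=
            h6.trans (mul_le_mul_of_nonneg_left hmass (by positivity))
        _ = 4 ^ γ * K₁ * B ^ (γ - α) * (ρ ^ α)⁻¹ := by
            rw [Real.mul_rpow hB0.le hρ0.le, sub_eq_add_neg γ α, Real.rpow_add hρ0, Real.rpow_neg (by positivity) γ,
              Real.div_rpow hρ0.le (by norm_num), Real.rpow_neg hρ0.le α, inv_div]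
            have : ρ ^ γ ≠ 0 := (Real.rpow_pos_of_pos hρ0 _).ne'
            field_simp
        _ ≤ 4 ^ γ * K₁ * B ^ (γ - α) * ((1 + ‖x‖) ^ α * Q * B ^ (γ - α))⁻¹ :=
            mul_le_mul_of_nonneg_left (inv_anti₀ (by positivity) h7) (by positivity)
        _ = c * ((1 + ‖x‖) ^ α)⁻¹ / 2 := by
            have : B ^ (γ - α) ≠ 0 := (Real.rpow_pos_of_pos hB0 _).ne'
            rw [hQ]
            field_simp
        _ ≤ w x / 2 := by linarith
    · have hx1 : 1 ≤ ‖x‖ := by nlinarith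
      have hx0 : 0 < ‖x‖ := by linarith
      have h6 : riesz s η x ≤ (‖x‖ / 2) ^ (2 * s - N) * ∫ y, η y :=
        riesz_le_of_dist hs.1 hN hηc hcs hη0 (by positivity) fun y hy => by
          have := norm_sub_norm_le x y
          have := (hηs y hy).2
          nlinarith
      rw [show 2 * s - (N : ℝ) = -γ by rw [hγ]; ring] at h6
      have hκ₂0 : 0 < κ₂ := by linarith
      have h7 : Q₂ * (B * ρ) ^ (γ - α) ≤ ‖x‖ ^ (γ - α) := by
        have h8 : Q₂ ≤ κ₂ ^ (γ - α) := by
          calc Q₂ = (Q₂ ^ (1 / (γ - α))) ^ (γ - α) := by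
                rw [← Real.rpow_mul hQ₂0.le, one_div, inv_mul_cancel₀ hd.ne', Real.rpow_one]
            _ ≤ κ₂ ^ (γ - α) := Real.rpow_le_rpow (by positivity) (le_max_right _ _) hd.le
        calc Q₂ * (B * ρ) ^ (γ - α) ≤ κ₂ ^ (γ - α) * (B * ρ) ^ (γ - α) :=
              mul_le_mul_of_nonneg_right h8 (by positivity)
          _ = (κ₂ * (B * ρ)) ^ (γ - α) := (Real.mul_rpow hκ₂0.le hBρ.le).symm
          _ ≤ _ := Real.rpow_le_rpow (by positivity) hx hd.le
      have h9 : (B * ρ) ^ (γ - α) ≤ ‖x‖ ^ (γ - α) / Q₂ := by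
        rw [le_div_iff₀ hQ₂0, mul_comm]; exact h7
      calc riesz s η x ≤ (‖x‖ / 2) ^ (-γ) * (K₁ * (‖x‖ ^ (γ - α) / Q₂)) :=
            h6.trans (mul_le_mul_of_nonneg_left (hmass.trans
              (mul_le_mul_of_nonneg_left h9 hK₁0.le)) (by positivity))
        _ = c * (2 * ‖x‖) ^ (-α) / 2 := by
            rw [hQ₂, Real.rpow_neg (by positivity), Real.rpow_neg (by positivity),
              Real.div_rpow hx0.le (by norm_num), Real.mul_rpow (by norm_num) hx0.le,
              Real.rpow_sub hx0 γ α, Real.rpow_add (by norm_num) (γ + α) 1,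
              Real.rpow_add (by norm_num) γ α, Real.rpow_one]
            have : ‖x‖ ^ γ ≠ 0 := (Real.rpow_pos_of_pos hx0 _).ne'
            have : ‖x‖ ^ α ≠ 0 := (Real.rpow_pos_of_pos hx0 _).ne'
            field_simp
        _ ≤ w x / 2 := by
            have := h.lower_of_le hα (x := x) (r := 2 * ‖x‖) (by linarith)
            linarith

end Annulus

theorem uniformContinuous_of_hasCompactSupport {u : 𝔼 → ℝ} (hu : Continuous u)
    (h : HasCompactSupport u) : UniformContinuous u :=
  hu.uniformContinuous_of_tendsto_cocompact h.is_zero_at_infty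

set_option maxHeartbeats 1000000 in
/-- Solving the equation with the absorption term `a V v` cut off to an annulus, and mollifying, gives
a positive function `(1 + κ) w - g` that is small on the annulus, as it compensates the potential
there, and comparable to `w` away from the annulus. -/
theorem IsPowerPotential.exists_annulus_supersolution (hs : s ∈ Ioo (0 : ℝ) 1) {α c C : ℝ}
    {f w : 𝔼 → ℝ} (h : IsPowerPotential s α c C f w) (hα : 0 < α) (hαN : α < N - 2 * s) :
    ∃ κ₁ κ₂ K : ℝ, 0 < κ₁ ∧ 4 ≤ κ₂ ∧ 0 < K ∧ ∀ (V : 𝔼 → ℝ) (a B ρ : ℝ), Continuous V →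
      (∀ x, 0 ≤ V x) → 0 < a → 1 ≤ B → 1 ≤ ρ → (∀ x, ρ / 2 ≤ ‖x‖ → 0 < V x) →
      ∃ (κ : ℝ) (η g : 𝔼 → ℝ), 0 ≤ κ ∧ κ ≤ 1 ∧ IsPotential s η g ∧ ContDiff ℝ 2 g ∧
        (∀ x, 0 < (1 + κ) * w x - g x) ∧
        (∀ x, fracConst N s * η x ≤ a * V x * ((1 + κ) * w x - g x)) ∧
        gagliardo s g ≤
          ENNReal.ofReal (K * (B ^ (N - 2 * s - α) * ρ ^ (N - 2 * s - 2 * α))) ∧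
        ∫⁻ x in {x | ρ ≤ ‖x‖ ∧ ‖x‖ ≤ B * ρ},
          ENNReal.ofReal (a * (V x * ((1 + κ) * w x - g x) ^ 2)) ≤
          ENNReal.ofReal (K * (B ^ (N - 2 * s - α) * ρ ^ (N - 2 * s - 2 * α))) ∧
        ∀ x, (1 + ‖x‖ ≤ κ₁ * (ρ * B ^ (-((N - 2 * s - α) / α))) ∨ κ₂ * (B * ρ) ≤ ‖x‖) →
          g x ≤ w x / 2 := by
  have hN : 2 * s < N := by linarith
  obtain ⟨κ₁, κ₂, K, hκ₁, hκ₂, hK, hdec⟩ := h.exists_decay hs hα hαN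
  set F := fracConst N s with hF
  have hF0 : 0 < F := fracConst_pos hs hN
  have hwc := h.isPotential.continuous
  refine ⟨κ₁, κ₂, 4 * F * K + 1, hκ₁, hκ₂, by positivity, fun V a B ρ hVc hV0 ha hB hρ hVpos => ?_⟩
  have hB0 : 0 < B := by linarith
  have hρ0 : 0 < ρ := by linarith
  have hBρ : 0 < B * ρ := by positivity
  have hρB : ρ ≤ B * ρ := by nlinarith
  set D := B ^ (N - 2 * s - α) * ρ ^ (N - 2 * s - 2 * α) with hD
  have hD0 : 0 < D := by positivity
  obtain ⟨χ, hχc, hχ0, hχ1, hχeq, hχs⟩ := exists_annulus_cutoff (N := N) hρ0 hB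
  -- the solution with absorption on the annulus
  set W : 𝔼 → ℝ := fun x => a / F * V x * χ x with hW
  have hWc : Continuous W := (continuous_const.mul hVc).mul hχc
  have hW0 : ∀ x, 0 ≤ W x := fun x =>
    mul_nonneg (mul_nonneg (by positivity) (hV0 x)) (hχ0 x)
  have hWs : ∀ x, W x ≠ 0 → 3 / 4 * ρ ≤ ‖x‖ ∧ ‖x‖ ≤ 3 / 2 * (B * ρ) := fun x hx =>
    hχs x (right_ne_zero_of_mul hx)
  have hWcs : HasCompactSupport W := by
    refine HasCompactSupport.intro (isCompact_closedBall (0 : 𝔼) (3 / 2 * (B * ρ))) fun x hx => ?_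
    by_contra hne
    exact hx (by rw [mem_closedBall_zero_iff]; exact (hWs x hne).2)
  obtain ⟨v, hvc, hv0, hvw, hveq⟩ :=
    exists_absorption_solution hs hN hWc hWcs hW0 h.isPotential (h.tendsto hα)
  set h₀ : 𝔼 → ℝ := fun x => W x * v x with hh₀
  have hh₀c : Continuous h₀ := hWc.mul hvc
  have hh₀cs : HasCompactSupport h₀ := hWcs.mul_right
  have hh₀0 : ∀ x, 0 ≤ h₀ x := fun x => mul_nonneg (hW0 x) (hv0 x)
  have hh₀s : ∀ x, h₀ x ≠ 0 → 3 / 4 * ρ ≤ ‖x‖ ∧ ‖x‖ ≤ 3 / 2 * (B * ρ) := fun x hx =>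
    hWs x (left_ne_zero_of_mul hx)
  set g₀ := riesz s h₀ with hg₀
  have hg₀p : IsPotential s h₀ g₀ := isPotential_riesz hs.1 hN hh₀c hh₀cs hh₀0
  have hg₀w : ∀ x, g₀ x ≤ w x := fun x => by have := hveq x; have := hv0 x; linarith
  -- the term `κ w` has to absorb the errors `ε₁` and `ε₂` of the mollification, and `κ` is chosen so
  -- small that its contribution to the `V`-energy on the annulus is at most `D`
  set A : Set 𝔼 := {x | ρ ≤ ‖x‖ ∧ ‖x‖ ≤ B * ρ} with hA
  have hAc : IsCompact A := by
    refine (isCompact_closedBall (0 : 𝔼) (B * ρ)).of_isClosed_subset ?_ fun x hx => ?_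
    · exact (isClosed_le continuous_const continuous_norm).inter
        (isClosed_le continuous_norm continuous_const)
    · rw [mem_closedBall_zero_iff]; exact hx.2
  have hVwc : Continuous fun x => V x * w x ^ 2 := hVc.mul (hwc.pow 2)
  set J := ∫ x in A, V x * w x ^ 2 with hJ
  have hJ0 : 0 ≤ J := integral_nonneg fun x => mul_nonneg (hV0 x) (sq_nonneg _)
  set κ := min 1 (D / (8 * a * J + 1)) with hκ
  have hκ0 : 0 < κ := lt_min one_pos (by positivity)
  have hκ1 : κ ≤ 1 := min_le_left _ _
  have hκJ : 8 * κ ^ 2 * a * J ≤ D := by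
    have h1 : κ * (8 * a * J + 1) ≤ D := by
      rw [← le_div_iff₀ (by positivity)]; exact min_le_right _ _
    have h2 : κ ^ 2 ≤ κ := by nlinarith
    have h3 : 0 ≤ 8 * a * J := by positivity
    calc 8 * κ ^ 2 * a * J = κ ^ 2 * (8 * a * J) := by ring
      _ ≤ κ * (8 * a * J) := mul_le_mul_of_nonneg_right h2 h3
      _ ≤ κ * (8 * a * J + 1) := by nlinarith
      _ ≤ D := h1
  set r := κ₂ * (B * ρ) with hr
  have hr0 : 0 < r := by positivity
  have hBr2 : 2 * (B * ρ) ≤ r := mul_le_mul_of_nonneg_right (by linarith) hBρ.le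
  have hBr : B * ρ ≤ r := by linarith
  set m := c * (1 + r) ^ (-α) with hm
  have hm0 : 0 < m := mul_pos h.c_pos (by positivity)
  have hwm : ∀ x, ‖x‖ ≤ r → m ≤ w x := fun x hx => h.lower_of_le hα (by linarith)
  set ε₁ := κ * m / 2 with hε₁
  have hε₁0 : 0 < ε₁ := by positivity
  set A₂ : Set 𝔼 := {x | ρ / 2 ≤ ‖x‖ ∧ ‖x‖ ≤ 2 * (B * ρ)} with hA₂
  have hA₂c : IsCompact A₂ := by
    refine (isCompact_closedBall (0 : 𝔼) (2 * (B * ρ))).of_isClosed_subset ?_ fun x hx => ?_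
    · exact (isClosed_le continuous_const continuous_norm).inter
        (isClosed_le continuous_norm continuous_const)
    · rw [mem_closedBall_zero_iff]; exact hx.2
  obtain ⟨ε₂, hε₂0, hε₂⟩ := hA₂c.exists_forall_le' (f := fun x => a / F * V x * (κ * w x / 2))
    (a := 0) (by fun_prop) fun x hx => by
      have := hVpos x hx.1
      have := h.pos x
      positivity
  obtain ⟨η₁, hη₁, hcl₁⟩ := exists_moll_close (uniformContinuous_of_tendsto_cobounded
    hg₀p.continuous (tendsto_riesz_cobounded hs.1 hN hh₀c hh₀cs)) hε₁0
  obtain ⟨η₂, hη₂, hcl₂⟩ := exists_moll_close (uniformContinuous_of_hasCompactSupport hh₀c hh₀cs) hε₂0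
  obtain ⟨φ, hφ⟩ := exists_bump_rOut_le (N := N) (lt_min hη₁ (lt_min hη₂ (by positivity : 0 < ρ / 4)))
  have hφ₁ : φ.rOut ≤ η₁ := hφ.trans (min_le_left _ _)
  have hφ₂ : φ.rOut ≤ η₂ := hφ.trans ((min_le_right _ _).trans (min_le_left _ _))
  have hφ₃ : φ.rOut ≤ ρ / 4 := hφ.trans ((min_le_right _ _).trans (min_le_right _ _))
  set η := moll φ h₀ with hη
  set g := moll φ g₀ with hg
  have hcg : ∀ x, |g x - g₀ x| ≤ ε₁ := hcl₁ φ hφ₁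
  have hch : ∀ x, |η x - h₀ x| ≤ ε₂ := hcl₂ φ hφ₂
  have hgp : IsPotential s η g := hg₀p.moll φ
  have hgC : ContDiff ℝ 2 g := contDiff_moll hg₀p.continuous
  have hηs : ∀ x, η x ≠ 0 → ρ / 2 ≤ ‖x‖ ∧ ‖x‖ ≤ 2 * (B * ρ) := fun x hx => by
    obtain ⟨t, ht, hne⟩ := moll_ne_zero hx
    obtain ⟨h1, h2⟩ := hh₀s _ hne
    have h3 := norm_sub_le x t
    have h4 := norm_sub_norm_le x t
    constructor <;> linarith
  -- `w` is bounded below by `m` only on the ball of radius `r`; outside, the decay of `g` is used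
  have hnear : ∀ x, ‖x‖ ≤ r → v x + κ * w x / 2 ≤ (1 + κ) * w x - g x ∧
      (1 + κ) * w x - g x ≤ v x + 2 * κ * w x := fun x hx => by
    have h1 := abs_le.1 (hcg x)
    have h2 := mul_le_mul_of_nonneg_left (hwm x hx) hκ0.le
    have h3 : v x + g₀ x = w x := hveq x
    have h4 := h.pos x
    rw [hε₁] at h1
    have h5 : 0 ≤ κ * w x := by positivity
    rw [add_mul]
    constructor <;> linarith
  have hηcs : HasCompactSupport η := by
    refine HasCompactSupport.intro (isCompact_closedBall (0 : 𝔼) (2 * (B * ρ))) fun x hx => ?_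
    by_contra hne
    exact hx (by rw [mem_closedBall_zero_iff]; exact (hηs x hne).2)
  have hηc := hgp.continuous_density
  have hrg : riesz s η = g := (isPotential_riesz hs.1 hN hηc hηcs hgp.density_nonneg).eq hgp
  have hdη := hdec B ρ η hB hρ hηc hgp.density_nonneg hηs fun x hx => by
    rw [hrg]
    have h1 := (hnear x hx).1
    have h2 := hv0 x
    have h4 : 0 ≤ (1 - κ) * w x := mul_nonneg (by linarith) (h.pos x).le
    have h5 : 0 ≤ κ * w x := mul_nonneg hκ0.le (h.pos x).le
    rw [add_mul] at h1
    rw [sub_mul] at h4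
    linarith
  have hdh := hdec B ρ h₀ hB hρ hh₀c hh₀0 (fun x hx => by
    obtain ⟨h1, h2⟩ := hh₀s x hx
    constructor <;> linarith) fun x _ => by
      have h1 := hg₀w x
      have h4 := h.pos x
      linarith
  rw [hrg, mul_assoc] at hdη
  rw [mul_assoc] at hdh
  obtain ⟨-, hηw, hloc⟩ := hdη
  obtain ⟨-, hhw, -⟩ := hdh
  have hpos : ∀ x, 0 < (1 + κ) * w x - g x := fun x => by
    have h4 := h.pos x
    rcases le_total ‖x‖ r with hx | hx
    · have h1 := (hnear x hx).1
      have h2 := hv0 x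
      have : 0 < κ * w x / 2 := by positivity
      linarith
    · have h1 := hloc x (Or.inr hx)
      have h2 : 0 ≤ κ * w x := by positivity
      rw [add_mul]
      linarith
  refine ⟨κ, η, g, hκ0.le, hκ1, hgp, hgC, hpos, fun x => ?_, ?_, ?_, hloc⟩
  · by_cases hx : η x = 0
    · rw [hx, mul_zero]
      exact mul_nonneg (mul_nonneg ha.le (hV0 x)) (hpos x).le
    · have hxA := hηs x hx
      have h1 := (hnear x (hxA.2.trans hBr2)).1
      have h2 : ε₂ ≤ a / F * V x * (κ * w x / 2) := hε₂ x hxA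
      have h3 := (abs_le.1 (hch x)).2
      have h4 : h₀ x ≤ a / F * V x * v x := by
        have : W x ≤ a / F * V x :=
          mul_le_of_le_one_right (mul_nonneg (by positivity) (hV0 x)) (hχ1 x)
        exact mul_le_mul_of_nonneg_right this (hv0 x)
      have h5 : η x ≤ a / F * V x * ((1 + κ) * w x - g x) := by
        calc η x ≤ a / F * V x * (v x + κ * w x / 2) := by rw [mul_add]; linarith
          _ ≤ _ := mul_le_mul_of_nonneg_left h1 (mul_nonneg (by positivity) (hV0 x))
      calc F * η x ≤ F * (a / F * V x * ((1 + κ) * w x - g x)) :=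
            mul_le_mul_of_nonneg_left h5 hF0.le
        _ = F * (a / F) * V x * ((1 + κ) * w x - g x) := by simp only [mul_assoc]
        _ = _ := by rw [mul_div_cancel₀ a hF0.ne']
  · have hηi : Integrable fun x => η x * w x :=
      (hηc.mul hwc).integrable_of_hasCompactSupport hηcs.mul_right
    calc gagliardo s g ≤ ENNReal.ofReal (2 * F) * ∫⁻ x, ENNReal.ofReal (η x * g x) := by
          refine gagliardo_le_of_isPotential hs hN hgp hgC ?_
          rw [← hrg]
          exact tendsto_riesz_cobounded hs.1 hN hηc hηcs
      _ ≤ ENNReal.ofReal (2 * F) * ∫⁻ x, ENNReal.ofReal (2 * (η x * w x)) := by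
          refine mul_le_mul_right (lintegral_mono fun x => ENNReal.ofReal_le_ofReal ?_) _
          have h1 := hpos x
          have h4 := h.pos x
          have h6 : g x ≤ 2 * w x := by
            have h7 : 0 ≤ (1 - κ) * w x := mul_nonneg (by linarith) h4.le
            rw [sub_mul] at h7
            rw [add_mul] at h1
            linarith
          exact (mul_le_mul_of_nonneg_left h6 (hgp.density_nonneg x)).trans_eq (mul_left_comm _ _ _)
      _ = ENNReal.ofReal (4 * F * ∫ x, η x * w x) := by
          rw [← ofReal_integral_eq_lintegral_ofReal (hηi.const_mul 2) (Eventually.of_forall fun x =>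
            mul_nonneg zero_le_two (mul_nonneg (hgp.density_nonneg x) (h.pos x).le)),
            ← ENNReal.ofReal_mul (by positivity), integral_const_mul]
          congr 1; ring
      _ ≤ _ := by
          refine ENNReal.ofReal_le_ofReal ?_
          have h1 := mul_le_mul_of_nonneg_left hηw (by positivity : 0 ≤ 4 * F)
          have h2 : (4 * F * K + 1) * D = 4 * F * (K * D) + D := by ring
          rw [h2]
          linarith
  · have hhi : Integrable fun x => h₀ x * w x :=
      (hh₀c.mul hwc).integrable_of_hasCompactSupport hh₀cs.mul_right
    have hAi : IntegrableOn (fun x => V x * w x ^ 2) A := hVwc.continuousOn.integrableOn_compact hAc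
    have hpt : ∀ x ∈ A, a * (V x * ((1 + κ) * w x - g x) ^ 2) ≤
        2 * F * (h₀ x * w x) + 8 * κ ^ 2 * a * (V x * w x ^ 2) := fun x hx => by
      have h1 := (hnear x (hx.2.trans hBr)).2
      have h2 : ((1 + κ) * w x - g x) ^ 2 ≤ 2 * v x ^ 2 + 8 * κ ^ 2 * w x ^ 2 := by
        calc ((1 + κ) * w x - g x) ^ 2 ≤ (v x + 2 * κ * w x) ^ 2 :=
              pow_le_pow_left₀ (hpos x).le h1 2
          _ ≤ _ := by nlinarith [sq_nonneg (v x - 2 * κ * w x)]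
      have h3 : F * h₀ x = a * V x * v x := by
        simp only [hh₀, hW]
        rw [hχeq x hx.1 hx.2, mul_one, ← mul_assoc, ← mul_assoc, mul_div_cancel₀ a hF0.ne']
      have h4 : a * V x * v x ^ 2 ≤ F * (h₀ x * w x) := by
        calc a * V x * v x ^ 2 = (a * V x * v x) * v x := by ring
          _ ≤ (a * V x * v x) * w x := mul_le_mul_of_nonneg_left (hvw x)
              (mul_nonneg (mul_nonneg ha.le (hV0 x)) (hv0 x))
          _ = _ := by rw [← h3]; ring
      have h5 := mul_le_mul_of_nonneg_left h2 (mul_nonneg ha.le (hV0 x))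
      rw [← mul_assoc]
      refine h5.trans ?_
      have h6 : a * V x * (2 * v x ^ 2 + 8 * κ ^ 2 * w x ^ 2) =
        2 * (a * V x * v x ^ 2) + 8 * κ ^ 2 * a * (V x * w x ^ 2) := by ring
      rw [h6]
      linarith
    have hI : IntegrableOn (fun x => 2 * F * (h₀ x * w x) + 8 * κ ^ 2 * a * (V x * w x ^ 2)) A :=
      (hhi.integrableOn.const_mul _).add (hAi.const_mul _)
    calc ∫⁻ x in A, ENNReal.ofReal (a * (V x * ((1 + κ) * w x - g x) ^ 2))
        ≤ ∫⁻ x in A, ENNReal.ofReal (2 * F * (h₀ x * w x) + 8 * κ ^ 2 * a * (V x * w x ^ 2)) :=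
          setLIntegral_mono' hAc.measurableSet fun x hx => ENNReal.ofReal_le_ofReal (hpt x hx)
      _ = ENNReal.ofReal (∫ x in A, (2 * F * (h₀ x * w x) + 8 * κ ^ 2 * a * (V x * w x ^ 2))) := by
          refine (ofReal_integral_eq_lintegral_ofReal hI (Eventually.of_forall fun x => ?_)).symm
          have h1 := mul_nonneg (hh₀0 x) (h.pos x).le
          have h2 := mul_nonneg (hV0 x) (sq_nonneg (w x))
          change 0 ≤ _
          positivity
      _ ≤ _ := by
          refine ENNReal.ofReal_le_ofReal ?_
          rw [integral_add (hhi.integrableOn.const_mul _) (hAi.const_mul _), integral_const_mul,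
            integral_const_mul]
          have h1 : ∫ x in A, h₀ x * w x ≤ ∫ x, h₀ x * w x :=
            setIntegral_le_integral hhi (Eventually.of_forall fun x => mul_nonneg (hh₀0 x) (h.pos x).le)
          have h2 := mul_le_mul_of_nonneg_left (h1.trans hhw) (by positivity : 0 ≤ 2 * F)
          have h3 : 0 ≤ F * K * D := by positivity
          have h4 : (4 * F * K + 1) * D = 2 * F * (K * D) + 2 * (F * K * D) + D := by ring
          rw [h4]
          linarith

/-! ### Smooth concave minima -/

theorem hasDerivAt_posPart_pow (n : ℕ) (t : ℝ) :
    HasDerivAt (fun t : ℝ => max t 0 ^ (n + 2)) ((n + 2 : ℕ) * max t 0 ^ (n + 1)) t := by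
  rcases lt_trichotomy t 0 with ht | rfl | ht
  · rw [max_eq_right ht.le, zero_pow (by omega), mul_zero]
    refine (hasDerivAt_const t (0 : ℝ)).congr_of_eventuallyEq ?_
    filter_upwards [Iio_mem_nhds ht] with y hy
    rw [max_eq_right (le_of_lt hy), zero_pow (by omega)]
  · rw [max_self, zero_pow (by omega), mul_zero]
    have h1 : (fun t : ℝ => max t 0 ^ (n + 2)) =O[𝓝 0] fun t => ‖t - 0‖ ^ (n + 2) := by
      refine Asymptotics.IsBigO.of_bound 1 (Eventually.of_forall fun y => ?_)
      rw [sub_zero, norm_pow, norm_pow, one_mul, norm_norm]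
      refine pow_le_pow_left₀ (norm_nonneg _) ?_ _
      rw [Real.norm_of_nonneg (le_max_right _ _)]
      exact max_le (le_abs_self y) (abs_nonneg y)
    exact (h1.hasFDerivAt (by omega)).hasDerivAt
  · rw [max_eq_left ht.le]
    refine (hasDerivAt_pow (n + 2) t).congr_of_eventuallyEq ?_
    filter_upwards [Ioi_mem_nhds ht] with y hy
    rw [max_eq_left (le_of_lt hy)]

theorem contDiff_posPart_cube : ContDiff ℝ 2 fun t : ℝ => max t 0 ^ 3 := by
  have d1 : deriv (fun t : ℝ => max t 0 ^ 3) = fun t => ((1 + 2 : ℕ) : ℝ) * max t 0 ^ 2 :=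
    funext fun t => (hasDerivAt_posPart_pow 1 t).deriv
  have d2 : deriv (fun t : ℝ => max t 0 ^ 2) = fun t => ((0 + 2 : ℕ) : ℝ) * max t 0 ^ 1 :=
    funext fun t => (hasDerivAt_posPart_pow 0 t).deriv
  have c2 : ContDiff ℝ 1 fun t : ℝ => max t 0 ^ 2 := by
    rw [contDiff_one_iff_deriv]
    refine ⟨fun t => (hasDerivAt_posPart_pow 0 t).differentiableAt, ?_⟩
    rw [d2]
    fun_prop
  have : ContDiff ℝ (1 + 1) fun t : ℝ => max t 0 ^ 3 := by
    rw [contDiff_succ_iff_deriv]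
    refine ⟨fun t => (hasDerivAt_posPart_pow 1 t).differentiableAt, by simp, ?_⟩
    rw [d1]
    exact contDiff_const.mul c2
  exact this

/-- A homogeneous concave function of `p > 0` and `q ≥ 0` of class `C²`, equal to `p` for `p ≤ 2 q`
and at most `6 q`. -/
def capMin (p q : ℝ) : ℝ := p - max (p - 2 * q) 0 ^ 3 / p ^ 2

theorem capMin_eq {p q : ℝ} (hp : 0 < p) : capMin p q = p * (1 - (max (p - 2 * q) 0 / p) ^ 3) := by
  rw [capMin, div_pow]
  field_simp

theorem capMin_le_left {p q : ℝ} (hp : 0 < p) : capMin p q ≤ p := by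
  have : 0 ≤ max (p - 2 * q) 0 ^ 3 / p ^ 2 := by positivity
  rw [capMin]
  linarith

theorem capMin_le_right {p q : ℝ} (hp : 0 < p) (hq : 0 ≤ q) : capMin p q ≤ 6 * q := by
  rw [capMin_eq hp]
  set z := max (p - 2 * q) 0 / p with hz
  have hz0 : 0 ≤ z := by positivity
  have hz1 : z ≤ 1 := by
    rw [hz, div_le_one hp]
    exact max_le (by linarith) hp.le
  have h1 : p * (1 - z) ≤ 2 * q := by
    have : p - 2 * q ≤ p * z := by
      rw [hz, mul_div_cancel₀ _ hp.ne']; exact le_max_left _ _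
    linarith
  have h2 : 1 - z ^ 3 ≤ 3 * (1 - z) := by
    nlinarith [mul_nonneg (sq_nonneg (1 - z)) (by linarith : 0 ≤ 2 + z)]
  have := mul_le_mul_of_nonneg_left h2 hp.le
  linarith

theorem capMin_pos {p q : ℝ} (hp : 0 < p) (hq : 0 < q) : 0 < capMin p q := by
  rw [capMin_eq hp]
  refine mul_pos hp (sub_pos.2 ?_)
  refine pow_lt_one₀ (by positivity) ?_ (by norm_num)
  rw [div_lt_one hp]
  exact max_lt (by linarith) hp

theorem capMin_of_le {p q : ℝ} (h : p ≤ 2 * q) : capMin p q = p := by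
  rw [capMin, max_eq_right (by linarith)]
  norm_num

/-- The supporting linear functions of the concave function `capMin`. -/
theorem exists_tangent_capMin {p₀ q₀ : ℝ} (hp₀ : 0 < p₀) (hq₀ : 0 ≤ q₀) :
    ∃ A B : ℝ, 0 ≤ A ∧ A ≤ 1 ∧ 0 ≤ B ∧ B ≤ 6 ∧ capMin p₀ q₀ = A * p₀ + B * q₀ ∧
      ∀ p q : ℝ, 0 < p → 0 ≤ q → capMin p q ≤ A * p + B * q := by
  rcases le_or_gt p₀ (2 * q₀) with h | h
  · refine ⟨1, 0, by norm_num, le_rfl, le_rfl, by norm_num, ?_, fun p q hp _ => ?_⟩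
    · rw [capMin_of_le h]; ring
    · have := capMin_le_left (q := q) hp
      linarith
  · set y := (p₀ - 2 * q₀) / p₀ with hy
    have hy0 : 0 ≤ y := div_nonneg (by linarith) hp₀.le
    have hy1 : y ≤ 1 := by rw [hy, div_le_one hp₀]; linarith
    have hq : q₀ = p₀ * ((1 - y) / 2) := by rw [hy]; field_simp; ring
    refine ⟨(1 - y) ^ 2 * (1 + 2 * y), 6 * y ^ 2, by positivity, ?_, by positivity, ?_, ?_,
      fun p q hp hq0 => ?_⟩
    · nlinarith [mul_nonneg hy0 hy0, mul_nonneg (mul_nonneg hy0 hy0) (by linarith : 0 ≤ 3 - 2 * y)]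
    · nlinarith
    · rw [capMin_eq hp₀, max_eq_left (by linarith), ← hy]
      conv_rhs => rw [hq]
      ring
    · rw [capMin_eq hp]
      set z := max (p - 2 * q) 0 / p with hz
      have hz0 : 0 ≤ z := by positivity
      have h1 : p * ((1 - z) / 2) ≤ q := by
        have : p - 2 * q ≤ p * z := by
          rw [hz, mul_div_cancel₀ _ hp.ne']; exact le_max_left _ _
        linarith
      have h2 := mul_le_mul_of_nonneg_left h1 (by positivity : 0 ≤ 6 * y ^ 2)
      have h3 : 0 ≤ p * ((z - y) ^ 2 * (z + 2 * y)) := by positivity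
      nlinarith

/-- The supporting linear functions of the harmonic mean. -/
theorem exists_tangent_harmonic {p₀ q₀ : ℝ} (hp₀ : 0 < p₀) (hq₀ : 0 < q₀) :
    ∃ A B : ℝ, 0 ≤ A ∧ A ≤ 2 ∧ 0 ≤ B ∧ B ≤ 2 ∧
      2 * p₀ * q₀ / (p₀ + q₀) = A * p₀ + B * q₀ ∧
      ∀ p q : ℝ, 0 < p → 0 < q → 2 * p * q / (p + q) ≤ A * p + B * q := by
  have h0 : 0 < p₀ + q₀ := by positivity
  refine ⟨2 * (q₀ / (p₀ + q₀)) ^ 2, 2 * (p₀ / (p₀ + q₀)) ^ 2, by positivity, ?_, by positivity, ?_, ?_,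
    fun p q hp hq => ?_⟩
  · have : q₀ / (p₀ + q₀) ≤ 1 := by rw [div_le_one h0]; linarith
    have := pow_le_one₀ (by positivity) this (n := 2)
    linarith
  · have : p₀ / (p₀ + q₀) ≤ 1 := by rw [div_le_one h0]; linarith
    have := pow_le_one₀ (by positivity) this (n := 2)
    linarith
  · field_simp
    ring
  · have h1 : 2 * (q₀ / (p₀ + q₀)) ^ 2 * p + 2 * (p₀ / (p₀ + q₀)) ^ 2 * q =
        (2 * q₀ ^ 2 * p + 2 * p₀ ^ 2 * q) / (p₀ + q₀) ^ 2 := by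
      field_simp
    rw [h1, div_le_div_iff₀ (by positivity) (by positivity)]
    nlinarith [sq_nonneg (q₀ * p - p₀ * q)]

/-- Gluing along a locally finite disjoint family: `U` coincides with `capMin w (v k)` where
`2 v k < w`. At each point at most one of the terms subtracted from `w` is nonzero. -/
theorem exists_glue_of_disjoint {w : 𝔼 → ℝ} {v : ℕ → 𝔼 → ℝ} (hw : ContDiff ℝ 2 w)
    (hw0 : ∀ x, 0 < w x) (hv : ∀ k, ContDiff ℝ 2 (v k)) (hv0 : ∀ k x, 0 < v k x)
    (hlf : LocallyFinite fun k => {x | 2 * v k x < w x})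
    (hdisj : ∀ j k x, 2 * v j x < w x → 2 * v k x < w x → j = k) :
    ∃ U : 𝔼 → ℝ, ContDiff ℝ 2 U ∧ (∀ x, 0 < U x) ∧ (∀ x, U x ≤ w x) ∧ (∀ k x, U x ≤ 6 * v k x) ∧
      (∀ x, (∀ k, w x ≤ 2 * v k x) → U x = w x) ∧
      ∀ x, ∃ k, ∃ A B : ℝ, 0 ≤ A ∧ A ≤ 1 ∧ 0 ≤ B ∧ B ≤ 6 ∧ U x = A * w x + B * v k x ∧
        ∀ y, U y ≤ A * w y + B * v k y := by
  set e : ℕ → 𝔼 → ℝ := fun k x => max (w x - 2 * v k x) 0 ^ 3 / w x ^ 2 with he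
  have hcap : ∀ k x, w x - e k x = capMin (w x) (v k x) := fun k x => rfl
  have he0 : ∀ k x, 0 ≤ e k x := fun k x => by simp only [he]; positivity
  have hne : ∀ k x, e k x ≠ 0 → 2 * v k x < w x := fun k x hx => by
    by_contra! hc
    refine hx ?_
    simp only [he]
    rw [max_eq_right (by linarith)]
    norm_num
  have hsum : ∀ k x, e k x ≠ 0 → ∑ᶠ j, e j x = e k x := fun k x hx =>
    finsum_eq_single _ k fun j hj => by
      by_contra hc
      exact hj (hdisj j k x (hne j x hc) (hne k x hx))
  have hsum0 : ∀ x, (∀ k, e k x = 0) → ∑ᶠ j, e j x = 0 := fun x hx => by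
    simp [hx]
  have hle : ∀ k x, e k x ≤ ∑ᶠ j, e j x := fun k x => by
    by_cases hx : e k x = 0
    · rw [hx]; exact finsum_nonneg fun j => he0 j x
    · exact (hsum k x hx).ge
  have hec : ∀ k, ContDiff ℝ 2 (e k) := fun k =>
    (contDiff_posPart_cube.comp (hw.sub (contDiff_const.mul (hv k)))).div (hw.pow 2)
      fun x => (pow_pos (hw0 x) 2).ne'
  have hsc : ContDiff ℝ 2 fun x => ∑ᶠ j, e j x := by
    rw [← contMDiff_iff_contDiff]
    refine contMDiff_finsum (fun j => contMDiff_iff_contDiff.2 (hec j)) (hlf.subset fun j x hx => ?_)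
    exact hne j x hx
  have hUcap : ∀ k x, w x - ∑ᶠ j, e j x ≤ capMin (w x) (v k x) := fun k x => by
    have := hle k x
    rw [← hcap]
    linarith
  refine ⟨fun x => w x - ∑ᶠ j, e j x, hw.sub hsc, fun x => ?_, fun x => ?_, fun k x => ?_,
    fun x hx => ?_, fun x => ?_⟩
  · by_cases h : ∀ k, e k x = 0
    · beta_reduce
      rw [hsum0 x h, sub_zero]; exact hw0 x
    · push Not at h
      obtain ⟨k, hk⟩ := h
      beta_reduce
      rw [hsum k x hk, hcap]
      exact capMin_pos (hw0 x) (hv0 k x)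
  · exact (hUcap 0 x).trans (capMin_le_left (hw0 x))
  · exact (hUcap k x).trans (capMin_le_right (hw0 x) (hv0 k x).le)
  · beta_reduce
    rw [hsum0 x fun k => ?_, sub_zero]
    by_contra hc
    exact not_lt_of_ge (hx k) (hne k x hc)
  · by_cases h : ∀ k, e k x = 0
    · refine ⟨0, 1, 0, by norm_num, le_rfl, le_rfl, by norm_num, ?_, fun y => ?_⟩
      · beta_reduce
        rw [hsum0 x h]; ring
      · have := (hUcap 0 y).trans (capMin_le_left (hw0 y))
        linarith
    · push Not at h
      obtain ⟨k, hk⟩ := h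
      obtain ⟨A, B, hA0, hA1, hB0, hB6, heq, hle⟩ := exists_tangent_capMin (hw0 x) (hv0 k x).le
      refine ⟨k, A, B, hA0, hA1, hB0, hB6, ?_, fun y => ?_⟩
      · beta_reduce
        rw [hsum k x hk, hcap, heq]
      · exact (hUcap k y).trans (hle _ _ (hw0 y) (hv0 k y).le)

/-- Gluing along a family whose members of even index, and those of odd index, are disjoint: the
harmonic mean of the two functions glued separately. -/
theorem exists_glue {w : 𝔼 → ℝ} {v : ℕ → 𝔼 → ℝ} (hw : ContDiff ℝ 2 w)
    (hw0 : ∀ x, 0 < w x) (hv : ∀ k, ContDiff ℝ 2 (v k)) (hv0 : ∀ k x, 0 < v k x)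
    (hlf : LocallyFinite fun k => {x | 2 * v k x < w x})
    (hdisj : ∀ j k x, j + 2 ≤ k → 2 * v j x < w x → w x ≤ 2 * v k x) :
    ∃ U : 𝔼 → ℝ, ContDiff ℝ 2 U ∧ (∀ x, 0 < U x) ∧ (∀ x, U x ≤ w x) ∧ (∀ k x, U x ≤ 12 * v k x) ∧
      (∀ x, (∀ k, w x ≤ 2 * v k x) → U x = w x) ∧
      ∀ x, ∃ j k, ∃ A B₁ B₂ : ℝ, 0 ≤ A ∧ A ≤ 4 ∧ 0 ≤ B₁ ∧ B₁ ≤ 12 ∧ 0 ≤ B₂ ∧ B₂ ≤ 12 ∧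
        U x = A * w x + B₁ * v j x + B₂ * v k x ∧
        ∀ y, U y ≤ A * w y + B₁ * v j y + B₂ * v k y := by
  have hd : ∀ i, ∀ j k x, 2 * v (2 * j + i) x < w x → 2 * v (2 * k + i) x < w x → j = k :=
    fun i j k x h1 h2 => by
      rcases lt_trichotomy j k with h | h | h
      · exact absurd h2 (not_lt_of_ge (hdisj _ _ x (by omega) h1))
      · exact h
      · exact absurd h1 (not_lt_of_ge (hdisj _ _ x (by omega) h2))
  have hl : ∀ i, LocallyFinite fun k => {x | 2 * v (2 * k + i) x < w x} := fun i =>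
    hlf.comp_injective (g := fun k => 2 * k + i) fun a b hab => by
      have : 2 * a + i = 2 * b + i := hab
      omega
  obtain ⟨P, hPc, hP0, hPw, hPv, hPeq, hPt⟩ :=
    exists_glue_of_disjoint hw hw0 (fun k => hv (2 * k + 0)) (fun k => hv0 (2 * k + 0)) (hl 0) (hd 0)
  obtain ⟨Q, hQc, hQ0, hQw, hQv, hQeq, hQt⟩ :=
    exists_glue_of_disjoint hw hw0 (fun k => hv (2 * k + 1)) (fun k => hv0 (2 * k + 1)) (hl 1) (hd 1)
  have hPQ : ∀ x, 0 < P x + Q x := fun x => add_pos (hP0 x) (hQ0 x)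
  have hUP : ∀ x, 2 * P x * Q x / (P x + Q x) ≤ 2 * P x := fun x => by
    rw [div_le_iff₀ (hPQ x)]
    nlinarith [mul_pos (hP0 x) (hP0 x)]
  have hUQ : ∀ x, 2 * P x * Q x / (P x + Q x) ≤ 2 * Q x := fun x => by
    rw [div_le_iff₀ (hPQ x)]
    nlinarith [mul_pos (hQ0 x) (hQ0 x)]
  refine ⟨fun x => 2 * P x * Q x / (P x + Q x), ((contDiff_const.mul hPc).mul hQc).div (hPc.add hQc)
    fun x => (hPQ x).ne', fun x => div_pos (mul_pos (mul_pos two_pos (hP0 x)) (hQ0 x)) (hPQ x),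
    fun x => ?_, fun k x => ?_, fun x hx => ?_, fun x => ?_⟩
  · rw [div_le_iff₀ (hPQ x)]
    have h1 := mul_le_mul_of_nonneg_left (hQw x) (hP0 x).le
    have h2 := mul_le_mul_of_nonneg_left (hPw x) (hQ0 x).le
    linarith
  · rcases Nat.even_or_odd' k with ⟨m, rfl | rfl⟩
    · have := hPv m x
      have := hUP x
      simp only [add_zero] at *
      linarith
    · have := hQv m x
      have := hUQ x
      linarith
  · beta_reduce
    rw [hPeq x fun k => hx _, hQeq x fun k => hx _]
    have := hw0 x
    field_simp
    norm_num
  · obtain ⟨j, A₁, B₁, a1, a2, a3, a4, a5, a6⟩ := hPt x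
    obtain ⟨k, A₂, B₂, b1, b2, b3, b4, b5, b6⟩ := hQt x
    obtain ⟨S, T, s1, s2, s3, s4, s5, s6⟩ := exists_tangent_harmonic (hP0 x) (hQ0 x)
    refine ⟨2 * j + 0, 2 * k + 1, S * A₁ + T * A₂, S * B₁, T * B₂, by positivity, by nlinarith,
      by positivity, by nlinarith, by positivity, by nlinarith, ?_, fun y => ?_⟩
    · beta_reduce
      rw [s5]
      conv_lhs => rw [a5, b5]
      ring
    · refine (s6 _ _ (hP0 y) (hQ0 y)).trans ?_
      have h1 := mul_le_mul_of_nonneg_left (a6 y) s1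
      have h2 := mul_le_mul_of_nonneg_left (b6 y) s3
      linarith

/-! ### A smooth supersolution of finite energy for an arbitrary potential -/

/-- An increment that is bounded above by the increment of a supporting combination is controlled by
the increments of the components. The constant `9000` is not optimal: the coefficients are at most
`4 + 2 * 12 * 2 = 52`, `12` and `12`. -/
theorem increment_le_of_tangent {A B₁ B₂ κ₁ κ₂ a b c a' b' c' D : ℝ} (hA : 0 ≤ A) (hA' : A ≤ 4)
    (hB₁ : 0 ≤ B₁) (hB₁' : B₁ ≤ 12) (hB₂ : 0 ≤ B₂) (hB₂' : B₂ ≤ 12) (hκ₁ : 0 ≤ κ₁) (hκ₁' : κ₁ ≤ 1)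
    (hκ₂ : 0 ≤ κ₂) (hκ₂' : κ₂ ≤ 1)
    (h : D ≤ A * a' + B₁ * ((1 + κ₁) * a' - b') + B₂ * ((1 + κ₂) * a' - c') -
      (A * a + B₁ * ((1 + κ₁) * a - b) + B₂ * ((1 + κ₂) * a - c))) (hD : 0 ≤ D) :
    D ^ 2 ≤ 9000 * ((a - a') ^ 2 + (b - b') ^ 2 + (c - c') ^ 2) := by
  have e : A * a' + B₁ * ((1 + κ₁) * a' - b') + B₂ * ((1 + κ₂) * a' - c') -
      (A * a + B₁ * ((1 + κ₁) * a - b) + B₂ * ((1 + κ₂) * a - c)) =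
      (A + B₁ * (1 + κ₁) + B₂ * (1 + κ₂)) * (a' - a) + B₁ * (b - b') + B₂ * (c - c') := by ring
  rw [e] at h
  have h1 : (A + B₁ * (1 + κ₁) + B₂ * (1 + κ₂)) * (a' - a) ≤ 52 * |a - a'| := by
    rw [abs_sub_comm]
    refine (mul_le_mul_of_nonneg_left (le_abs_self _) (by positivity)).trans
      (mul_le_mul_of_nonneg_right ?_ (abs_nonneg _))
    nlinarith
  have h2 : B₁ * (b - b') ≤ 12 * |b - b'| :=
    (mul_le_mul_of_nonneg_left (le_abs_self _) hB₁).trans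
      (mul_le_mul_of_nonneg_right hB₁' (abs_nonneg _))
  have h3 : B₂ * (c - c') ≤ 12 * |c - c'| :=
    (mul_le_mul_of_nonneg_left (le_abs_self _) hB₂).trans
      (mul_le_mul_of_nonneg_right hB₂' (abs_nonneg _))
  have h4 : D ≤ 52 * |a - a'| + 12 * |b - b'| + 12 * |c - c'| := by linarith
  have h5 := pow_le_pow_left₀ hD h4 2
  rw [← sq_abs (a - a'), ← sq_abs (b - b'), ← sq_abs (c - c')]
  set p := |a - a'|
  set q := |b - b'|
  set r := |c - c'|
  nlinarith [sq_nonneg (52 * p - 12 * q), sq_nonneg (52 * p - 12 * r), sq_nonneg (q - r),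
    sq_nonneg p, sq_nonneg q, sq_nonneg r]

/-- The energy of a function with supporting combinations of `w` and of the `(1 + κ k) w - g k` is
controlled by the energies of `w` and of the `g k`. -/
theorem gagliardo_lt_top_of_tangents {U w : 𝔼 → ℝ} {g : ℕ → 𝔼 → ℝ} {κ : ℕ → ℝ} (hκ0 : ∀ k, 0 ≤ κ k)
    (hκ1 : ∀ k, κ k ≤ 1) (hw : Measurable w) (hg : ∀ k, Measurable (g k))
    (ht : ∀ x, ∃ j k, ∃ A B₁ B₂ : ℝ, 0 ≤ A ∧ A ≤ 4 ∧ 0 ≤ B₁ ∧ B₁ ≤ 12 ∧ 0 ≤ B₂ ∧ B₂ ≤ 12 ∧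
        U x = A * w x + B₁ * ((1 + κ j) * w x - g j x) + B₂ * ((1 + κ k) * w x - g k x) ∧
        ∀ y, U y ≤ A * w y + B₁ * ((1 + κ j) * w y - g j y) + B₂ * ((1 + κ k) * w y - g k y))
    (hwf : gagliardo s w < ∞) (hgf : ∑' k, gagliardo s (g k) < ∞) : gagliardo s U < ∞ := by
  have key : ∀ x y, U x ≤ U y → ∃ j k, (U y - U x) ^ 2 ≤
      9000 * ((w x - w y) ^ 2 + (g j x - g j y) ^ 2 + (g k x - g k y) ^ 2) := fun x y hxy => by
    obtain ⟨j, k, A, B₁, B₂, a1, a2, b1, b2, c1, c2, heq, hle⟩ := ht x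
    refine ⟨j, k, increment_le_of_tangent a1 a2 b1 b2 c1 c2 (hκ0 j) (hκ1 j) (hκ0 k) (hκ1 k) ?_
      (sub_nonneg.2 hxy)⟩
    have := hle y
    linarith
  have key' : ∀ x y, ∃ j k, (U x - U y) ^ 2 ≤
      9000 * ((w x - w y) ^ 2 + (g j x - g j y) ^ 2 + (g k x - g k y) ^ 2) := fun x y => by
    rcases le_total (U x) (U y) with h | h
    · obtain ⟨j, k, hjk⟩ := key x y h
      exact ⟨j, k, by rw [← neg_sub, neg_sq]; exact hjk⟩
    · obtain ⟨j, k, hjk⟩ := key y x h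
      refine ⟨j, k, hjk.trans (le_of_eq ?_)⟩
      ring
  set I : (𝔼 → ℝ) → 𝔼 × 𝔼 → ℝ≥0∞ := fun u z =>
    ENNReal.ofReal ((u z.1 - u z.2) ^ 2 / ‖z.1 - z.2‖ ^ ((N : ℝ) + 2 * s)) with hI
  have hpt : ∀ z : 𝔼 × 𝔼, I U z ≤
      ENNReal.ofReal 9000 * (I w z + (∑' k, I (g k) z + ∑' k, I (g k) z)) := fun z => by
    obtain ⟨j, k, hjk⟩ := key' z.1 z.2
    have hD : 0 ≤ ‖z.1 - z.2‖ ^ ((N : ℝ) + 2 * s) := by positivity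
    calc I U z ≤ ENNReal.ofReal (9000 * ((w z.1 - w z.2) ^ 2 / ‖z.1 - z.2‖ ^ ((N : ℝ) + 2 * s) +
          ((g j z.1 - g j z.2) ^ 2 / ‖z.1 - z.2‖ ^ ((N : ℝ) + 2 * s) +
          (g k z.1 - g k z.2) ^ 2 / ‖z.1 - z.2‖ ^ ((N : ℝ) + 2 * s)))) := by
          refine ENNReal.ofReal_le_ofReal ((div_le_div_of_nonneg_right hjk hD).trans (le_of_eq ?_))
          ring
      _ = ENNReal.ofReal 9000 * (I w z + (I (g j) z + I (g k) z)) := by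
          rw [ENNReal.ofReal_mul (by norm_num), ENNReal.ofReal_add (by positivity) (by positivity),
            ENNReal.ofReal_add (by positivity) (by positivity)]
      _ ≤ _ := by
          gcongr
          · exact ENNReal.le_tsum (f := fun k => I (g k) z) j
          · exact ENNReal.le_tsum (f := fun k => I (g k) z) k
  have hmI : ∀ k, Measurable (I (g k)) := fun k => measurable_gagliardo_integrand (hg k)
  have hts : ∫⁻ z, ∑' k, I (g k) z = ∑' k, gagliardo s (g k) :=
    lintegral_tsum fun k => (hmI k).aemeasurable
  calc gagliardo s U ≤ ∫⁻ z, ENNReal.ofReal 9000 * (I w z + (∑' k, I (g k) z + ∑' k, I (g k) z)) :=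
        lintegral_mono hpt
    _ = ENNReal.ofReal 9000 * (gagliardo s w + (∑' k, gagliardo s (g k) + ∑' k, gagliardo s (g k))) := by
        rw [lintegral_const_mul' _ _ ENNReal.ofReal_ne_top,
          lintegral_add_left (measurable_gagliardo_integrand hw),
          lintegral_add_left (Measurable.tsum hmI), hts]
        rfl
    _ < ∞ := ENNReal.mul_lt_top ENNReal.ofReal_lt_top
        (ENNReal.add_lt_top.2 ⟨hwf, ENNReal.add_lt_top.2 ⟨hgf, hgf⟩⟩)

namespace IsPowerPotential

variable {α c C : ℝ} {f w : EuclideanSpace ℝ (Fin N) → ℝ}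

theorem gagliardo_lt_top (hs : s ∈ Ioo (0 : ℝ) 1) (h : IsPowerPotential s α c C f w)
    (hN : 2 * s < N) (hα : (N - 2 * s) / 2 < α) : gagliardo s w < ∞ := by
  have hα0 : 0 < α := by linarith
  refine (gagliardo_le_of_isPotential hs hN h.isPotential h.contDiff (h.tendsto hα0)).trans_lt ?_
  refine ENNReal.mul_lt_top ENNReal.ofReal_lt_top ?_
  have hi : Integrable fun x : 𝔼 => C ^ 2 * (1 + ‖x‖) ^ (-(2 * α + 2 * s)) :=
    (integrable_one_add_norm (by rw [finrank_euclideanSpace, Fintype.card_fin]; linarith)).const_mul _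
  refine (lintegral_mono fun x => ENNReal.ofReal_le_ofReal ?_).trans_lt hi.lintegral_lt_top
  have hX : 0 < 1 + ‖x‖ := by positivity
  calc f x * w x ≤ (C * (1 + ‖x‖) ^ (-(α + 2 * s))) * (C * (1 + ‖x‖) ^ (-α)) :=
        mul_le_mul (h.density_upper x) (h.upper x) (h.pos x).le
          (mul_nonneg h.C_pos.le (by positivity))
    _ = C ^ 2 * (1 + ‖x‖) ^ (-(2 * α + 2 * s)) := by
        rw [show -(2 * α + 2 * s) = -(α + 2 * s) + -α by ring, Real.rpow_add hX]
        ring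

theorem density_ratio (h : IsPowerPotential s α c C f w) (x : 𝔼) :
    c / C * (1 + ‖x‖) ^ (-(2 * s)) * w x ≤ f x := by
  have hX : 0 < 1 + ‖x‖ := by positivity
  have hc := h.c_pos
  have hC := h.C_pos
  calc c / C * (1 + ‖x‖) ^ (-(2 * s)) * w x
      ≤ c / C * (1 + ‖x‖) ^ (-(2 * s)) * (C * (1 + ‖x‖) ^ (-α)) :=
        mul_le_mul_of_nonneg_left (h.upper x) (by positivity)
    _ = c * (1 + ‖x‖) ^ (-(α + 2 * s)) := by
        rw [show -(α + 2 * s) = -(2 * s) + -α by ring, Real.rpow_add hX]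
        field_simp
    _ ≤ f x := h.density_lower x

/-- A function with supporting combinations of supersolutions is a supersolution. -/
theorem supersolution_of_tangents (hs : s ∈ Ioo (0 : ℝ) 1) (hN : 2 * s < N)
    (h : IsPowerPotential s α c C f w) {V U : 𝔼 → ℝ} {a : ℝ} (ha : 0 < a) (hV0 : ∀ x, 0 ≤ V x)
    {g η : ℕ → 𝔼 → ℝ} {κ : ℕ → ℝ} (hκ0 : ∀ k, 0 ≤ κ k) (hκ1 : ∀ k, κ k ≤ 1)
    (hg : ∀ k, IsPotential s (η k) (g k)) (hgC : ∀ k, ContDiff ℝ 2 (g k))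
    (hη : ∀ k x, fracConst N s * η k x ≤ a * V x * ((1 + κ k) * w x - g k x))
    (hU : ContDiff ℝ 2 U) (hU0 : ∀ x, 0 < U x) (hUw : ∀ x, U x ≤ w x) {x : 𝔼}
    (ht : ∃ j k, ∃ A B₁ B₂ : ℝ, 0 ≤ A ∧ A ≤ 4 ∧ 0 ≤ B₁ ∧ B₁ ≤ 12 ∧ 0 ≤ B₂ ∧ B₂ ≤ 12 ∧
        U x = A * w x + B₁ * ((1 + κ j) * w x - g j x) + B₂ * ((1 + κ k) * w x - g k x) ∧
        ∀ y, U y ≤ A * w y + B₁ * ((1 + κ j) * w y - g j y) + B₂ * ((1 + κ k) * w y - g k y)) :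
    ∃ ℓ, HasFracLaplacian s U x ℓ ∧
      fracConst N s * c / (2 * C) * (1 + ‖x‖) ^ (-(2 * s)) * U x ≤ ℓ + a * V x * U x := by
  obtain ⟨M, hM⟩ := h.isPotential.bounded
  have hUM : ∀ y, |U y| ≤ M := fun y => by
    rw [abs_of_pos (hU0 y)]; exact (hUw y).trans (hM y)
  have hL := hasFracLaplacian_of_contDiff hs (pos_dim hs.1 hN) hU hUM x
  refine ⟨_, hL, ?_⟩
  obtain ⟨j, k, A, B₁, B₂, a1, -, b1, -, c1, -, heq, hle⟩ := ht
  set F := fracConst N s with hF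
  have hF0 : 0 < F := fracConst_pos hs hN
  have hLw := h.isPotential.hasFracLaplacian hs hN h.contDiff x
  have hLv : ∀ k, HasFracLaplacian s (fun y => (1 + κ k) * w y - g k y) x
      ((1 + κ k) * (F * f x) - F * η k x) := fun k =>
    (hLw.const_mul _).sub ((hg k).hasFracLaplacian hs hN (hgC k) x)
  have hLZ := ((hLw.const_mul A).add ((hLv j).const_mul B₁)).add ((hLv k).const_mul B₂)
  have hcomp := hL.le_of_touching hLZ hle heq
  refine le_trans ?_ (add_le_add_left hcomp _)
  have hf0 : 0 ≤ F * f x := mul_nonneg hF0.le (h.isPotential.density_nonneg x)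
  have hw0 := h.pos x
  have hvη : ∀ k, F * f x - a * V x * ((1 + κ k) * w x - g k x) ≤ (1 + κ k) * (F * f x) - F * η k x :=
    fun k => by
      have h1 := hη k x
      have h2 := mul_nonneg (hκ0 k) hf0
      rw [add_mul, one_mul]
      linarith
  have hv2 : ∀ k, (1 + κ k) * w x - g k x ≤ 2 * w x := fun k => by
    have h1 := mul_le_mul_of_nonneg_right (hκ1 k) hw0.le
    have h2 := (hg k).nonneg x
    rw [add_mul]
    linarith
  have hU2 : U x ≤ 2 * (A + B₁ + B₂) * w x := by
    rw [heq]
    have h1 := mul_le_mul_of_nonneg_left (hv2 j) b1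
    have h2 := mul_le_mul_of_nonneg_left (hv2 k) c1
    have h3 := mul_nonneg a1 hw0.le
    linarith
  have hC := h.C_pos
  have hc := h.c_pos
  have h4 : F * c / (2 * C) * (1 + ‖x‖) ^ (-(2 * s)) * U x ≤ (A + B₁ + B₂) * (F * f x) := by
    calc F * c / (2 * C) * (1 + ‖x‖) ^ (-(2 * s)) * U x
        ≤ F * c / (2 * C) * (1 + ‖x‖) ^ (-(2 * s)) * (2 * (A + B₁ + B₂) * w x) :=
          mul_le_mul_of_nonneg_left hU2 (by positivity)
      _ = (A + B₁ + B₂) * (F * (c / C * (1 + ‖x‖) ^ (-(2 * s)) * w x)) := by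
          field_simp
      _ ≤ _ := mul_le_mul_of_nonneg_left (mul_le_mul_of_nonneg_left (h.density_ratio x) hF0.le)
          (by positivity)
  have h5 := mul_le_mul_of_nonneg_left (hvη j) b1
  have h6 := mul_le_mul_of_nonneg_left (hvη k) c1
  have h7 : 0 ≤ a * V x * (A * w x) :=
    mul_nonneg (mul_nonneg ha.le (hV0 x)) (mul_nonneg a1 hw0.le)
  have h8 : a * V x * U x = a * V x * (A * w x) + B₁ * (a * V x * ((1 + κ j) * w x - g j x)) +
      B₂ * (a * V x * ((1 + κ k) * w x - g k x)) := by rw [heq]; ring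
  rw [h8]
  rw [mul_sub] at h5 h6
  refine h4.trans ?_
  rw [add_mul, add_mul]
  linarith

end IsPowerPotential

/-- A ratio for which the annuli of indices `k` and `k + 2` do not interact. -/
theorem exists_ratio {κ₁ κ₂ θ : ℝ} (hκ₁ : 0 < κ₁) (hκ₂ : 0 < κ₂) (hθ : θ < 1) :
    ∃ B : ℝ, 2 ≤ B ∧ 1 + κ₂ * B ≤ κ₁ * (B ^ 2 * B ^ (-θ)) := by
  set Q := (1 + κ₂) / κ₁ with hQ
  have hQ0 : 0 < Q := by positivity
  have hd : 0 < 1 - θ := by linarith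
  set B := max 2 (Q ^ (1 / (1 - θ))) with hB
  have hB2 : 2 ≤ B := le_max_left _ _
  have hB0 : 0 < B := by linarith
  refine ⟨B, hB2, ?_⟩
  have h1 : Q ≤ B ^ (1 - θ) := by
    calc Q = (Q ^ (1 / (1 - θ))) ^ (1 - θ) := by
          rw [← Real.rpow_mul hQ0.le, one_div, inv_mul_cancel₀ hd.ne', Real.rpow_one]
      _ ≤ _ := Real.rpow_le_rpow (by positivity) (le_max_right _ _) hd.le
  have h2 : 1 + κ₂ ≤ κ₁ * B ^ (1 - θ) := by
    rw [hQ, div_le_iff₀ hκ₁] at h1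
    linarith
  have h3 : B ^ 2 * B ^ (-θ) = B * B ^ (1 - θ) := by
    rw [sub_eq_add_neg, Real.rpow_add hB0, Real.rpow_one]
    ring
  rw [h3]
  have h4 := mul_le_mul_of_nonneg_left h2 hB0.le
  linarith

theorem weightedSq_lt_top_of_annuli {V U w : 𝔼 → ℝ} {v : ℕ → 𝔼 → ℝ} {a B ρ₀ : ℝ} (ha : 0 < a)
    (hB : 1 < B) (hρ₀ : 0 < ρ₀) (hVc : Continuous V) (hV0 : ∀ x, 0 ≤ V x) (hw : Continuous w)
    (hU0 : ∀ x, 0 < U x) (hUw : ∀ x, U x ≤ w x) (hUv : ∀ k x, U x ≤ 12 * v k x)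
    (hsum : ∑' k : ℕ, ∫⁻ x in {x | ρ₀ * B ^ k ≤ ‖x‖ ∧ ‖x‖ ≤ B * (ρ₀ * B ^ k)},
      ENNReal.ofReal (a * (V x * v k x ^ 2)) < ∞) : weightedSq V U < ∞ := by
  set A : ℕ → Set 𝔼 := fun k => {x | ρ₀ * B ^ k ≤ ‖x‖ ∧ ‖x‖ ≤ B * (ρ₀ * B ^ k)} with hA
  have hAm : ∀ k, MeasurableSet (A k) := fun k =>
    ((isClosed_le continuous_const continuous_norm).inter
      (isClosed_le continuous_norm continuous_const)).measurableSet
  have hcover : (univ : Set 𝔼) ⊆ Metric.closedBall 0 ρ₀ ∪ ⋃ k, A k := by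
    intro x _
    rcases le_total ‖x‖ ρ₀ with hx | hx
    · exact Or.inl (mem_closedBall_zero_iff.2 hx)
    · have h1 : 1 ≤ ‖x‖ / ρ₀ := by rwa [one_le_div hρ₀]
      obtain ⟨n, hn1, hn2⟩ := exists_nat_pow_near h1 hB
      rw [le_div_iff₀ hρ₀] at hn1
      rw [div_lt_iff₀ hρ₀, pow_succ] at hn2
      refine Or.inr (mem_iUnion.2 ⟨n, ?_, ?_⟩)
      · linarith
      · linarith
  have h1 : ∫⁻ x in Metric.closedBall (0 : 𝔼) ρ₀, ENNReal.ofReal (V x * U x ^ 2) < ∞ := by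
    have hi : IntegrableOn (fun x => V x * w x ^ 2) (Metric.closedBall (0 : 𝔼) ρ₀) :=
      (hVc.mul (hw.pow 2)).continuousOn.integrableOn_compact (isCompact_closedBall _ _)
    refine (lintegral_mono fun x => ENNReal.ofReal_le_ofReal ?_).trans_lt hi.lintegral_lt_top
    exact mul_le_mul_of_nonneg_left (pow_le_pow_left₀ (hU0 x).le (hUw x) 2) (hV0 x)
  have h2 : ∀ k, ∫⁻ x in A k, ENNReal.ofReal (V x * U x ^ 2) ≤
      ENNReal.ofReal (144 / a) * ∫⁻ x in A k, ENNReal.ofReal (a * (V x * v k x ^ 2)) := fun k => by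
    rw [← lintegral_const_mul' _ _ ENNReal.ofReal_ne_top]
    refine lintegral_mono fun x => ?_
    rw [← ENNReal.ofReal_mul (by positivity)]
    refine ENNReal.ofReal_le_ofReal ?_
    have e : 144 / a * (a * (V x * v k x ^ 2)) = V x * (12 * v k x) ^ 2 := by
      field_simp
      ring
    rw [e]
    exact mul_le_mul_of_nonneg_left (pow_le_pow_left₀ (hU0 x).le (hUv k x) 2) (hV0 x)
  calc weightedSq V U = ∫⁻ x in univ, ENNReal.ofReal (V x * U x ^ 2) := by
        rw [setLIntegral_univ]; rfl
    _ ≤ (∫⁻ x in Metric.closedBall (0 : 𝔼) ρ₀, ENNReal.ofReal (V x * U x ^ 2)) +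
        ∑' k, ∫⁻ x in A k, ENNReal.ofReal (V x * U x ^ 2) :=
        (lintegral_mono_set hcover).trans ((lintegral_union_le _ _ _).trans
          (add_le_add le_rfl (lintegral_iUnion_le _ _)))
    _ ≤ (∫⁻ x in Metric.closedBall (0 : 𝔼) ρ₀, ENNReal.ofReal (V x * U x ^ 2)) +
        ENNReal.ofReal (144 / a) * ∑' k, ∫⁻ x in A k, ENNReal.ofReal (a * (V x * v k x ^ 2)) := by
        rw [← ENNReal.tsum_mul_left]
        exact add_le_add le_rfl (ENNReal.tsum_le_tsum h2)
    _ < ∞ := ENNReal.add_lt_top.2 ⟨h1, ENNReal.mul_lt_top ENNReal.ofReal_lt_top hsum⟩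

/-- For every continuous potential `V ≥ 0` that is positive far away, there is a function of class
`C²`, of finite energy and dominated by `w`, that satisfies a supersolution estimate with constants
that do not depend on `V`. It is glued from the functions attached to the annuli of radii `ρ₀ B^k`; the
energies are summable because `α > (N - 2s) / 2`. -/
theorem IsPowerPotential.exists_supersolution (hs : s ∈ Ioo (0 : ℝ) 1) {α c C : ℝ}
    {f w : 𝔼 → ℝ} (h : IsPowerPotential s α c C f w) (hN : 2 * s < N) (hα : (N - 2 * s) / 2 < α)
    (hαN : α < N - 2 * s) {V : 𝔼 → ℝ} (hVc : Continuous V) (hV0 : ∀ x, 0 ≤ V x) {a R ρ₁ : ℝ}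
    (ha : 0 < a) (hVpos : ∀ x, ρ₁ ≤ ‖x‖ → 0 < V x) :
    ∃ U : 𝔼 → ℝ, ContDiff ℝ 2 U ∧ (∀ x, 0 < U x) ∧ (∀ x, U x ≤ w x) ∧
      (∀ x, ‖x‖ ≤ R → U x = w x) ∧ gagliardo s U < ∞ ∧ weightedSq V U < ∞ ∧
      ∀ x, ∃ ℓ, HasFracLaplacian s U x ℓ ∧
        fracConst N s * c / (2 * C) * (1 + ‖x‖) ^ (-(2 * s)) * U x ≤ ℓ + a * V x * U x := by
  have hα0 : 0 < α := by linarith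
  obtain ⟨κ₁, κ₂, K, hκ₁, hκ₂, hK, hblock⟩ := h.exists_annulus_supersolution hs hα0 hαN
  have hκ₂0 : 0 < κ₂ := by linarith
  set θ := (N - 2 * s - α) / α with hθ
  have hθ1 : θ < 1 := by rw [hθ, div_lt_one hα0]; linarith
  obtain ⟨B, hB2, hBr⟩ := exists_ratio hκ₁ hκ₂0 hθ1
  have hB0 : 0 < B := by linarith
  have hB1 : 1 ≤ B := by linarith
  have hBθ : 0 < B ^ (-θ) := Real.rpow_pos_of_pos hB0 _
  set ρ₀ := max 1 (max (2 * ρ₁) ((1 + R) / (κ₁ * B ^ (-θ)))) with hρ₀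
  have hρ₀1 : 1 ≤ ρ₀ := le_max_left _ _
  have hρ₀0 : 0 < ρ₀ := by linarith
  have hρ₀ρ : 2 * ρ₁ ≤ ρ₀ := (le_max_left _ _).trans (le_max_right _ _)
  have hρ₀R : 1 + R ≤ κ₁ * (ρ₀ * B ^ (-θ)) := by
    have h1 : (1 + R) / (κ₁ * B ^ (-θ)) ≤ ρ₀ := (le_max_right _ _).trans (le_max_right _ _)
    rw [div_le_iff₀ (by positivity)] at h1
    linarith
  have hpow1 : ∀ k : ℕ, 1 ≤ B ^ k := fun k => one_le_pow₀ hB1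
  set ρ : ℕ → ℝ := fun k => ρ₀ * B ^ k with hρ
  have hρge : ∀ k, ρ₀ ≤ ρ k := fun k => le_mul_of_one_le_right hρ₀0.le (hpow1 k)
  have hρ1 : ∀ k, 1 ≤ ρ k := fun k => hρ₀1.trans (hρge k)
  choose κ η g hκ0 hκ1 hgp hgC hv0 hη hgag hann hloc using fun k => hblock V a B (ρ k) hVc hV0 ha hB1
    (hρ1 k) fun x hx => hVpos x (by have := hρge k; linarith)
  have hw0 := h.pos
  set v : ℕ → 𝔼 → ℝ := fun k x => (1 + κ k) * w x - g k x with hv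
  -- where a block is active
  have hact : ∀ k x, 2 * v k x < w x →
      κ₁ * (ρ k * B ^ (-θ)) < 1 + ‖x‖ ∧ ‖x‖ < κ₂ * (B * ρ k) := fun k x hx => by
    by_contra hc
    have h1 : 1 + ‖x‖ ≤ κ₁ * (ρ k * B ^ (-θ)) ∨ κ₂ * (B * ρ k) ≤ ‖x‖ := by
      by_cases h2 : κ₁ * (ρ k * B ^ (-θ)) < 1 + ‖x‖
      · exact Or.inr (not_lt.1 fun h3 => hc ⟨h2, h3⟩)
      · exact Or.inl (not_lt.1 h2)
    have h4 := hloc k x h1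
    have h5 : 0 ≤ κ k * w x := mul_nonneg (hκ0 k) (hw0 x).le
    simp only [hv] at hx
    rw [add_mul] at hx
    linarith
  have hlf : LocallyFinite fun k => {x | 2 * v k x < w x} := fun x => by
    refine ⟨Metric.ball x 1, Metric.ball_mem_nhds x one_pos, ?_⟩
    have ht : Tendsto (fun k : ℕ => κ₁ * (ρ k * B ^ (-θ))) atTop atTop :=
      (((tendsto_pow_atTop_atTop_of_one_lt (by linarith : 1 < B)).const_mul_atTop
        hρ₀0).atTop_mul_const hBθ).const_mul_atTop hκ₁
    obtain ⟨k₀, hk₀⟩ := (ht.eventually_ge_atTop (2 + ‖x‖)).exists_forall_of_atTop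
    refine (finite_lt_nat k₀).subset fun k hk => ?_
    obtain ⟨y, hy, hyx⟩ := hk
    by_contra hc
    have h1 := hk₀ k (not_lt.1 hc)
    have h2 := (hact k y hy).1
    have h3 : ‖y - x‖ < 1 := by rwa [Metric.mem_ball, dist_eq_norm] at hyx
    have h4 := norm_sub_norm_le y x
    linarith
  have hdisj : ∀ j k x, j + 2 ≤ k → 2 * v j x < w x → w x ≤ 2 * v k x := fun j k x hjk hj => by
    by_contra! hk
    have h1 := (hact j x hj).2
    have h2 := (hact k x hk).1
    have h3 : ρ j * B ^ 2 ≤ ρ k := by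
      simp only [hρ]
      rw [mul_assoc, ← pow_add]
      exact mul_le_mul_of_nonneg_left (pow_le_pow_right₀ hB1 hjk) hρ₀0.le
    have h4 : κ₁ * (ρ j * B ^ 2 * B ^ (-θ)) ≤ κ₁ * (ρ k * B ^ (-θ)) :=
      mul_le_mul_of_nonneg_left (mul_le_mul_of_nonneg_right h3 hBθ.le) hκ₁.le
    have h5 := mul_le_mul_of_nonneg_left hBr (zero_le_one.trans (hρ1 j))
    have h6 := hρ1 j
    linarith
  have hvC : ∀ k, ContDiff ℝ 2 (v k) := fun k => (contDiff_const.mul h.contDiff).sub (hgC k)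
  obtain ⟨U, hUC, hU0, hUw, hUv, hUeq, hUt⟩ := exists_glue h.contDiff hw0 hvC hv0 hlf hdisj
  -- the energies of the blocks form a convergent geometric series
  have hgeo : ∑' k, ENNReal.ofReal (K * (B ^ (N - 2 * s - α) * ρ k ^ (N - 2 * s - 2 * α))) < ∞ := by
    have e : ∀ k, K * (B ^ (N - 2 * s - α) * ρ k ^ (N - 2 * s - 2 * α)) =
        (K * B ^ (N - 2 * s - α) * ρ₀ ^ (N - 2 * s - 2 * α)) * (B ^ (N - 2 * s - 2 * α)) ^ k :=
      fun k => by
        simp only [hρ]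
        rw [Real.mul_rpow hρ₀0.le (by positivity), ← Real.rpow_natCast B k, ← Real.rpow_mul hB0.le,
          mul_comm (k : ℝ), Real.rpow_mul hB0.le, Real.rpow_natCast]
        ring
    simp_rw [e]
    have hr : B ^ (N - 2 * s - 2 * α) < 1 :=
      Real.rpow_lt_one_of_one_lt_of_neg (by linarith) (by linarith)
    exact ((summable_geometric_of_lt_one (by positivity) hr).mul_left _).tsum_ofReal_lt_top
  have hgsum : ∑' k, gagliardo s (g k) < ∞ := (ENNReal.tsum_le_tsum hgag).trans_lt hgeo
  refine ⟨U, hUC, hU0, hUw, fun x hx => hUeq x fun k => ?_, ?_, ?_, fun x => ?_⟩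
  · by_contra! hc
    have h1 := (hact k x hc).1
    have h2 : κ₁ * (ρ₀ * B ^ (-θ)) ≤ κ₁ * (ρ k * B ^ (-θ)) :=
      mul_le_mul_of_nonneg_left (mul_le_mul_of_nonneg_right (hρge k) hBθ.le) hκ₁.le
    linarith
  · exact gagliardo_lt_top_of_tangents hκ0 hκ1 h.isPotential.continuous.measurable
      (fun k => (hgp k).continuous.measurable) hUt (h.gagliardo_lt_top hs hN hα) hgsum
  · exact weightedSq_lt_top_of_annuli ha (by linarith) hρ₀0 hVc hV0 h.isPotential.continuous hU0 hUw
      hUv ((ENNReal.tsum_le_tsum hann).trans_lt hgeo)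
  · exact h.supersolution_of_tangents hs hN ha hV0 hκ0 hκ1 hgp hgC hη hUC hU0 hUw (hUt x)

/-! ### Local estimates in the weighted fractional Sobolev space -/

theorem exists_le_of_liminf_pos {V : 𝔼 → ℝ}
    (hVinf : 0 < liminf (fun x : 𝔼 => ENNReal.ofReal (V x * ‖x‖ ^ (2 * s)))
      (Bornology.cobounded 𝔼)) :
    ∃ c > 0, ∃ ρ₁ : ℝ, 1 ≤ ρ₁ ∧ ∀ x : 𝔼, ρ₁ ≤ ‖x‖ → c * ‖x‖ ^ (-(2 * s)) ≤ V x := by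
  obtain ⟨b, hb0, hb⟩ := exists_between hVinf
  have h1 := eventually_lt_of_lt_liminf hb
  rw [Filter.Eventually, ← Bornology.isCobounded_def] at h1
  obtain ⟨R, hR⟩ := (Bornology.isBounded_compl_iff.2 h1).subset_closedBall 0
  have hbt : b ≠ ∞ := (hb.trans_le le_top).ne
  refine ⟨b.toReal, ENNReal.toReal_pos hb0.ne' hbt, max 1 (R + 1), le_max_left _ _, fun x hx => ?_⟩
  have hx1 : 1 ≤ ‖x‖ := (le_max_left _ _).trans hx
  have hx2 : R + 1 ≤ ‖x‖ := (le_max_right _ _).trans hx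
  have hx0 : 0 < ‖x‖ := by linarith
  have h2 : b < ENNReal.ofReal (V x * ‖x‖ ^ (2 * s)) := by
    by_contra hc
    have : x ∈ Metric.closedBall (0 : 𝔼) R := hR hc
    rw [mem_closedBall_zero_iff] at this
    linarith
  have h3 : b.toReal < V x * ‖x‖ ^ (2 * s) := (ENNReal.lt_ofReal_iff_toReal_lt hbt).1 h2
  rw [Real.rpow_neg hx0.le, ← div_eq_mul_inv, div_le_iff₀ (by positivity)]
  exact h3.le

theorem gagliardo_congr {u v : 𝔼 → ℝ} (h : u =ᵐ[volume] v) : gagliardo s u = gagliardo s v := by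
  rw [gagliardo, gagliardo, Measure.volume_eq_prod]
  have h1 : (fun z : 𝔼 × 𝔼 => u z.1) =ᵐ[(volume : Measure 𝔼).prod volume] fun z => v z.1 :=
    Measure.quasiMeasurePreserving_fst.ae_eq_comp h
  have h2 : (fun z : 𝔼 × 𝔼 => u z.2) =ᵐ[(volume : Measure 𝔼).prod volume] fun z => v z.2 :=
    Measure.quasiMeasurePreserving_snd.ae_eq_comp h
  refine lintegral_congr_ae ?_
  filter_upwards [h1, h2] with z hz1 hz2
  rw [hz1, hz2]

theorem weightedSq_congr {w u v : 𝔼 → ℝ} (h : u =ᵐ[volume] v) : weightedSq w u = weightedSq w v := by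
  refine lintegral_congr_ae ?_
  filter_upwards [h] with z hz
  rw [hz]

theorem gagliardo_eq_lintegral {u : 𝔼 → ℝ} (hu : Measurable u) :
    gagliardo s u =
      ∫⁻ x, ∫⁻ y, ENNReal.ofReal ((u x - u y) ^ 2 / ‖x - y‖ ^ ((N : ℝ) + 2 * s)) := by
  rw [gagliardo, Measure.volume_eq_prod,
    lintegral_prod _ (measurable_gagliardo_integrand hu).aemeasurable]

theorem sq_sub_le_mul_kernel (hs : 0 < s) (u : 𝔼 → ℝ) {x y : 𝔼} {d : ℝ} (h : ‖x - y‖ ≤ d) :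
    (u x - u y) ^ 2 ≤ d ^ ((N : ℝ) + 2 * s) * ((u x - u y) ^ 2 / ‖x - y‖ ^ ((N : ℝ) + 2 * s)) := by
  by_cases hxy : x = y
  · simp [hxy]
  · have h0 : 0 < ‖x - y‖ := norm_pos_iff.2 (sub_ne_zero.2 hxy)
    have h1 : ‖x - y‖ ^ ((N : ℝ) + 2 * s) ≤ d ^ ((N : ℝ) + 2 * s) :=
      Real.rpow_le_rpow h0.le h (by positivity)
    have h2 : 0 < ‖x - y‖ ^ ((N : ℝ) + 2 * s) := Real.rpow_pos_of_pos h0 _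
    rw [← mul_div_assoc, le_div_iff₀ h2, mul_comm]
    exact mul_le_mul_of_nonneg_right h1 (sq_nonneg _)

/-- A Poincaré inequality: the values on a ball are compared with those on an annulus where `V` is
bounded below, by integrating `u(x)² ≤ 2 (u(x) - u(y))² + 2 u(y)²`. -/
theorem exists_poincare (hs : 0 < s) (hN : 0 < N) {V : 𝔼 → ℝ} (hVc : Continuous V) {ρ₁ : ℝ}
    (hVpos : ∀ x, ρ₁ ≤ ‖x‖ → 0 < V x) (ρ : ℝ) :
    ∃ K : ℝ, 0 ≤ K ∧ ∀ u : 𝔼 → ℝ, Measurable u →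
      ∫⁻ x in Metric.ball 0 ρ, ENNReal.ofReal (u x ^ 2) ≤
        ENNReal.ofReal K * (gagliardo s u + weightedSq V u) := by
  have := nontrivial_euclidean hN
  set R := max ρ (max ρ₁ 1) with hR
  have hRρ : ρ ≤ R := le_max_left _ _
  have hRρ₁ : ρ₁ ≤ R := (le_max_left _ _).trans (le_max_right _ _)
  have hR1 : 1 ≤ R := (le_max_right _ _).trans (le_max_right _ _)
  set A : Set 𝔼 := {x | R < ‖x‖ ∧ ‖x‖ < 2 * R} with hA
  have hAo : IsOpen A := (isOpen_lt continuous_const continuous_norm).inter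
    (isOpen_lt continuous_norm continuous_const)
  have hAb : A ⊆ Metric.closedBall 0 (2 * R) := fun x hx => by
    rw [mem_closedBall_zero_iff]; exact hx.2.le
  have hAt : volume A ≠ ∞ := ((measure_mono hAb).trans_lt measure_closedBall_lt_top).ne
  have hA0 : volume A ≠ 0 := by
    obtain ⟨x, hx⟩ := exists_norm_eq 𝔼 (by linarith : 0 ≤ 3 / 2 * R)
    exact (hAo.measure_pos volume ⟨x, show R < ‖x‖ ∧ ‖x‖ < 2 * R by constructor <;> linarith⟩).ne'
  set m := (volume A).toReal with hm
  have hm0 : 0 < m := ENNReal.toReal_pos hA0 hAt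
  have hmA : ENNReal.ofReal m = volume A := ENNReal.ofReal_toReal hAt
  obtain ⟨c, hc0, hc⟩ : ∃ c, 0 < c ∧ ∀ x ∈ A, c ≤ V x := by
    have hK : IsCompact (Metric.closedBall (0 : 𝔼) (2 * R) ∩ {x | R ≤ ‖x‖}) :=
      (isCompact_closedBall _ _).inter_right (isClosed_le continuous_const continuous_norm)
    obtain ⟨c, hc0, hc⟩ := hK.exists_forall_le' (f := V) (a := 0) hVc.continuousOn
      fun x hx => hVpos x (hRρ₁.trans hx.2)
    exact ⟨c, hc0, fun x hx => hc x ⟨hAb hx, hx.1.le⟩⟩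
  set mB := (volume (Metric.ball (0 : 𝔼) ρ)).toReal with hmB
  have hmB' : ENNReal.ofReal mB = volume (Metric.ball (0 : 𝔼) ρ) :=
    ENNReal.ofReal_toReal measure_ball_lt_top.ne
  set D := 2 * (3 * R) ^ ((N : ℝ) + 2 * s) with hD
  have hD0 : 0 ≤ D := by positivity
  set D' := mB * (2 / c) with hD'
  have hD'0 : 0 ≤ D' := mul_nonneg ENNReal.toReal_nonneg (by positivity)
  refine ⟨m⁻¹ * (D + D'), by positivity, fun u hu => ?_⟩
  set X := ∫⁻ x in Metric.ball 0 ρ, ENNReal.ofReal (u x ^ 2) with hX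
  set I : 𝔼 → 𝔼 → ℝ≥0∞ := fun x y =>
    ENNReal.ofReal ((u x - u y) ^ 2 / ‖x - y‖ ^ ((N : ℝ) + 2 * s)) with hI
  have hu2 : Measurable fun y => ENNReal.ofReal (u y ^ 2) := (hu.pow_const 2).ennreal_ofReal
  have hL : ENNReal.ofReal m * X =
      ∫⁻ x in Metric.ball 0 ρ, ∫⁻ _y in A, ENNReal.ofReal (u x ^ 2) := by
    simp_rw [setLIntegral_const]
    rw [lintegral_mul_const' _ _ hAt, hmA, mul_comm]
  have hpt : ∀ x ∈ Metric.ball (0 : 𝔼) ρ, ∫⁻ _y in A, ENNReal.ofReal (u x ^ 2) ≤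
      ENNReal.ofReal D * (∫⁻ y, I x y) + ENNReal.ofReal (2 / c) * weightedSq V u := fun x hx => by
    rw [mem_ball_zero_iff] at hx
    calc ∫⁻ _y in A, ENNReal.ofReal (u x ^ 2)
        ≤ ∫⁻ y in A, (ENNReal.ofReal D * I x y +
            ENNReal.ofReal (2 / c) * ENNReal.ofReal (V y * u y ^ 2)) := by
          refine setLIntegral_mono' hAo.measurableSet fun y hy => ?_
          have hxy : ‖x - y‖ ≤ 3 * R := by
            have := norm_sub_le x y
            have := hy.2
            linarith
          have h1 := sq_sub_le_mul_kernel hs u hxy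
          have h2 : u y ^ 2 ≤ c⁻¹ * (V y * u y ^ 2) := by
            rw [← div_eq_inv_mul, le_div_iff₀ hc0, mul_comm]
            exact mul_le_mul_of_nonneg_right (hc y hy) (sq_nonneg _)
          have hVy : 0 ≤ V y := hc0.le.trans (hc y hy)
          rw [← ENNReal.ofReal_mul hD0, ← ENNReal.ofReal_mul (by positivity),
            ← ENNReal.ofReal_add (by positivity) (by positivity)]
          refine ENNReal.ofReal_le_ofReal ?_
          have h3 : u x ^ 2 ≤ 2 * (u x - u y) ^ 2 + 2 * u y ^ 2 := by
            nlinarith [sq_nonneg (u x - 2 * u y)]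
          have h4 : 2 / c * (V y * u y ^ 2) = 2 * (c⁻¹ * (V y * u y ^ 2)) := by
            rw [div_eq_mul_inv]; ring
          rw [h4, hD, mul_assoc]
          linarith
      _ ≤ ∫⁻ y, (ENNReal.ofReal D * I x y +
            ENNReal.ofReal (2 / c) * ENNReal.ofReal (V y * u y ^ 2)) := setLIntegral_le_lintegral _ _
      _ = _ := by
          rw [lintegral_add_right, lintegral_const_mul' _ _ ENNReal.ofReal_ne_top,
            lintegral_const_mul' _ _ ENNReal.ofReal_ne_top]
          · rfl
          · exact ((hVc.measurable.mul (hu.pow_const 2)).ennreal_ofReal).const_mul _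
  have hR : ENNReal.ofReal m * X ≤
      ENNReal.ofReal D * gagliardo s u + ENNReal.ofReal D' * weightedSq V u := by
    rw [hL]
    calc ∫⁻ x in Metric.ball 0 ρ, ∫⁻ _y in A, ENNReal.ofReal (u x ^ 2)
        ≤ ∫⁻ x in Metric.ball 0 ρ,
            (ENNReal.ofReal D * (∫⁻ y, I x y) + ENNReal.ofReal (2 / c) * weightedSq V u) :=
          setLIntegral_mono' Metric.isOpen_ball.measurableSet hpt
      _ = ENNReal.ofReal D * (∫⁻ x in Metric.ball 0 ρ, ∫⁻ y, I x y) +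
            ENNReal.ofReal (2 / c) * weightedSq V u * volume (Metric.ball (0 : 𝔼) ρ) := by
          rw [lintegral_add_right _ measurable_const, lintegral_const_mul' _ _ ENNReal.ofReal_ne_top,
            setLIntegral_const]
      _ ≤ _ := by
          rw [gagliardo_eq_lintegral hu, ← hmB', hD', ENNReal.ofReal_mul ENNReal.toReal_nonneg,
            mul_right_comm, mul_comm (ENNReal.ofReal (2 / c))]
          exact add_le_add (mul_le_mul_right (setLIntegral_le_lintegral _ _) _) le_rfl
  have hX' : X = ENNReal.ofReal m⁻¹ * (ENNReal.ofReal m * X) := by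
    rw [← mul_assoc, ← ENNReal.ofReal_mul (by positivity), inv_mul_cancel₀ hm0.ne',
      ENNReal.ofReal_one, one_mul]
  rw [hX']
  calc ENNReal.ofReal m⁻¹ * (ENNReal.ofReal m * X)
      ≤ ENNReal.ofReal m⁻¹ * (ENNReal.ofReal (D + D') * (gagliardo s u + weightedSq V u)) := by
        refine mul_le_mul_right (hR.trans ?_) _
        rw [mul_add]
        exact add_le_add (mul_le_mul_left (ENNReal.ofReal_le_ofReal (by linarith)) _)
          (mul_le_mul_left (ENNReal.ofReal_le_ofReal (by linarith)) _)
    _ = _ := by rw [← mul_assoc, ← ENNReal.ofReal_mul (by positivity)]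

/-- On a small ball a function is close in the mean to one of its values, with an error controlled
by its energy, and this value can be taken not too large: the inequality holds on average over the
point where the value is taken. -/
theorem exists_value_close (hs : 0 < s) {c : 𝔼} {η L : ℝ} (hη : 0 < η) {Q : Set 𝔼}
    (hQ : MeasurableSet Q) (hQb : Q ⊆ Metric.ball c η) {u : 𝔼 → ℝ} (hu : Measurable u) :
    ∃ y : 𝔼, (∫⁻ x in Q, ENNReal.ofReal ((u x - u y) ^ 2)) +
        ENNReal.ofReal L * ENNReal.ofReal (u y ^ 2) ≤
      (ENNReal.ofReal ((2 * η) ^ ((N : ℝ) + 2 * s)) *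
        (∫⁻ x in Q, ∫⁻ y, ENNReal.ofReal ((u x - u y) ^ 2 / ‖x - y‖ ^ ((N : ℝ) + 2 * s))) +
        ENNReal.ofReal L * ∫⁻ y in Metric.ball c η, ENNReal.ofReal (u y ^ 2)) /
          volume (Metric.ball c η) := by
  have hm1 : Measurable fun z : 𝔼 × 𝔼 => ENNReal.ofReal ((u z.1 - u z.2) ^ 2) :=
    (((hu.comp measurable_fst).sub (hu.comp measurable_snd)).pow_const 2).ennreal_ofReal
  have hu2 : Measurable fun y => ENNReal.ofReal (u y ^ 2) := (hu.pow_const 2).ennreal_ofReal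
  have hF : Measurable fun y => (∫⁻ x in Q, ENNReal.ofReal ((u x - u y) ^ 2)) +
      ENNReal.ofReal L * ENNReal.ofReal (u y ^ 2) :=
    (Measurable.lintegral_prod_left' hm1).add (hu2.const_mul _)
  obtain ⟨y, -, hy⟩ := exists_le_setLAverage (Metric.measure_ball_pos volume c hη).ne'
    measure_ball_lt_top.ne hF.aemeasurable
  refine ⟨y, hy.trans ?_⟩
  rw [setLAverage_eq]
  refine ENNReal.div_le_div_right ?_ _
  rw [lintegral_add_right _ (hu2.const_mul _), lintegral_const_mul _ hu2]
  refine add_le_add ?_ le_rfl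
  rw [lintegral_lintegral_swap (f := fun y x => ENNReal.ofReal ((u x - u y) ^ 2))
    (hm1.comp measurable_swap).aemeasurable, ← lintegral_const_mul' _ _ ENNReal.ofReal_ne_top]
  refine setLIntegral_mono' hQ fun x hx => ?_
  rw [← lintegral_const_mul' _ _ ENNReal.ofReal_ne_top]
  refine (setLIntegral_mono' Metric.isOpen_ball.measurableSet fun y hy => ?_).trans
    (setLIntegral_le_lintegral _ _)
  rw [← ENNReal.ofReal_mul (by positivity)]
  refine ENNReal.ofReal_le_ofReal (sq_sub_le_mul_kernel hs u ?_)
  have h1 := hQb hx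
  rw [Metric.mem_ball] at h1 hy
  rw [← dist_eq_norm]
  have := dist_triangle_right x y c
  linarith

theorem exists_finite_measurable_cover (ρ : ℝ) {η : ℝ} (hη : 0 < η) :
    ∃ (n : ℕ) (c : Fin n → 𝔼) (Q : Fin n → Set 𝔼), (∀ i, c i ∈ Metric.closedBall 0 ρ) ∧
      (∀ i, MeasurableSet (Q i)) ∧ Pairwise (Function.onFun Disjoint Q) ∧
      (∀ i, Q i ⊆ Metric.ball (c i) η) ∧ Metric.ball 0 ρ ⊆ ⋃ i, Q i := by
  obtain ⟨t, hts, htf, htc⟩ := (isCompact_closedBall (0 : 𝔼) ρ).finite_cover_balls hη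
  obtain ⟨n, c, hc, hr⟩ := htf.fin_param
  refine ⟨n, c, disjointed fun i => Metric.ball (c i) η, fun i => hts (hr ▸ mem_range_self i),
    fun i => ?_, disjoint_disjointed _, fun i => disjointed_subset _ i, ?_⟩
  · rw [disjointed_eq_inter_compl]
    exact Metric.isOpen_ball.measurableSet.inter (MeasurableSet.iInter fun j =>
      MeasurableSet.iInter fun _ => Metric.isOpen_ball.measurableSet.compl)
  · rw [iUnion_disjointed]
    intro x hx
    obtain ⟨y, hy, hxy⟩ := mem_iUnion₂.1 (htc (Metric.ball_subset_closedBall hx))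
    rw [← hr] at hy
    obtain ⟨i, rfl⟩ := hy
    exact mem_iUnion.2 ⟨i, hxy⟩

/-- Functions of bounded energy are uniformly close, in the mean on a ball, to step functions of
finitely many parameters. -/
theorem exists_step_approx (hs : 0 < s) (hN : 0 < N) (ρ : ℝ) {K δ : ℝ} (hK : 0 ≤ K) (hδ : 0 < δ) :
    ∃ (n : ℕ) (Q : Fin n → Set 𝔼) (M : ℝ), (∀ i, MeasurableSet (Q i)) ∧
      (∀ i, volume (Q i) ≠ ∞) ∧ Metric.ball 0 ρ ⊆ ⋃ i, Q i ∧
      ∀ u : 𝔼 → ℝ, Measurable u → gagliardo s u ≤ ENNReal.ofReal K →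
        ∫⁻ x in Metric.ball 0 (ρ + 1), ENNReal.ofReal (u x ^ 2) ≤ ENNReal.ofReal K →
        ∃ a : Fin n → ℝ, (∀ i, |a i| ≤ M) ∧
          ∑ i, ∫⁻ x in Q i, ENNReal.ofReal ((u x - a i) ^ 2) ≤ ENNReal.ofReal δ := by
  have := nontrivial_euclidean hN
  set J := (volume (Metric.ball (0 : 𝔼) 1)).toReal with hJ
  have hJ0 : 0 < J := ENNReal.toReal_pos (Metric.measure_ball_pos _ _ one_pos).ne'
    measure_ball_lt_top.ne
  set q := δ * J / (2 * 2 ^ ((N : ℝ) + 2 * s) * (K + 1)) with hq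
  have hq0 : 0 < q := by positivity
  -- on balls of radius `η` the error is of order `η^(2s)` times the energy
  set η := min 1 (q ^ (1 / (2 * s))) with hη
  have hη0 : 0 < η := lt_min one_pos (by positivity)
  have hη1 : η ≤ 1 := min_le_left _ _
  have hηq : η ^ (2 * s) ≤ q := by
    calc η ^ (2 * s) ≤ (q ^ (1 / (2 * s))) ^ (2 * s) :=
          Real.rpow_le_rpow hη0.le (min_le_right _ _) (by positivity)
      _ = q := by
          rw [← Real.rpow_mul hq0.le, one_div, inv_mul_cancel₀ (by positivity), Real.rpow_one]
  set D := (2 * η) ^ ((N : ℝ) + 2 * s) with hD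
  have hD0 : 0 < D := by positivity
  set m := (J * η ^ N)⁻¹ with hm
  have hm0 : 0 < m := by positivity
  have hmD : m * (D * K) ≤ δ / 2 := by
    have e : m * D = 2 ^ ((N : ℝ) + 2 * s) * η ^ (2 * s) / J := by
      rw [hm, hD, Real.mul_rpow (by norm_num) hη0.le, Real.rpow_add hη0, Real.rpow_natCast]
      field_simp
    calc m * (D * K) = 2 ^ ((N : ℝ) + 2 * s) * η ^ (2 * s) / J * K := by rw [← e]; ring
      _ ≤ 2 ^ ((N : ℝ) + 2 * s) * q / J * (K + 1) := by
          refine mul_le_mul ?_ (by linarith) hK (by positivity)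
          exact div_le_div_of_nonneg_right (mul_le_mul_of_nonneg_left hηq (by positivity)) hJ0.le
      _ = δ / 2 := by
          rw [hq]
          field_simp
  obtain ⟨n, c, Q, hc, hQm, hQd, hQb, hQc⟩ := exists_finite_measurable_cover (N := N) ρ hη0
  -- the weight of the term that keeps the values bounded, small after summation over the `n` balls
  set L := δ / (2 * (m * n * K + 1)) with hL
  have hL0 : 0 < L := by positivity
  have hmL : m * (n * (L * K)) ≤ δ / 2 := by
    have : m * (n * (L * K)) = δ / 2 * (m * n * K / (m * n * K + 1)) := by
      rw [hL]; field_simp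
    rw [this]
    refine mul_le_of_le_one_right (by positivity) ?_
    rw [div_le_one (by positivity)]
    linarith
  have hvol : ∀ i, volume (Metric.ball (c i) η) = ENNReal.ofReal (J * η ^ N) := fun i => by
    rw [Measure.addHaar_ball _ _ hη0.le, finrank_euclideanSpace, Fintype.card_fin,
      ← ENNReal.ofReal_toReal (measure_ball_lt_top (x := (0 : 𝔼)) (r := 1)).ne, ← hJ,
      ← ENNReal.ofReal_mul (by positivity), mul_comm]
  set M := Real.sqrt (m * (D * K + L * K) / L) with hM
  refine ⟨n, Q, M, hQm, fun i => ((measure_mono (hQb i)).trans_lt measure_ball_lt_top).ne, hQc,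
    fun u hu hgu hu2 => ?_⟩
  choose y hy using fun i => exists_value_close (s := s) (L := L) hs hη0 (hQm i) (hQb i) hu
  set T : Fin n → ℝ≥0∞ := fun i => ∫⁻ x in Q i, ∫⁻ y,
    ENNReal.ofReal ((u x - u y) ^ 2 / ‖x - y‖ ^ ((N : ℝ) + 2 * s)) with hT
  have hTs : ∑ i, T i ≤ ENNReal.ofReal K := by
    rw [← tsum_fintype (L := .unconditional _), ← lintegral_iUnion hQm hQd]
    refine (setLIntegral_le_lintegral _ _).trans ?_
    rw [← gagliardo_eq_lintegral hu]
    exact hgu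
  have hball : ∀ i, ∫⁻ y in Metric.ball (c i) η, ENNReal.ofReal (u y ^ 2) ≤ ENNReal.ofReal K :=
    fun i => by
      refine (lintegral_mono_set ?_).trans hu2
      intro z hz
      have h1 := hc i
      rw [mem_closedBall_zero_iff] at h1
      rw [Metric.mem_ball, dist_eq_norm] at hz
      rw [mem_ball_zero_iff]
      have := norm_sub_norm_le z (c i)
      linarith
  have hy' : ∀ i, (∫⁻ x in Q i, ENNReal.ofReal ((u x - u (y i)) ^ 2)) +
      ENNReal.ofReal L * ENNReal.ofReal (u (y i) ^ 2) ≤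
      ENNReal.ofReal m * (ENNReal.ofReal D * T i + ENNReal.ofReal (L * K)) := fun i => by
    refine (hy i).trans ?_
    rw [hvol, div_eq_mul_inv, ← ENNReal.ofReal_inv_of_pos (by positivity), ← hm, mul_comm]
    refine mul_le_mul_right (add_le_add le_rfl ?_) _
    rw [ENNReal.ofReal_mul hL0.le]
    exact mul_le_mul_right (hball i) _
  refine ⟨fun i => u (y i), fun i => ?_, ?_⟩
  · have h1 : ENNReal.ofReal L * ENNReal.ofReal (u (y i) ^ 2) ≤
        ENNReal.ofReal (m * (D * K + L * K)) := by
      refine (le_add_self.trans (hy' i)).trans ?_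
      rw [ENNReal.ofReal_mul hm0.le, ENNReal.ofReal_add (by positivity) (by positivity),
        ENNReal.ofReal_mul hD0.le]
      refine mul_le_mul_right (add_le_add (mul_le_mul_right ?_ _) le_rfl) _
      exact (Finset.single_le_sum (f := T) (fun _ _ => zero_le) (Finset.mem_univ i)).trans hTs
    rw [← ENNReal.ofReal_mul hL0.le, ENNReal.ofReal_le_ofReal_iff (by positivity)] at h1
    refine Real.abs_le_sqrt ?_
    rw [le_div_iff₀ hL0, mul_comm]
    exact h1
  · calc ∑ i, ∫⁻ x in Q i, ENNReal.ofReal ((u x - u (y i)) ^ 2)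
        ≤ ∑ i, ENNReal.ofReal m * (ENNReal.ofReal D * T i + ENNReal.ofReal (L * K)) :=
          Finset.sum_le_sum fun i _ => le_self_add.trans (hy' i)
      _ = ENNReal.ofReal m * (ENNReal.ofReal D * ∑ i, T i + n * ENNReal.ofReal (L * K)) := by
          rw [← Finset.mul_sum, Finset.sum_add_distrib, ← Finset.mul_sum, Finset.sum_const,
            Finset.card_univ, Fintype.card_fin, nsmul_eq_mul]
      _ ≤ ENNReal.ofReal m * (ENNReal.ofReal D * ENNReal.ofReal K + n * ENNReal.ofReal (L * K)) :=
          mul_le_mul_right (add_le_add (mul_le_mul_right hTs _) le_rfl) _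
      _ = ENNReal.ofReal (m * (D * K + n * (L * K))) := by
          rw [ENNReal.ofReal_mul hm0.le, ENNReal.ofReal_add (by positivity) (by positivity),
            ENNReal.ofReal_mul hD0.le, ENNReal.ofReal_mul (Nat.cast_nonneg n), ENNReal.ofReal_natCast]
      _ ≤ ENNReal.ofReal δ := by
          refine ENNReal.ofReal_le_ofReal ?_
          rw [mul_add]
          linarith

/-! ### The compact embedding -/

/-- The measure `w(x) dx`. -/
def weightMeasure (w : EuclideanSpace ℝ (Fin N) → ℝ) : Measure (EuclideanSpace ℝ (Fin N)) :=
  volume.withDensity fun x => ENNReal.ofReal (w x)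

theorem weightedSq_eq_eLpNorm {w : 𝔼 → ℝ} (hw : Measurable w) (hw0 : ∀ x, 0 ≤ w x) (g : 𝔼 → ℝ) :
    weightedSq w g = eLpNorm g 2 (weightMeasure w) ^ 2 := by
  have h1 : eLpNorm g 2 (weightMeasure w) ^ 2 = ∫⁻ x, ‖g x‖ₑ ^ 2 ∂weightMeasure w := by
    rw [eLpNorm_eq_lintegral_rpow_enorm_toReal (by norm_num) (by norm_num)]
    simp only [ENNReal.toReal_ofNat, ENNReal.rpow_ofNat]
    rw [← ENNReal.rpow_natCast, ← ENNReal.rpow_mul]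
    norm_num
  rw [h1, weightMeasure, lintegral_withDensity_eq_lintegral_mul_non_measurable _ hw.ennreal_ofReal
    (Eventually.of_forall fun _ => ENNReal.ofReal_lt_top), weightedSq]
  refine lintegral_congr fun x => ?_
  rw [Pi.mul_apply, ENNReal.ofReal_mul (hw0 x), Real.enorm_eq_ofReal_abs,
    ← ENNReal.ofReal_pow (abs_nonneg _), sq_abs]

theorem weightedSq_sub_le_tail {w V u v : 𝔼 → ℝ} {θ : ℝ} (hθ : 0 ≤ θ) (hV : Measurable V)
    (hV0 : ∀ x, 0 ≤ V x) {A : Set 𝔼} (hA : MeasurableSet A) (hw : ∀ x ∈ A, w x ≤ θ * V x)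
    (hu : Measurable u) :
    ∫⁻ x in A, ENNReal.ofReal (w x * (u x - v x) ^ 2) ≤
      ENNReal.ofReal (2 * θ) * (weightedSq V u + weightedSq V v) := by
  have hm : Measurable fun x => ENNReal.ofReal (V x * u x ^ 2) :=
    (hV.mul (hu.pow_const 2)).ennreal_ofReal
  calc ∫⁻ x in A, ENNReal.ofReal (w x * (u x - v x) ^ 2)
      ≤ ∫⁻ x in A, ENNReal.ofReal (2 * θ) *
          (ENNReal.ofReal (V x * u x ^ 2) + ENNReal.ofReal (V x * v x ^ 2)) := by
        refine setLIntegral_mono' hA fun x hx => ?_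
        have h1 := mul_nonneg (hV0 x) (sq_nonneg (u x))
        have h2 := mul_nonneg (hV0 x) (sq_nonneg (v x))
        rw [← ENNReal.ofReal_add h1 h2, ← ENNReal.ofReal_mul (by positivity)]
        refine ENNReal.ofReal_le_ofReal ?_
        calc w x * (u x - v x) ^ 2 ≤ θ * V x * (2 * u x ^ 2 + 2 * v x ^ 2) := by
              refine mul_le_mul (hw x hx) ?_ (sq_nonneg _) (mul_nonneg hθ (hV0 x))
              nlinarith [sq_nonneg (u x + v x)]
          _ = _ := by ring
    _ ≤ ∫⁻ x, ENNReal.ofReal (2 * θ) *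
          (ENNReal.ofReal (V x * u x ^ 2) + ENNReal.ofReal (V x * v x ^ 2)) :=
        setLIntegral_le_lintegral _ _
    _ = _ := by
        rw [lintegral_const_mul' _ _ ENNReal.ofReal_ne_top, lintegral_add_left hm]
        rfl

/-- The image of a bounded set of the weighted Sobolev space in `L²(w(x) dx)` is totally bounded, for
a bounded weight `w` that is negligible with respect to `V` at infinity. -/
theorem totallyBounded_embedded (hs : 0 < s) (hN : 0 < N) {V w : 𝔼 → ℝ} (hVc : Continuous V)
    (hV0 : ∀ x, 0 ≤ V x) {ρ₁ : ℝ} (hVpos : ∀ x, ρ₁ ≤ ‖x‖ → 0 < V x) (hw : Measurable w)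
    (hw0 : ∀ x, 0 ≤ w x) {W : ℝ} (hW : ∀ x, w x ≤ W)
    (htail : ∀ θ > 0, ∃ ρ : ℝ, ∀ x, ρ ≤ ‖x‖ → w x ≤ θ * V x) (K : ℝ) :
    TotallyBounded {f : Lp ℝ 2 (weightMeasure w) | ∃ u : 𝔼 → ℝ, Measurable u ∧
      gagliardo s u ≤ ENNReal.ofReal K ∧ weightedSq V u ≤ ENNReal.ofReal K ∧
      f =ᵐ[weightMeasure w] u} := by
  refine Metric.totallyBounded_of_finite_discretization fun ε hε => ?_
  have hWn : 0 ≤ W := (hw0 0).trans (hW 0)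
  set K₀ := max K 0 with hK₀
  have hK₀0 : 0 ≤ K₀ := le_max_right _ _
  have hKK₀ : ENNReal.ofReal K ≤ ENNReal.ofReal K₀ := ENNReal.ofReal_le_ofReal (le_max_left _ _)
  set θ := ε ^ 2 / (16 * (K₀ + 1)) with hθ
  have hθ0 : 0 < θ := by positivity
  obtain ⟨ρ, hρ⟩ := htail θ hθ0
  obtain ⟨P, hP0, hP⟩ := exists_poincare (s := s) hs hN hVc hVpos (ρ + 1)
  set K₁ := max K₀ (P * (K₀ + K₀)) with hK₁
  have hK₁0 : 0 ≤ K₁ := le_max_of_le_left hK₀0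
  set δ := ε ^ 2 / (24 * (W + 1)) with hδ
  have hδ0 : 0 < δ := by positivity
  obtain ⟨n, Q, M, hQm, hQt, hQc, hstep⟩ := exists_step_approx (s := s) hs hN ρ hK₁0 hδ0
  set S := ∑ i, (volume (Q i)).toReal with hS
  have hS0 : 0 ≤ S := Finset.sum_nonneg fun _ _ => ENNReal.toReal_nonneg
  set h := Real.sqrt (ε ^ 2 / (24 * (W + 1) * (S + 1))) with hh
  have hh0 : 0 < h := Real.sqrt_pos.2 (by positivity)
  have hh2 : h ^ 2 = ε ^ 2 / (24 * (W + 1) * (S + 1)) := Real.sq_sqrt (by positivity)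
  -- the step function attached to an element
  have hex : ∀ f : {f : Lp ℝ 2 (weightMeasure w) | ∃ u : 𝔼 → ℝ, Measurable u ∧
      gagliardo s u ≤ ENNReal.ofReal K ∧ weightedSq V u ≤ ENNReal.ofReal K ∧
      f =ᵐ[weightMeasure w] u}, ∃ (u : 𝔼 → ℝ) (a : Fin n → ℝ), Measurable u ∧
      weightedSq V u ≤ ENNReal.ofReal K₀ ∧ f.1 =ᵐ[weightMeasure w] u ∧ (∀ i, |a i| ≤ M) ∧
      ∑ i, ∫⁻ x in Q i, ENNReal.ofReal ((u x - a i) ^ 2) ≤ ENNReal.ofReal δ := by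
    rintro ⟨f, u, hu, hg, hv, hfu⟩
    have h1 := hg.trans hKK₀
    have h2 := hv.trans hKK₀
    obtain ⟨a, ha, hau⟩ := hstep u hu (h1.trans (ENNReal.ofReal_le_ofReal (le_max_left _ _))) (by
      refine (hP u hu).trans ((mul_le_mul_right (add_le_add h1 h2) _).trans ?_)
      rw [← ENNReal.ofReal_add hK₀0 hK₀0, ← ENNReal.ofReal_mul hP0]
      exact ENNReal.ofReal_le_ofReal (le_max_right _ _))
    exact ⟨u, a, hu, h2, hfu, ha, hau⟩
  choose u a hum huV hfu haM hau using hex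
  have hfl : ∀ f i, ⌊a f i / h⌋ ∈ Finset.Icc ⌊-M / h⌋ ⌊M / h⌋ := fun f i => by
    have h1 := abs_le.1 (haM f i)
    rw [Finset.mem_Icc]
    exact ⟨Int.floor_le_floor (div_le_div_of_nonneg_right h1.1 hh0.le),
      Int.floor_le_floor (div_le_div_of_nonneg_right h1.2 hh0.le)⟩
  refine ⟨Fin n → Finset.Icc ⌊-M / h⌋ ⌊M / h⌋, inferInstance, fun f i => ⟨_, hfl f i⟩,
    fun f g hfg => ?_⟩
  have hah : ∀ i, (a f i - a g i) ^ 2 ≤ h ^ 2 := fun i => by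
    have h1 : ⌊a f i / h⌋ = ⌊a g i / h⌋ := congrArg Subtype.val (congrFun hfg i)
    have h2 := Int.abs_sub_lt_one_of_floor_eq_floor h1
    rw [← sub_div, abs_div, abs_of_pos hh0, div_lt_one hh0] at h2
    rw [← sq_abs]
    exact pow_le_pow_left₀ (abs_nonneg _) h2.le 2
  -- comparison of two elements with the same discretization
  have hA : MeasurableSet (Metric.ball (0 : 𝔼) ρ)ᶜ := Metric.isOpen_ball.measurableSet.compl
  have hfar : ∫⁻ x in (Metric.ball (0 : 𝔼) ρ)ᶜ, ENNReal.ofReal (w x * (u f x - u g x) ^ 2) ≤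
      ENNReal.ofReal (ε ^ 2 / 4) := by
    refine (weightedSq_sub_le_tail hθ0.le hVc.measurable hV0 hA (fun x hx => hρ x (by simpa using hx))
      (hum f)).trans ((mul_le_mul_right (add_le_add (huV f) (huV g)) _).trans ?_)
    rw [← ENNReal.ofReal_add hK₀0 hK₀0, ← ENNReal.ofReal_mul (by positivity)]
    refine ENNReal.ofReal_le_ofReal ?_
    have e : 2 * θ * (K₀ + K₀) = ε ^ 2 / 4 * (K₀ / (K₀ + 1)) := by
      rw [hθ]; field_simp; ring
    rw [e]
    refine mul_le_of_le_one_right (by positivity) ?_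
    rw [div_le_one (by positivity)]
    linarith
  have hnear : ∫⁻ x in Metric.ball (0 : 𝔼) ρ, ENNReal.ofReal (w x * (u f x - u g x) ^ 2) ≤
      ENNReal.ofReal (3 * ε ^ 2 / 8) := by
    have hmf : ∀ i, Measurable fun x => ENNReal.ofReal ((u f x - a f i) ^ 2) := fun i =>
      (((hum f).sub_const _).pow_const 2).ennreal_ofReal
    have hmg : ∀ i, Measurable fun x => ENNReal.ofReal ((u g x - a g i) ^ 2) := fun i =>
      (((hum g).sub_const _).pow_const 2).ennreal_ofReal
    have hpiece : ∀ i, ∫⁻ x in Q i, ENNReal.ofReal (w x * (u f x - u g x) ^ 2) ≤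
        ENNReal.ofReal (3 * W) * ((∫⁻ x in Q i, ENNReal.ofReal ((u f x - a f i) ^ 2)) +
          ((∫⁻ x in Q i, ENNReal.ofReal ((u g x - a g i) ^ 2)) +
            ENNReal.ofReal (h ^ 2) * volume (Q i))) := fun i => by
      calc ∫⁻ x in Q i, ENNReal.ofReal (w x * (u f x - u g x) ^ 2)
          ≤ ∫⁻ x in Q i, ENNReal.ofReal (3 * W) * (ENNReal.ofReal ((u f x - a f i) ^ 2) +
              (ENNReal.ofReal ((u g x - a g i) ^ 2) + ENNReal.ofReal (h ^ 2))) := by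
            refine lintegral_mono fun x => ?_
            rw [← ENNReal.ofReal_add (by positivity) (by positivity),
              ← ENNReal.ofReal_add (by positivity) (by positivity),
              ← ENNReal.ofReal_mul (by positivity)]
            refine ENNReal.ofReal_le_ofReal ?_
            have h3 : (u f x - u g x) ^ 2 ≤
                3 * ((u f x - a f i) ^ 2 + ((u g x - a g i) ^ 2 + (a f i - a g i) ^ 2)) := by
              nlinarith [sq_nonneg ((u f x - a f i) + (u g x - a g i)),
                sq_nonneg ((u f x - a f i) - (a f i - a g i)),
                sq_nonneg ((u g x - a g i) + (a f i - a g i))]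
            calc w x * (u f x - u g x) ^ 2 ≤ W * (3 * ((u f x - a f i) ^ 2 +
                  ((u g x - a g i) ^ 2 + h ^ 2))) := by
                  refine mul_le_mul (hW x) (h3.trans ?_) (sq_nonneg _) hWn
                  have := hah i
                  linarith
              _ = _ := by ring
        _ = _ := by
            rw [lintegral_const_mul' _ _ ENNReal.ofReal_ne_top, lintegral_add_left (hmf i),
              lintegral_add_left (hmg i), setLIntegral_const]
    have hvolS : ∑ i, volume (Q i) = ENNReal.ofReal S := by
      rw [hS, ENNReal.ofReal_sum_of_nonneg fun _ _ => ENNReal.toReal_nonneg]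
      exact Finset.sum_congr rfl fun i _ => (ENNReal.ofReal_toReal (hQt i)).symm
    calc ∫⁻ x in Metric.ball (0 : 𝔼) ρ, ENNReal.ofReal (w x * (u f x - u g x) ^ 2)
        ≤ ∑ i, ∫⁻ x in Q i, ENNReal.ofReal (w x * (u f x - u g x) ^ 2) := by
          refine (lintegral_mono_set hQc).trans ((lintegral_iUnion_le _ _).trans ?_)
          rw [tsum_fintype]
      _ ≤ ∑ i, ENNReal.ofReal (3 * W) * ((∫⁻ x in Q i, ENNReal.ofReal ((u f x - a f i) ^ 2)) +
          ((∫⁻ x in Q i, ENNReal.ofReal ((u g x - a g i) ^ 2)) +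
            ENNReal.ofReal (h ^ 2) * volume (Q i))) := Finset.sum_le_sum fun i _ => hpiece i
      _ ≤ ENNReal.ofReal (3 * W) * (ENNReal.ofReal δ + (ENNReal.ofReal δ +
            ENNReal.ofReal (h ^ 2) * ENNReal.ofReal S)) := by
          rw [← Finset.mul_sum, Finset.sum_add_distrib, Finset.sum_add_distrib, ← Finset.mul_sum,
            hvolS]
          exact mul_le_mul_right (add_le_add (hau f) (add_le_add (hau g) le_rfl)) _
      _ = ENNReal.ofReal (3 * W * (δ + (δ + h ^ 2 * S))) := by
          rw [← ENNReal.ofReal_mul (by positivity), ← ENNReal.ofReal_add (by positivity) (by positivity),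
            ← ENNReal.ofReal_add (by positivity) (by positivity), ← ENNReal.ofReal_mul (by positivity)]
      _ ≤ _ := by
          refine ENNReal.ofReal_le_ofReal ?_
          have e : 3 * W * (δ + (δ + h ^ 2 * S)) =
              W / (W + 1) * (ε ^ 2 / 4 + ε ^ 2 / 8 * (S / (S + 1))) := by
            rw [hh2, hδ]; field_simp; ring
          have h4 : W / (W + 1) ≤ 1 := by rw [div_le_one (by positivity)]; linarith
          have h5 : S / (S + 1) ≤ 1 := by rw [div_le_one (by positivity)]; linarith
          rw [e]
          calc W / (W + 1) * (ε ^ 2 / 4 + ε ^ 2 / 8 * (S / (S + 1)))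
              ≤ 1 * (ε ^ 2 / 4 + ε ^ 2 / 8 * 1) := by
                refine mul_le_mul h4 ?_ (by positivity) zero_le_one
                have := mul_le_mul_of_nonneg_left h5 (by positivity : 0 ≤ ε ^ 2 / 8)
                linarith
            _ = _ := by ring
  have hsq : weightedSq w (fun x => u f x - u g x) < ENNReal.ofReal (ε ^ 2) := by
    calc weightedSq w (fun x => u f x - u g x)
        ≤ ENNReal.ofReal (3 * ε ^ 2 / 8) + ENNReal.ofReal (ε ^ 2 / 4) := by
          rw [weightedSq, ← lintegral_add_compl _ (Metric.isOpen_ball (x := (0 : 𝔼)) (ε := ρ)).measurableSet]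
          exact add_le_add hnear hfar
      _ = ENNReal.ofReal (5 * ε ^ 2 / 8) := by
          rw [← ENNReal.ofReal_add (by positivity) (by positivity)]
          congr 1; ring
      _ < _ := (ENNReal.ofReal_lt_ofReal_iff (by positivity)).2 (by nlinarith [pow_pos hε 2])
  rw [weightedSq_eq_eLpNorm hw hw0, ENNReal.ofReal_pow hε.le] at hsq
  have hlt := lt_of_pow_lt_pow_left' 2 hsq
  rw [← edist_lt_ofReal, Lp.edist_def]
  refine lt_of_eq_of_lt (eLpNorm_congr_ae ?_) hlt
  exact (hfu f).sub (hfu g)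

theorem weightedSq_lt_top_of_tail (hs : 0 < s) (hN : 0 < N) {V w : 𝔼 → ℝ} (hVc : Continuous V)
    {ρ₁ : ℝ} (hVpos : ∀ x, ρ₁ ≤ ‖x‖ → 0 < V x)
    (hw0 : ∀ x, 0 ≤ w x) {W : ℝ} (hW : ∀ x, w x ≤ W)
    (htail : ∀ θ > 0, ∃ ρ : ℝ, ∀ x, ρ ≤ ‖x‖ → w x ≤ θ * V x) {u : 𝔼 → ℝ} (hu : Measurable u)
    (hg : gagliardo s u < ∞) (hv : weightedSq V u < ∞) : weightedSq w u < ∞ := by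
  obtain ⟨ρ, hρ⟩ := htail 1 one_pos
  obtain ⟨P, -, hP⟩ := exists_poincare (s := s) hs hN hVc hVpos ρ
  have hWn : 0 ≤ W := (hw0 0).trans (hW 0)
  rw [weightedSq, ← lintegral_add_compl _ (Metric.isOpen_ball (x := (0 : 𝔼)) (ε := ρ)).measurableSet]
  refine ENNReal.add_lt_top.2 ⟨?_, ?_⟩
  · calc ∫⁻ x in Metric.ball (0 : 𝔼) ρ, ENNReal.ofReal (w x * u x ^ 2)
        ≤ ∫⁻ x in Metric.ball (0 : 𝔼) ρ, ENNReal.ofReal W * ENNReal.ofReal (u x ^ 2) := by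
          refine lintegral_mono fun x => ?_
          rw [← ENNReal.ofReal_mul hWn]
          exact ENNReal.ofReal_le_ofReal (mul_le_mul_of_nonneg_right (hW x) (sq_nonneg _))
      _ = ENNReal.ofReal W * ∫⁻ x in Metric.ball (0 : 𝔼) ρ, ENNReal.ofReal (u x ^ 2) :=
          lintegral_const_mul' _ _ ENNReal.ofReal_ne_top
      _ < ∞ := ENNReal.mul_lt_top ENNReal.ofReal_lt_top ((hP u hu).trans_lt
          (ENNReal.mul_lt_top ENNReal.ofReal_lt_top (ENNReal.add_lt_top.2 ⟨hg, hv⟩)))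
  · refine lt_of_le_of_lt ?_ hv
    refine (setLIntegral_mono' Metric.isOpen_ball.measurableSet.compl fun x hx => ?_).trans
      (setLIntegral_le_lintegral _ _)
    refine ENNReal.ofReal_le_ofReal (mul_le_mul_of_nonneg_right ?_ (sq_nonneg _))
    have := hρ x (by simpa using hx)
    rwa [one_mul] at this

/-- The weighted Sobolev space is compactly embedded in `L²(w(x) dx)`, for a bounded weight `w` that
is negligible with respect to `V` at infinity. -/
theorem compactlyEmbedded_of_tail (hs : 0 < s) (hN : 0 < N) {V w : 𝔼 → ℝ} (hVc : Continuous V)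
    (hV0 : ∀ x, 0 ≤ V x) {ρ₁ : ℝ} (hVpos : ∀ x, ρ₁ ≤ ‖x‖ → 0 < V x) (hw : Measurable w)
    (hw0 : ∀ x, 0 ≤ w x) {W : ℝ} (hW : ∀ x, w x ≤ W)
    (htail : ∀ θ > 0, ∃ ρ : ℝ, ∀ x, ρ ≤ ‖x‖ → w x ≤ θ * V x) {ε : ℝ} (hε : 0 < ε) :
    CompactlyEmbedded ε s V w := by
  have hfin : ∀ u : 𝔼 → ℝ, MemHsV s V u → weightedSq w u < ∞ := fun u hu => by
    have e := hu.1.ae_eq_mk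
    rw [weightedSq_congr e]
    refine weightedSq_lt_top_of_tail hs hN hVc hVpos hw0 hW htail
      hu.1.stronglyMeasurable_mk.measurable ?_ ?_
    · rw [← gagliardo_congr e]; exact hu.2.1
    · rw [← weightedSq_congr e]; exact hu.2.2
  refine ⟨hfin, fun u hu ⟨C, hC⟩ => ?_⟩
  have hεs : 0 < ε ^ (2 * s) := Real.rpow_pos_of_pos hε _
  set K := max (C / ε ^ (2 * s)) C with hK
  set u' : ℕ → 𝔼 → ℝ := fun n => (hu n).1.mk (u n) with hu'
  have he : ∀ n, u n =ᵐ[volume] u' n := fun n => (hu n).1.ae_eq_mk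
  have hu'm : ∀ n, Measurable (u' n) := fun n => (hu n).1.stronglyMeasurable_mk.measurable
  have hgK : ∀ n, gagliardo s (u' n) ≤ ENNReal.ofReal K := fun n => by
    rw [← gagliardo_congr (he n)]
    refine le_trans ?_ (ENNReal.ofReal_le_ofReal (le_max_left _ _))
    have h1 : ENNReal.ofReal (ε ^ (2 * s)) * gagliardo s (u n) ≤ ENNReal.ofReal C :=
      le_self_add.trans (hC n)
    rw [ENNReal.ofReal_div_of_pos hεs, ENNReal.le_div_iff_mul_le
      (Or.inl (ENNReal.ofReal_pos.2 hεs).ne') (Or.inl ENNReal.ofReal_ne_top), mul_comm]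
    exact h1
  have hvK : ∀ n, weightedSq V (u' n) ≤ ENNReal.ofReal K := fun n => by
    rw [← weightedSq_congr (he n)]
    exact (le_add_self.trans (hC n)).trans (ENNReal.ofReal_le_ofReal (le_max_right _ _))
  have hmem : ∀ n, MemLp (u' n) 2 (weightMeasure w) := fun n => by
    refine ⟨(hu'm n).aestronglyMeasurable, ?_⟩
    have h1 := hfin (u n) (hu n)
    rw [weightedSq_congr (he n), weightedSq_eq_eLpNorm hw hw0] at h1
    by_contra hc
    rw [not_lt, top_le_iff] at hc
    rw [hc] at h1
    exact absurd h1 (by simp)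
  have htb := totallyBounded_embedded hs hN hVc hV0 hVpos hw hw0 hW htail K
  have hcomp := htb.closure.isCompact_of_isClosed isClosed_closure
  obtain ⟨g, -, φ, hφ, hlim⟩ := hcomp.tendsto_subseq (x := fun n => (hmem n).toLp (u' n)) fun n =>
    subset_closure ⟨u' n, hu'm n, hgK n, hvK n, (hmem n).coeFn_toLp⟩
  refine ⟨g, (Lp.stronglyMeasurable g).aestronglyMeasurable, ?_, φ, hφ, ?_⟩
  · rw [weightedSq_eq_eLpNorm hw hw0]
    exact ENNReal.pow_lt_top (Lp.memLp g).2
  · have h1 : ∀ n, weightedSq w (fun x => u (φ n) x - g x) =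
        edist ((hmem (φ n)).toLp (u' (φ n))) g ^ 2 := fun n => by
      have h2 : (fun x => u (φ n) x - g x) =ᵐ[volume] fun x => u' (φ n) x - g x := by
        filter_upwards [he (φ n)] with x hx
        rw [hx]
      rw [weightedSq_congr h2, weightedSq_eq_eLpNorm hw hw0, Lp.edist_def]
      congr 1
      exact eLpNorm_congr_ae ((hmem (φ n)).coeFn_toLp.symm.sub (ae_eq_refl _))
    simp_rw [h1]
    have h3 := tendsto_iff_edist_tendsto_0.1 hlim
    have h4 := ENNReal.Tendsto.pow (n := 2) h3
    rw [zero_pow (by norm_num)] at h4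
    exact h4

/-! ### Properties of the penalization potentials -/

theorem penalization_of_mem {Λ : Set 𝔼} {σ t ε : ℝ} {x : 𝔼} (hx : x ∈ Λ) :
    penalization Λ σ t ε x = 0 :=
  indicator_of_notMem (fun h : x ∈ Λᶜ => h hx) _

theorem penalization_of_notMem {Λ : Set 𝔼} {σ t ε : ℝ} {x : 𝔼} (hx : x ∉ Λ) :
    penalization Λ σ t ε x = ε ^ σ / ‖x‖ ^ t :=
  indicator_of_mem (s := Λᶜ) hx _

theorem penalization_nonneg (Λ : Set 𝔼) (σ t : ℝ) {ε : ℝ} (hε : 0 ≤ ε) (x : 𝔼) :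
    0 ≤ penalization Λ σ t ε x :=
  indicator_nonneg (fun _ _ => by positivity) x

theorem measurable_penalization {Λ : Set 𝔼} (hΛ : MeasurableSet Λ) (σ t ε : ℝ) :
    Measurable (penalization Λ σ t ε) :=
  ((measurable_norm.pow_const t).const_div _).indicator hΛ.compl

theorem exists_norm_ge_of_notMem {Λ : Set 𝔼} (hΛ : IsOpen Λ) (h0 : (0 : 𝔼) ∈ Λ) :
    ∃ r > 0, ∀ x ∉ Λ, r ≤ ‖x‖ := by
  obtain ⟨r, hr, h⟩ := Metric.isOpen_iff.1 hΛ 0 h0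
  refine ⟨r, hr, fun x hx => ?_⟩
  by_contra hc
  exact hx (h (mem_ball_zero_iff.2 (not_le.1 hc)))

theorem penalization_le {Λ : Set 𝔼} {σ t ε r : ℝ} (hε : 0 ≤ ε) (ht : 0 ≤ t) (hr : 0 < r)
    (hΛ : ∀ x ∉ Λ, r ≤ ‖x‖) (x : 𝔼) : penalization Λ σ t ε x ≤ ε ^ σ / r ^ t := by
  by_cases hx : x ∈ Λ
  · rw [penalization_of_mem hx]; positivity
  · rw [penalization_of_notMem hx]
    have := hΛ x hx
    gcongr

/-- At infinity the penalization potential is dominated by `V`, with a factor that decays because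
`t > 2s`. -/
theorem penalization_le_mul_potential {Λ : Set 𝔼} {V : 𝔼 → ℝ} {σ t ε c ρ₁ : ℝ} (hε : 0 ≤ ε)
    (hc : 0 < c) (hρ₁ : 1 ≤ ρ₁) (hV : ∀ x : 𝔼, ρ₁ ≤ ‖x‖ → c * ‖x‖ ^ (-(2 * s)) ≤ V x) {x : 𝔼}
    (hx : ρ₁ ≤ ‖x‖) :
    penalization Λ σ t ε x ≤ ε ^ σ / c * ‖x‖ ^ (-(t - 2 * s)) * V x := by
  have hx0 : 0 < ‖x‖ := by linarith
  have h1 := hV x hx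
  have hV0 : 0 ≤ V x := le_trans (by positivity) h1
  by_cases hΛ : x ∈ Λ
  · rw [penalization_of_mem hΛ]; positivity
  · rw [penalization_of_notMem hΛ]
    calc ε ^ σ / ‖x‖ ^ t = ε ^ σ / c * ‖x‖ ^ (-(t - 2 * s)) * (c * ‖x‖ ^ (-(2 * s))) := by
          have e : ‖x‖ ^ (-(t - 2 * s)) * ‖x‖ ^ (-(2 * s)) = (‖x‖ ^ t)⁻¹ := by
            rw [← Real.rpow_add hx0, ← Real.rpow_neg hx0.le]; congr 1; ring
          rw [div_eq_mul_inv, ← e]; field_simp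
      _ ≤ _ := by gcongr

theorem condP1_penalization (hs : 0 < s) (hN : 0 < N) {V : 𝔼 → ℝ} (hVc : Continuous V)
    (hV0 : ∀ x, 0 ≤ V x) {c ρ₁ : ℝ} (hc : 0 < c) (hρ₁ : 1 ≤ ρ₁)
    (hV : ∀ x : 𝔼, ρ₁ ≤ ‖x‖ → c * ‖x‖ ^ (-(2 * s)) ≤ V x) {Λ : Set 𝔼} (hΛ : IsOpen Λ)
    (hΛb : Bornology.IsBounded Λ) (h0 : (0 : 𝔼) ∈ Λ) {σ t ε : ℝ} (ht : 2 * s < t) (hε : 0 < ε) :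
    CondP1 ε s V Λ (penalization Λ σ t ε) := by
  obtain ⟨r, hr, hΛr⟩ := exists_norm_ge_of_notMem hΛ h0
  obtain ⟨ρ₂, hρ₂⟩ := hΛb.subset_ball 0
  have hVpos : ∀ x, ρ₁ ≤ ‖x‖ → 0 < V x := fun x hx =>
    lt_of_lt_of_le (mul_pos hc (Real.rpow_pos_of_pos (by linarith) _)) (hV x hx)
  refine compactlyEmbedded_of_tail hs hN hVc hV0 hVpos
    (w := fun x => penalization Λ σ t ε x + Λ.indicator (fun _ => (1 : ℝ)) x)
    ((measurable_penalization hΛ.measurableSet σ t ε).add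
      (measurable_const.indicator hΛ.measurableSet))
    (fun x => add_nonneg (penalization_nonneg Λ σ t hε.le x)
      (indicator_nonneg (fun _ _ => zero_le_one) x))
    (W := ε ^ σ / r ^ t + 1)
    (fun x => add_le_add (penalization_le hε.le (by linarith) hr hΛr x)
      (indicator_le' (fun _ _ => le_rfl) (fun _ _ => zero_le_one) x)) ?_ hε
  intro θ hθ
  have h1 : Tendsto (fun ρ : ℝ => ε ^ σ / c * ρ ^ (-(t - 2 * s))) atTop (𝓝 0) := by
    simpa using (tendsto_rpow_neg_atTop (sub_pos.2 ht)).const_mul (ε ^ σ / c)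
  obtain ⟨ρ₃, hρ₃⟩ := eventually_atTop.1 (h1.eventually (gt_mem_nhds hθ))
  refine ⟨max ρ₁ (max ρ₂ ρ₃), fun x hx => ?_⟩
  have hx1 : ρ₁ ≤ ‖x‖ := (le_max_left _ _).trans hx
  have hx2 : ρ₂ ≤ ‖x‖ := (le_max_left _ _).trans ((le_max_right _ _).trans hx)
  have hx3 : ρ₃ ≤ ‖x‖ := (le_max_right _ _).trans ((le_max_right _ _).trans hx)
  have hxΛ : x ∉ Λ := fun h => absurd (mem_ball_zero_iff.1 (hρ₂ h)) (not_lt.2 hx2)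
  rw [indicator_of_notMem hxΛ, add_zero]
  refine (penalization_le_mul_potential hε.le hc hρ₁ hV hx1).trans ?_
  exact mul_le_mul_of_nonneg_right (hρ₃ _ hx3).le (hV0 x)

/-- On a bounded set the inequality follows from the Poincaré inequality, and near infinity from the
pointwise bound by `V`; the power `ε^σ` with `σ > 2s` absorbs the constants. -/
theorem eventually_condP2_penalization (hs : 0 < s) (hN : 0 < N) {V : 𝔼 → ℝ} (hVc : Continuous V)
    {c ρ₁ : ℝ} (hc : 0 < c) (hρ₁ : 1 ≤ ρ₁)
    (hV : ∀ x : 𝔼, ρ₁ ≤ ‖x‖ → c * ‖x‖ ^ (-(2 * s)) ≤ V x) {Λ : Set 𝔼} (hΛ : IsOpen Λ)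
    (h0 : (0 : 𝔼) ∈ Λ) {σ t τ : ℝ} (hσ : 2 * s < σ) (ht : 2 * s < t) (hτ : 0 < τ) :
    ∀ᶠ ε in 𝓝[>] (0 : ℝ), CondP2 ε s τ V (penalization Λ σ t ε) := by
  obtain ⟨r, hr, hΛr⟩ := exists_norm_ge_of_notMem hΛ h0
  have hVpos : ∀ x, ρ₁ ≤ ‖x‖ → 0 < V x := fun x hx =>
    lt_of_lt_of_le (mul_pos hc (Real.rpow_pos_of_pos (by linarith) _)) (hV x hx)
  obtain ⟨K, hK, hP⟩ := exists_poincare (s := s) hs hN hVc hVpos ρ₁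
  have hrt : 0 < r ^ t := Real.rpow_pos_of_pos hr t
  set Q := 1 / c + K / r ^ t with hQ
  have hQ0 : 0 < Q := by positivity
  have h1 : Tendsto (fun ε : ℝ => ε ^ (σ - 2 * s)) (𝓝[>] 0) (𝓝 0) := by
    have := (Real.continuousAt_rpow_const 0 (σ - 2 * s) (Or.inr (by linarith))).tendsto
    rw [Real.zero_rpow (by linarith)] at this
    exact this.mono_left nhdsWithin_le_nhds
  filter_upwards [h1.eventually (gt_mem_nhds (div_pos hτ hQ0)), self_mem_nhdsWithin,
    Ioo_mem_nhdsGT (one_pos : (0 : ℝ) < 1)] with ε hε hε0 hε1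
  rw [mem_Ioi] at hε0
  rw [lt_div_iff₀ hQ0] at hε
  have hεσ : ε ^ σ * Q ≤ τ * ε ^ (2 * s) := by
    have e : ε ^ σ = ε ^ (σ - 2 * s) * ε ^ (2 * s) := by
      rw [← Real.rpow_add hε0]; congr 1; ring
    rw [e]
    have : 0 < ε ^ (2 * s) := Real.rpow_pos_of_pos hε0 _
    nlinarith
  have hε2 : ε ^ (2 * s) ≤ 1 := Real.rpow_le_one hε0.le hε1.2.le (by linarith)
  have hεσ0 : 0 < ε ^ σ := Real.rpow_pos_of_pos hε0 _
  intro φ hφ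
  have e := hφ.1.ae_eq_mk
  set u := hφ.1.mk φ with hu
  have hum : Measurable u := hφ.1.stronglyMeasurable_mk.measurable
  rw [normSqHsV, weightedSq_congr e, weightedSq_congr (w := V) e, gagliardo_congr e]
  have hnear : ∫⁻ x in Metric.ball 0 ρ₁, ENNReal.ofReal (penalization Λ σ t ε x * u x ^ 2) ≤
      ENNReal.ofReal (ε ^ σ / r ^ t * K) * (gagliardo s u + weightedSq V u) := by
    calc _ ≤ ∫⁻ x in Metric.ball 0 ρ₁, ENNReal.ofReal (ε ^ σ / r ^ t) * ENNReal.ofReal (u x ^ 2) := by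
          refine lintegral_mono fun x => ?_
          rw [← ENNReal.ofReal_mul (by positivity)]
          exact ENNReal.ofReal_le_ofReal (mul_le_mul_of_nonneg_right
            (penalization_le hε0.le (by linarith) hr hΛr x) (sq_nonneg _))
      _ = ENNReal.ofReal (ε ^ σ / r ^ t) * ∫⁻ x in Metric.ball 0 ρ₁, ENNReal.ofReal (u x ^ 2) :=
          lintegral_const_mul _ (hum.pow_const 2).ennreal_ofReal
      _ ≤ _ := by
          rw [ENNReal.ofReal_mul (by positivity), mul_assoc]
          exact mul_le_mul_right (hP u hum) _
  have hfar : ∫⁻ x in (Metric.ball 0 ρ₁)ᶜ, ENNReal.ofReal (penalization Λ σ t ε x * u x ^ 2) ≤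
      ENNReal.ofReal (ε ^ σ / c) * (gagliardo s u + weightedSq V u) := by
    calc _ ≤ ∫⁻ x in (Metric.ball 0 ρ₁)ᶜ, ENNReal.ofReal (ε ^ σ / c) *
            ENNReal.ofReal (V x * u x ^ 2) := by
          refine setLIntegral_mono' Metric.isOpen_ball.measurableSet.compl fun x hx => ?_
          rw [mem_compl_iff, mem_ball_zero_iff, not_lt] at hx
          rw [← ENNReal.ofReal_mul (by positivity), ← mul_assoc]
          refine ENNReal.ofReal_le_ofReal (mul_le_mul_of_nonneg_right
            ((penalization_le_mul_potential hε0.le hc hρ₁ hV hx).trans ?_) (sq_nonneg _))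
          refine mul_le_mul_of_nonneg_right ?_ (hVpos x hx).le
          exact mul_le_of_le_one_right (by positivity)
            (Real.rpow_le_one_of_one_le_of_nonpos (hρ₁.trans hx) (by linarith))
      _ = ENNReal.ofReal (ε ^ σ / c) *
            ∫⁻ x in (Metric.ball 0 ρ₁)ᶜ, ENNReal.ofReal (V x * u x ^ 2) :=
          lintegral_const_mul _ (hVc.measurable.mul (hum.pow_const 2)).ennreal_ofReal
      _ ≤ _ := mul_le_mul_right ((setLIntegral_le_lintegral _ _).trans le_add_self) _
  calc weightedSq (penalization Λ σ t ε) u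
      ≤ ENNReal.ofReal (ε ^ σ / r ^ t * K) * (gagliardo s u + weightedSq V u) +
        ENNReal.ofReal (ε ^ σ / c) * (gagliardo s u + weightedSq V u) := by
        rw [weightedSq, ← lintegral_add_compl _
          (Metric.isOpen_ball (x := (0 : 𝔼)) (ε := ρ₁)).measurableSet]
        exact add_le_add hnear hfar
    _ = ENNReal.ofReal (ε ^ σ * Q) * (gagliardo s u + weightedSq V u) := by
        rw [← add_mul, ← ENNReal.ofReal_add (by positivity) (by positivity)]
        congr 2
        rw [hQ]; ring
    _ ≤ ENNReal.ofReal τ * (ENNReal.ofReal (ε ^ (2 * s)) * (gagliardo s u + weightedSq V u)) := by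
        rw [← mul_assoc, ← ENNReal.ofReal_mul hτ.le]
        exact mul_le_mul_left (ENNReal.ofReal_le_ofReal hεσ) _
    _ ≤ _ := by
        refine mul_le_mul_right ?_ _
        rw [mul_add]
        refine add_le_add le_rfl ?_
        calc _ ≤ 1 * weightedSq V u :=
              mul_le_mul_left (by simpa using ENNReal.ofReal_le_ofReal hε2) _
          _ = _ := one_mul _

/-! ### Behaviour under rescaling and translation -/

theorem lintegral_affine {E : Type*} [NormedAddCommGroup E] [NormedSpace ℝ E]
    [FiniteDimensional ℝ E] [MeasurableSpace E] [BorelSpace E] (μ : Measure E)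
    [μ.IsAddHaarMeasure] {ε : ℝ} (hε : 0 < ε) (a : E) (g : E → ℝ≥0∞) :
    ∫⁻ x, g (ε⁻¹ • (x - a)) ∂μ =
      ENNReal.ofReal (((ε⁻¹) ^ Module.finrank ℝ E)⁻¹) * ∫⁻ z, g z ∂μ := by
  rw [lintegral_sub_right_eq_self (fun x => g (ε⁻¹ • x)) a,
    lintegral_comp_smul_euclidean μ (inv_pos.2 hε) g]

theorem gagliardo_affine_lt_top {v : 𝔼 → ℝ} (hv : gagliardo s v < ∞) {ε : ℝ} (hε : 0 < ε) (a : 𝔼)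
    (M : ℝ) : gagliardo s (fun x => M * v (ε⁻¹ • (x - a))) < ∞ := by
  have e : ∀ z : 𝔼 × 𝔼, ENNReal.ofReal ((M * v (ε⁻¹ • (z.1 - a)) - M * v (ε⁻¹ • (z.2 - a))) ^ 2 /
        ‖z.1 - z.2‖ ^ ((N : ℝ) + 2 * s)) =
      ENNReal.ofReal (M ^ 2 * (ε⁻¹) ^ ((N : ℝ) + 2 * s)) *
        (fun z : 𝔼 × 𝔼 => ENNReal.ofReal ((v z.1 - v z.2) ^ 2 / ‖z.1 - z.2‖ ^ ((N : ℝ) + 2 * s)))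
          (ε⁻¹ • (z - (a, a))) := fun z => by
    rw [← ENNReal.ofReal_mul (by positivity)]
    congr 1
    have h1 : (ε⁻¹ • (z - (a, a))).1 - (ε⁻¹ • (z - (a, a))).2 = ε⁻¹ • (z.1 - z.2) := by
      simp [smul_sub]
    have h2 : 0 < ε⁻¹ := inv_pos.2 hε
    have h3 : 0 < (ε⁻¹) ^ ((N : ℝ) + 2 * s) := Real.rpow_pos_of_pos h2 _
    rw [h1, norm_smul, Real.norm_of_nonneg h2.le, Real.mul_rpow h2.le (norm_nonneg _)]
    simp only [Prod.smul_fst, Prod.smul_snd, Prod.fst_sub, Prod.snd_sub]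
    rw [← mul_sub, mul_pow]
    set X := (v (ε⁻¹ • (z.1 - a)) - v (ε⁻¹ • (z.2 - a))) ^ 2
    rw [mul_assoc, ← mul_div_assoc, mul_div_mul_left _ _ h3.ne', mul_div_assoc]
  have : (volume : Measure (𝔼 × 𝔼)).IsAddHaarMeasure := by
    rw [Measure.volume_eq_prod]; infer_instance
  rw [gagliardo, lintegral_congr e, lintegral_const_mul' _ _ ENNReal.ofReal_ne_top,
    lintegral_affine volume hε (g := fun z : 𝔼 × 𝔼 =>
      ENNReal.ofReal ((v z.1 - v z.2) ^ 2 / ‖z.1 - z.2‖ ^ ((N : ℝ) + 2 * s)))]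
  exact ENNReal.mul_lt_top ENNReal.ofReal_lt_top (ENNReal.mul_lt_top ENNReal.ofReal_lt_top hv)

theorem weightedSq_affine_lt_top {V v : 𝔼 → ℝ} {ε : ℝ} (hε : 0 < ε) (a : 𝔼)
    (hv : weightedSq (fun z => V (a + ε • z)) v < ∞) (M : ℝ) :
    weightedSq V (fun x => M * v (ε⁻¹ • (x - a))) < ∞ := by
  have e : ∀ x : 𝔼, ENNReal.ofReal (V x * (M * v (ε⁻¹ • (x - a))) ^ 2) =
      ENNReal.ofReal (M ^ 2) *
        (fun z : 𝔼 => ENNReal.ofReal (V (a + ε • z) * v z ^ 2)) (ε⁻¹ • (x - a)) := fun x => by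
    rw [← ENNReal.ofReal_mul (by positivity)]
    congr 1
    rw [smul_inv_smul₀ hε.ne', add_sub_cancel]
    ring
  rw [weightedSq, lintegral_congr e, lintegral_const_mul' _ _ ENNReal.ofReal_ne_top,
    lintegral_affine volume hε (g := fun z : 𝔼 => ENNReal.ofReal (V (a + ε • z) * v z ^ 2))]
  exact ENNReal.mul_lt_top ENNReal.ofReal_lt_top (ENNReal.mul_lt_top ENNReal.ofReal_lt_top hv)

theorem HasFracLaplacian.affine {v : 𝔼 → ℝ} {ε ℓ : ℝ} (hε : 0 < ε) {a x : 𝔼}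
    (h : HasFracLaplacian s v (ε⁻¹ • (x - a)) ℓ) :
    HasFracLaplacian s (fun y => v (ε⁻¹ • (y - a))) x (ε ^ (-(2 * s)) * ℓ) := by
  set z := ε⁻¹ • (x - a) with hz
  have h2 : 0 < ε⁻¹ := inv_pos.2 hε
  set κ := (N : ℝ) + 2 * s with hκ
  have h3 : 0 < (ε⁻¹) ^ κ := Real.rpow_pos_of_pos h2 _
  set G : ℝ → 𝔼 → ℝ := fun ρ =>
    (Metric.ball z ρ)ᶜ.indicator fun y => (v z - v y) / ‖z - y‖ ^ κ with hG
  have e : ∀ r, (Metric.ball x r)ᶜ.indicator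
      (fun y => (v z - v (ε⁻¹ • (y - a))) / ‖x - y‖ ^ κ) =
      fun y => (ε⁻¹) ^ κ * G (ε⁻¹ * r) (ε⁻¹ • (y - a)) := fun r => by
    funext y
    have hd : ‖z - ε⁻¹ • (y - a)‖ = ε⁻¹ * ‖x - y‖ := by
      rw [hz, ← smul_sub, sub_sub_sub_cancel_right, norm_smul, Real.norm_of_nonneg h2.le]
    by_cases hy : y ∈ (Metric.ball x r)ᶜ
    · have hy' : ε⁻¹ • (y - a) ∈ (Metric.ball z (ε⁻¹ * r))ᶜ := by
        rw [mem_compl_iff, Metric.mem_ball, dist_comm, dist_eq_norm] at hy ⊢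
        rw [hd]
        exact fun hc => hy (lt_of_mul_lt_mul_left hc h2.le)
      rw [indicator_of_mem hy, hG]
      beta_reduce
      rw [indicator_of_mem hy', hd, Real.mul_rpow h2.le (norm_nonneg _)]
      field_simp
    · have hy' : ε⁻¹ • (y - a) ∉ (Metric.ball z (ε⁻¹ * r))ᶜ := by
        rw [mem_compl_iff, not_not, Metric.mem_ball, dist_comm, dist_eq_norm] at hy ⊢
        rw [hd]
        exact mul_lt_mul_of_pos_left hy h2
      rw [indicator_of_notMem hy, hG]
      beta_reduce
      rw [indicator_of_notMem hy', mul_zero]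
  have hball : ∀ r, MeasurableSet (Metric.ball x r)ᶜ := fun r =>
    Metric.isOpen_ball.measurableSet.compl
  have hball' : ∀ r, MeasurableSet (Metric.ball z r)ᶜ := fun r =>
    Metric.isOpen_ball.measurableSet.compl
  refine ⟨fun r hr => ?_, ?_⟩
  · beta_reduce
    rw [← integrable_indicator_iff (hball r), e r]
    have h1 := (integrable_indicator_iff (hball' _)).2 (h.1 (ε⁻¹ * r) (mul_pos h2 hr))
    exact ((h1.comp_smul h2.ne').comp_sub_right a).const_mul _
  · have hlim : Tendsto (fun r : ℝ => ε⁻¹ * r) (𝓝[>] 0) (𝓝[>] 0) := by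
      refine tendsto_nhdsWithin_iff.2 ⟨?_, ?_⟩
      · have : Tendsto (fun r : ℝ => ε⁻¹ * r) (𝓝 0) (𝓝 (ε⁻¹ * 0)) := tendsto_id.const_mul _
        rw [mul_zero] at this
        exact this.mono_left nhdsWithin_le_nhds
      · filter_upwards [self_mem_nhdsWithin] with r hr
        exact mul_pos h2 hr
    refine ((h.2.comp hlim).const_mul (ε ^ (-(2 * s)))).congr fun r => ?_
    beta_reduce
    rw [Function.comp, ← integral_indicator (hball r), e r, integral_const_mul,
      integral_sub_right_eq_self (fun y => G (ε⁻¹ * r) (ε⁻¹ • y)) a,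
      Measure.integral_comp_inv_smul_of_nonneg _ _ hε.le, ← integral_indicator (hball' _),
      smul_eq_mul, ← mul_assoc, finrank_euclideanSpace_fin]
    congr 1
    rw [Real.inv_rpow hε.le, ← Real.rpow_neg hε.le, ← Real.rpow_natCast, ← Real.rpow_add hε]
    congr 1
    rw [hκ]; ring

theorem isC11_of_contDiff {u : 𝔼 → ℝ} (hu : ContDiff ℝ 2 u) : IsC11 u :=
  ⟨hu.of_le (by norm_num),
    (hu.fderiv_right (m := 1) (by norm_num)).locallyLipschitz⟩

theorem IsUniformC11.affine {v : 𝔼 → ℝ} (hv : IsUniformC11 v) {ε : ℝ} (hε : 0 < ε) (a : 𝔼)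
    {M : ℝ} (hM : 0 ≤ M) : IsUniformC11 fun x => M * v (ε⁻¹ • (x - a)) := by
  obtain ⟨h1, ⟨C, hC⟩, K, hK⟩ := hv
  have h2 : 0 < ε⁻¹ := inv_pos.2 hε
  have hd : ∀ x, fderiv ℝ (fun x => M * v (ε⁻¹ • (x - a))) x =
      (M * ε⁻¹) • fderiv ℝ v (ε⁻¹ • (x - a)) := fun x => by
    have hw := (h1.differentiable (by norm_num) (ε⁻¹ • (x - a))).hasFDerivAt
    have hl : HasFDerivAt (fun x : 𝔼 => ε⁻¹ • (x - a)) (ε⁻¹ • ContinuousLinearMap.id ℝ 𝔼) x :=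
      ((hasFDerivAt_id x).sub_const a).const_smul ε⁻¹
    have := ((hw.comp x hl).const_mul M).fderiv
    refine Eq.trans this ?_
    ext y
    simp [mul_assoc]
  have hC0 : 0 ≤ C := (abs_nonneg _).trans (hC 0).1
  refine ⟨contDiff_const.mul (h1.comp ((contDiff_id.sub contDiff_const).const_smul ε⁻¹)),
    ⟨max (M * C) (M * ε⁻¹ * C), fun x => ⟨?_, ?_⟩⟩,
    ⟨Real.toNNReal (M * ε⁻¹) * (K * Real.toNNReal ε⁻¹), ?_⟩⟩
  · refine le_trans ?_ (le_max_left _ _)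
    rw [abs_mul, abs_of_nonneg hM]
    exact mul_le_mul_of_nonneg_left (hC _).1 hM
  · refine le_trans ?_ (le_max_right _ _)
    rw [hd, norm_smul, Real.norm_of_nonneg (by positivity)]
    exact mul_le_mul_of_nonneg_left (hC _).2 (by positivity)
  · refine LipschitzWith.of_dist_le_mul fun x y => ?_
    rw [hd, hd, dist_eq_norm, ← smul_sub, norm_smul, Real.norm_of_nonneg (by positivity),
      ← dist_eq_norm]
    have := hK.dist_le_mul (ε⁻¹ • (x - a)) (ε⁻¹ • (y - a))
    rw [dist_smul₀, Real.norm_of_nonneg h2.le, dist_sub_right] at this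
    push_cast
    rw [Real.coe_toNNReal _ (by positivity), Real.coe_toNNReal _ h2.le, mul_assoc (M * ε⁻¹),
      mul_assoc (K : ℝ)]
    exact mul_le_mul_of_nonneg_left this (mul_nonneg hM h2.le)

/-! ### The barrier functions -/

theorem weightedSq_mono {w u v : 𝔼 → ℝ} (hw : ∀ x, 0 ≤ w x) (h : ∀ x, |u x| ≤ |v x|) :
    weightedSq w u ≤ weightedSq w v :=
  lintegral_mono fun x => ENNReal.ofReal_le_ofReal
    (mul_le_mul_of_nonneg_left (sq_le_sq.2 (h x)) (hw x))

theorem weightedSq_rpow_le {V : 𝔼 → ℝ} (hV0 : ∀ x, 0 ≤ V x) {α μ : ℝ} (h : μ ≤ α) :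
    weightedSq V (fun x => (1 + ‖x‖) ^ (-α)) ≤ weightedSq V (fun x => (1 + ‖x‖) ^ (-μ)) := by
  refine weightedSq_mono hV0 fun x => ?_
  have h1 : 1 ≤ 1 + ‖x‖ := by linarith [norm_nonneg x]
  rw [abs_of_nonneg (by positivity), abs_of_nonneg (by positivity)]
  exact Real.rpow_le_rpow_of_exponent_le h1 (by linarith)

theorem weightedSq_rpow_comp_affine_lt_top {V : 𝔼 → ℝ} (hV0 : ∀ x, 0 ≤ V x) {α : ℝ} (hα : 0 ≤ α)
    (h : weightedSq V (fun x => (1 + ‖x‖) ^ (-α)) < ∞) {ε : ℝ} (hε : 0 < ε) (a : 𝔼) :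
    weightedSq (fun z => V (a + ε • z)) (fun z => (1 + ‖z‖) ^ (-α)) < ∞ := by
  have hb : ∀ z : 𝔼, a + ε • (-(ε⁻¹ • a) + ε⁻¹ • z) = z := fun z => by
    rw [smul_add, smul_neg, smul_inv_smul₀ hε.ne', smul_inv_smul₀ hε.ne']; abel
  have h1 := weightedSq_affine_lt_top (V := fun z => V (a + ε • z))
    (v := fun x : 𝔼 => (1 + ‖x‖) ^ (-α)) (inv_pos.2 hε) (-(ε⁻¹ • a)) (by simp_rw [hb]; exact h)
    ((1 + ‖a‖ + ε) ^ α)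
  refine lt_of_le_of_lt (weightedSq_mono (fun z => hV0 _) fun z => ?_) h1
  have e : (ε⁻¹)⁻¹ • (z - -(ε⁻¹ • a)) = a + ε • z := by
    rw [inv_inv, sub_neg_eq_add, smul_add, smul_inv_smul₀ hε.ne', add_comm]
  rw [e, abs_of_nonneg (by positivity), abs_of_nonneg (by positivity)]
  have hB : 0 < 1 + ‖a‖ + ε := by positivity
  have h2 : 1 + ‖a + ε • z‖ ≤ (1 + ‖a‖ + ε) * (1 + ‖z‖) := by
    have h3 : ‖a + ε • z‖ ≤ ‖a‖ + ε * ‖z‖ := by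
      refine (norm_add_le _ _).trans ?_
      rw [norm_smul, Real.norm_of_nonneg hε.le]
    nlinarith [mul_nonneg (norm_nonneg a) (norm_nonneg z), norm_nonneg z]
  calc (1 + ‖z‖) ^ (-α) = (1 + ‖a‖ + ε) ^ α * ((1 + ‖a‖ + ε) * (1 + ‖z‖)) ^ (-α) := by
        rw [Real.mul_rpow hB.le (by positivity), ← mul_assoc, ← Real.rpow_add hB, add_neg_cancel,
          Real.rpow_zero, one_mul]
    _ ≤ _ := mul_le_mul_of_nonneg_left
        (Real.rpow_le_rpow_of_nonpos (by positivity) h2 (by linarith)) (by positivity)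

/-- Positive profiles of order `(1 + |x|)^(-α)` which are supersolutions for `(-Δ)^s + a V`, with
constants that depend neither on `V` nor on `a`. If the power `(1 + |x|)^(-α)` is itself of finite
`V`-energy, the Riesz potential is such a profile; otherwise it has to be cut down far away, where
its size is left free. -/
theorem exists_barrier_profile (hs : s ∈ Ioo (0 : ℝ) 1) (hN : 2 * s < N) {α : ℝ}
    (hα : (N - 2 * s) / 2 < α) (hαN : α < N - 2 * s) :
    ∃ κ > 0, ∃ c > 0, ∃ C > 0, ∀ (V : 𝔼 → ℝ) (a R ρ₁ : ℝ), Continuous V → (∀ x, 0 ≤ V x) →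
      0 < a → (∀ x, ρ₁ ≤ ‖x‖ → 0 < V x) →
      ∃ U : 𝔼 → ℝ, ContDiff ℝ 2 U ∧ (∀ x, 0 < U x) ∧ (∀ x, U x ≤ C * (1 + ‖x‖) ^ (-α)) ∧
        (∀ x, ‖x‖ ≤ R → c * (1 + ‖x‖) ^ (-α) ≤ U x) ∧ gagliardo s U < ∞ ∧ weightedSq V U < ∞ ∧
        (weightedSq V (fun x => (1 + ‖x‖) ^ (-α)) < ∞ → IsUniformC11 U) ∧
        ∀ x, ∃ ℓ, HasFracLaplacian s U x ℓ ∧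
          κ * (1 + ‖x‖) ^ (-(2 * s)) * U x ≤ ℓ + a * V x * U x := by
  have hα0 : 0 < α := by linarith
  obtain ⟨f, w, c, C, h, hw⟩ := exists_base hs hα0 hαN
  have hc := h.c_pos
  have hC := h.C_pos
  have hF : 0 < fracConst N s := fracConst_pos hs hN
  refine ⟨fracConst N s * c / (2 * C), by positivity, c, hc, C, hC,
    fun V a R ρ₁ hVc hV0 ha hVpos => ?_⟩
  by_cases hfin : weightedSq V (fun x => (1 + ‖x‖) ^ (-α)) < ∞
  · refine ⟨w, h.contDiff, h.pos, h.upper, fun x _ => h.lower x, h.gagliardo_lt_top hs hN hα,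
      ?_, fun _ => hw, fun x => ⟨_, h.isPotential.hasFracLaplacian hs hN h.contDiff x, ?_⟩⟩
    · have e : weightedSq V (fun x => C * (1 + ‖x‖) ^ (-α)) =
          ENNReal.ofReal (C ^ 2) * weightedSq V (fun x => (1 + ‖x‖) ^ (-α)) := by
        rw [weightedSq, weightedSq, ← lintegral_const_mul' _ _ ENNReal.ofReal_ne_top]
        refine lintegral_congr fun x => ?_
        rw [← ENNReal.ofReal_mul (by positivity)]
        congr 1; ring
      refine lt_of_le_of_lt (weightedSq_mono (v := fun x => C * (1 + ‖x‖) ^ (-α)) hV0 fun x => ?_)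
        (e ▸ ENNReal.mul_lt_top ENNReal.ofReal_lt_top hfin)
      rw [abs_of_pos (h.pos x)]
      exact (h.upper x).trans (le_abs_self _)
    · have h1 := h.density_ratio x
      have h2 := mul_le_mul_of_nonneg_left h1 hF.le
      have h3 : 0 ≤ a * V x * w x := mul_nonneg (mul_nonneg ha.le (hV0 x)) (h.pos x).le
      have h4 : 0 ≤ fracConst N s * (c / C * (1 + ‖x‖) ^ (-(2 * s)) * w x) :=
        mul_nonneg hF.le (mul_nonneg (by positivity) (h.pos x).le)
      have h5 : fracConst N s * c / (2 * C) * (1 + ‖x‖) ^ (-(2 * s)) * w x =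
          fracConst N s * (c / C * (1 + ‖x‖) ^ (-(2 * s)) * w x) / 2 := by ring
      linarith
  · obtain ⟨U, h1, h2, h3, h4, h5, h6, h7⟩ :=
      h.exists_supersolution hs hN hα hαN hVc hV0 ha (R := R) hVpos
    exact ⟨U, h1, h2, fun x => (h3 x).trans (h.upper x), fun x hx => (h4 x hx) ▸ h.lower x, h5, h6,
      fun hc => absurd hc hfin, h7⟩

theorem eventually_mul_rpow_lt (A : ℝ) {b t : ℝ} (h : t < b) :
    ∀ᶠ X : ℝ in atTop, A * X ^ (-b) < X ^ (-t) := by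
  have h1 : Tendsto (fun X : ℝ => A * X ^ (-(b - t))) atTop (𝓝 0) := by
    simpa using (tendsto_rpow_neg_atTop (sub_pos.2 h)).const_mul A
  filter_upwards [h1.eventually (gt_mem_nhds one_pos), eventually_gt_atTop 0] with X hX hX0
  have e : X ^ (-b) = X ^ (-(b - t)) * X ^ (-t) := by
    rw [← Real.rpow_add hX0]; congr 1; ring
  rw [e, ← mul_assoc]
  exact mul_lt_of_lt_one_left (Real.rpow_pos_of_pos hX0 _) hX

/-- Points that stay away from the boundary of a bounded set see the complement of this set at a
distance comparable with the norm. -/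
theorem exists_mul_norm_le_of_liminf_pos {ι : Type*} {l : Filter ι} {Λ : Set 𝔼}
    (hΛ : IsOpen Λ) (hΛb : Bornology.IsBounded Λ) {xc : ι → 𝔼} (hxc : ∀ᶠ i in l, xc i ∈ Λ)
    (hd : 0 < liminf (fun i => Metric.infEDist (xc i) (frontier Λ)) l) :
    ∃ c > 0, ∀ᶠ i in l, ∀ x ∉ Λ, c * ‖x‖ ≤ ‖x - xc i‖ := by
  obtain ⟨b, hb0, hb⟩ := exists_between hd
  have h1 := eventually_lt_of_lt_liminf hb
  have hbtop : b ≠ ∞ := hb.ne_top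
  have hd0 : 0 < b.toReal := ENNReal.toReal_pos hb0.ne' hbtop
  set d := b.toReal with hdd
  obtain ⟨ρ, hρ0, hρ⟩ := hΛb.subset_ball_lt 0 0
  refine ⟨(1 + ρ / d)⁻¹, by positivity, ?_⟩
  filter_upwards [h1, hxc] with i hi hxi x hx
  have hfr : d ≤ ‖x - xc i‖ := by
    obtain ⟨y, hy, hyf⟩ : ∃ y ∈ segment ℝ (xc i) x, y ∈ frontier Λ := by
      by_contra! hno
      have hcov : segment ℝ (xc i) x ⊆ Λ ∪ (closure Λ)ᶜ := fun y hy => by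
        by_contra hc
        rw [mem_union, not_or, mem_compl_iff, not_not] at hc
        exact hno y hy ⟨hc.2, by rw [hΛ.interior_eq]; exact hc.1⟩
      obtain ⟨z, -, hz⟩ := (convex_segment (𝕜 := ℝ) (xc i) x).isPreconnected _ _ hΛ
        isClosed_closure.isOpen_compl hcov ⟨xc i, left_mem_segment ℝ _ _, hxi⟩
        ⟨x, right_mem_segment ℝ _ _, (hcov (right_mem_segment ℝ _ _)).resolve_left hx⟩
      exact hz.2 (subset_closure hz.1)
    have h2 : b < edist (xc i) y := lt_of_lt_of_le hi (Metric.infEDist_le_edist_of_mem hyf)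
    have h3 : dist (xc i) y ≤ dist (xc i) x := by
      have := dist_add_dist_of_mem_segment hy
      linarith [dist_nonneg (x := y) (y := x)]
    have h4 : d ≤ dist (xc i) y := by
      rw [edist_dist] at h2
      exact (ENNReal.le_ofReal_iff_toReal_le hbtop dist_nonneg).1 h2.le
    rw [norm_sub_rev, ← dist_eq_norm]
    exact h4.trans h3
  have h5 : ‖xc i‖ < ρ := mem_ball_zero_iff.1 (hρ hxi)
  have h6 : ‖x‖ ≤ ‖x - xc i‖ + ‖xc i‖ := by
    have := norm_add_le (x - xc i) (xc i)
    rwa [sub_add_cancel] at this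
  rw [inv_mul_le_iff₀ (by positivity)]
  have h7 : ρ ≤ ρ / d * ‖x - xc i‖ := by
    rw [div_mul_eq_mul_div, le_div_iff₀ hd0]
    exact mul_le_mul_of_nonneg_left hfr hρ0.le
  linarith

/-- At each scale `ε` the barrier is the profile for the rescaled potential, transplanted to
`x_ε`. In terms of `X = |x| / ε`, which is large uniformly off `Λ` as `ε → 0`, the penalization with
`σ = t` is `X^(-t)`. The two inequalities to be checked there compare this power with `X^(-2s)` and
with `X^(-α (p - 2))`. -/
theorem eventually_exists_barrier (hs : s ∈ Ioo (0 : ℝ) 1) (hN : 2 * s < N) {α p t : ℝ}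
    (hα : (N - 2 * s) / 2 < α) (hαN : α < N - 2 * s) (hp : 2 < p) (ht : 2 * s < t)
    (hαp : t < α * (p - 2)) {V : 𝔼 → ℝ} (hVc : Continuous V) (hV0 : ∀ x, 0 ≤ V x) {ρ₁ : ℝ}
    (hVpos : ∀ x, ρ₁ ≤ ‖x‖ → 0 < V x) {Λ : Set 𝔼} (hΛ : IsOpen Λ) (hΛb : Bornology.IsBounded Λ)
    (h0 : (0 : 𝔼) ∈ Λ) {δ R Cinf : ℝ} {xc : ℝ → 𝔼} (hδ : δ < 1) (hR : 0 < R) (hCinf : 0 < Cinf)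
    (hxc : ∀ᶠ ε in 𝓝[>] (0 : ℝ), xc ε ∈ Λ)
    (hd : 0 < liminf (fun ε => Metric.infEDist (xc ε) (frontier Λ)) (𝓝[>] (0 : ℝ))) :
    ∀ᶠ ε in 𝓝[>] (0 : ℝ), ∃ U : 𝔼 → ℝ, MemHsV s V U ∧ IsC11 U ∧
      (weightedSq V (fun x => (1 + ‖x‖) ^ (-α)) < ∞ → IsUniformC11 U) ∧ (∀ x, 0 < U x) ∧
      (∀ x, ∃ ℓ, HasFracLaplacian s U x ℓ ∧
        penalization Λ t t ε x * U x ≤ ε ^ (2 * s) * ℓ + (1 - δ) * V x * U x) ∧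
      (∀ x ∈ Metric.ball (xc ε) (R * ε), Cinf ≤ U x) ∧
      ∀ x ∉ Λ, U x ^ (p - 2) < penalization Λ t t ε x := by
  have hs0 := hs.1
  have hα0 : 0 < α := by linarith
  obtain ⟨κ, hκ, c, hc, C, hC, hprof⟩ := exists_barrier_profile hs hN hα hαN
  obtain ⟨r, hr, hΛr⟩ := exists_norm_ge_of_notMem hΛ h0
  obtain ⟨ρ, hρ0, hρ⟩ := hΛb.subset_ball_lt 0 0
  obtain ⟨c₁, hc₁, hfar⟩ := exists_mul_norm_le_of_liminf_pos hΛ hΛb hxc hd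
  set M := Cinf * (1 + R) ^ α / c with hM
  have hM0 : 0 < M := by positivity
  set B := 2 + ρ / r with hB
  have hB0 : 0 < B := by positivity
  obtain ⟨X₀, hX₀⟩ := eventually_atTop.1
    ((eventually_mul_rpow_lt ((κ * B ^ (-(2 * s)))⁻¹) ht).and
      ((eventually_mul_rpow_lt ((M * (C * c₁ ^ (-α))) ^ (p - 2)) hαp).and (eventually_ge_atTop 1)))
  have hlim : ∀ᶠ ε in 𝓝[>] (0 : ℝ), max X₀ 1 ≤ r / ε := by
    have : Tendsto (fun ε : ℝ => r * ε⁻¹) (𝓝[>] 0) atTop :=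
      tendsto_inv_nhdsGT_zero.const_mul_atTop hr
    exact this.eventually_ge_atTop _
  filter_upwards [hlim, hfar, hxc, self_mem_nhdsWithin] with ε hεX hfarε hxcε hε
  rw [mem_Ioi] at hε
  have hεi : 0 < ε⁻¹ := inv_pos.2 hε
  set a := xc ε with ha
  obtain ⟨v, hv2, hvpos, hvC, hvc, hvg, hvV, hvU, hvL⟩ := hprof (fun z => V (a + ε • z)) (1 - δ) R
    ((ρ₁ + ‖a‖) / ε) (by fun_prop) (fun z => hV0 _) (by linarith) fun z hz => by
      refine hVpos _ ?_
      rw [div_le_iff₀ hε] at hz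
      have h1 : ‖ε • z‖ = ‖z‖ * ε := by
        rw [norm_smul, Real.norm_of_nonneg hε.le, mul_comm]
      have h2 := norm_sub_norm_le (ε • z) (-a)
      rw [norm_neg, sub_neg_eq_add, add_comm (ε • z)] at h2
      linarith
  have hU2 : ContDiff ℝ 2 fun x => M * v (ε⁻¹ • (x - a)) :=
    contDiff_const.mul (hv2.comp ((contDiff_id.sub contDiff_const).const_smul ε⁻¹))
  have hnorm : ∀ x, ‖ε⁻¹ • (x - a)‖ = ‖x - a‖ / ε := fun x => by
    rw [norm_smul, Real.norm_of_nonneg hεi.le, inv_mul_eq_div]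
  -- off `Λ`, the penalization and the size of `x - x_ε` in terms of `X = |x| / ε`
  have hX : ∀ x ∉ Λ, max X₀ 1 ≤ ‖x‖ / ε ∧ penalization Λ t t ε x = (‖x‖ / ε) ^ (-t) := fun x hx => by
    refine ⟨hεX.trans (div_le_div_of_nonneg_right (hΛr x hx) hε.le), ?_⟩
    rw [penalization_of_notMem hx, Real.rpow_neg (by positivity),
      Real.div_rpow (norm_nonneg _) hε.le, inv_div]
  have hpen : ∀ x, penalization Λ t t ε x ≤ κ * (1 + ‖ε⁻¹ • (x - a)‖) ^ (-(2 * s)) := fun x => by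
    by_cases hx : x ∈ Λ
    · rw [penalization_of_mem hx]; positivity
    · obtain ⟨h1, h2⟩ := hX x hx
      have hX1 : 1 ≤ ‖x‖ / ε := (le_max_right _ _).trans h1
      have h3 := (hX₀ _ ((le_max_left _ _).trans h1)).1
      have hκB : 0 < κ * B ^ (-(2 * s)) := by positivity
      rw [inv_mul_lt_iff₀ hκB] at h3
      rw [h2]
      refine h3.le.trans ?_
      rw [mul_assoc, ← Real.mul_rpow hB0.le (by positivity), hnorm]
      refine mul_le_mul_of_nonneg_left
        (Real.rpow_le_rpow_of_nonpos (by positivity) ?_ (by linarith)) hκ.le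
      have h4 : ‖x - a‖ ≤ ‖x‖ + ρ :=
        (norm_sub_le _ _).trans (add_le_add le_rfl (mem_ball_zero_iff.1 (hρ hxcε)).le)
      have h5 : ρ ≤ ρ / r * ‖x‖ := by
        rw [div_mul_eq_mul_div, le_div_iff₀ hr]
        exact mul_le_mul_of_nonneg_left (hΛr x hx) hρ0.le
      have h6 : ‖x - a‖ / ε ≤ (1 + ρ / r) * (‖x‖ / ε) := by
        rw [← mul_div_assoc]
        exact div_le_div_of_nonneg_right (by linarith) hε.le
      rw [hB]; linarith
  refine ⟨fun x => M * v (ε⁻¹ • (x - a)), ⟨hU2.continuous.aestronglyMeasurable,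
    gagliardo_affine_lt_top hvg hε a M, weightedSq_affine_lt_top hε a hvV M⟩,
    isC11_of_contDiff hU2,
    fun h => (hvU (weightedSq_rpow_comp_affine_lt_top hV0 hα0.le h hε a)).affine hε a hM0.le,
    fun x => mul_pos hM0 (hvpos _), fun x => ?_, fun x hx => ?_, fun x hx => ?_⟩
  · obtain ⟨ℓ, hℓ, hle⟩ := hvL (ε⁻¹ • (x - a))
    refine ⟨_, (hℓ.affine hε).const_mul M, ?_⟩
    rw [smul_inv_smul₀ hε.ne', add_sub_cancel] at hle
    have e : ε ^ (2 * s) * (M * (ε ^ (-(2 * s)) * ℓ)) = M * ℓ := by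
      have : ε ^ (2 * s) * ε ^ (-(2 * s)) = 1 := by
        rw [← Real.rpow_add hε, add_neg_cancel, Real.rpow_zero]
      linear_combination M * ℓ * this
    rw [e]
    have h1 := mul_le_mul_of_nonneg_left
      ((mul_le_mul_of_nonneg_right (hpen x) (hvpos (ε⁻¹ • (x - a))).le).trans hle) hM0.le
    linarith
  · rw [Metric.mem_ball, dist_eq_norm] at hx
    have hz : ‖ε⁻¹ • (x - a)‖ ≤ R := by
      rw [hnorm, div_le_iff₀ hε]; exact hx.le
    have h1 := hvc _ hz
    have h2 : (1 + R) ^ (-α) ≤ (1 + ‖ε⁻¹ • (x - a)‖) ^ (-α) :=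
      Real.rpow_le_rpow_of_nonpos (by positivity) (by linarith) (by linarith)
    calc Cinf = M * (c * (1 + R) ^ (-α)) := by
          rw [hM, Real.rpow_neg (by positivity)]
          field_simp
      _ ≤ _ := mul_le_mul_of_nonneg_left
          ((mul_le_mul_of_nonneg_left h2 hc.le).trans h1) hM0.le
  · obtain ⟨h1, h2⟩ := hX x hx
    have hX1 : 0 < ‖x‖ / ε := lt_of_lt_of_le one_pos ((le_max_right _ _).trans h1)
    have h3 := (hX₀ _ ((le_max_left _ _).trans h1)).2.1
    rw [h2]
    refine lt_of_le_of_lt ?_ h3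
    have h4 : c₁ * (‖x‖ / ε) ≤ 1 + ‖ε⁻¹ • (x - a)‖ := by
      rw [hnorm, ← mul_div_assoc]
      have := div_le_div_of_nonneg_right (hfarε x hx) hε.le
      linarith
    have h5 : v (ε⁻¹ • (x - a)) ≤ C * c₁ ^ (-α) * (‖x‖ / ε) ^ (-α) := by
      refine (hvC _).trans ?_
      rw [mul_assoc, ← Real.mul_rpow hc₁.le hX1.le]
      exact mul_le_mul_of_nonneg_left
        (Real.rpow_le_rpow_of_nonpos (by positivity) h4 (by linarith)) hC.le
    calc (M * v (ε⁻¹ • (x - a))) ^ (p - 2)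
        ≤ (M * (C * c₁ ^ (-α)) * (‖x‖ / ε) ^ (-α)) ^ (p - 2) := by
          refine Real.rpow_le_rpow (mul_pos hM0 (hvpos _)).le ?_ (by linarith)
          rw [mul_assoc]
          exact mul_le_mul_of_nonneg_left h5 hM0.le
      _ = (M * (C * c₁ ^ (-α))) ^ (p - 2) * (‖x‖ / ε) ^ (-(α * (p - 2))) := by
          rw [Real.mul_rpow (by positivity) (by positivity), ← Real.rpow_mul hX1.le, neg_mul]

end FracSchrodinger

end

theorem proposition4p5
    {N : ℕ} {s p : ℝ} (hs : s ∈ Ioo (0 : ℝ) 1) (hN : 2 * s < N)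
    (hp : p ∈ Ioo (2 + 2 * s / (N - 2 * s)) (2 * N / (N - 2 * s)))
    {V : EuclideanSpace ℝ (Fin N) → ℝ} (hVcont : Continuous V) (hVnonneg : ∀ x, 0 ≤ V x)
    (hVinf : 0 < liminf (fun x : EuclideanSpace ℝ (Fin N) => ENNReal.ofReal (V x * ‖x‖ ^ (2 * s)))
      (Bornology.cobounded (EuclideanSpace ℝ (Fin N))))
    {Λ : Set (EuclideanSpace ℝ (Fin N))} (hΛopen : IsOpen Λ) (hΛbdd : Bornology.IsBounded Λ)
    (hΛ0 : (0 : EuclideanSpace ℝ (Fin N)) ∈ Λ) :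
    ∃ σ t τ : ℝ, 0 < σ ∧ 2 * s < t ∧ t < (N - 2 * s) * (p - 2) ∧ τ ∈ Ioo (0 : ℝ) 1 ∧
      -- the penalization potential satisfies both structural conditions for small `ε`
      (∀ᶠ ε in 𝓝[>] (0 : ℝ),
        FracSchrodinger.CondP1 ε s V Λ (FracSchrodinger.penalization Λ σ t ε) ∧
        FracSchrodinger.CondP2 ε s τ V (FracSchrodinger.penalization Λ σ t ε)) ∧
      -- the barrier functions
      ∀ (δ R Cinf : ℝ) (xc : ℝ → EuclideanSpace ℝ (Fin N)),
        δ ∈ Ioo (0 : ℝ) 1 → 0 < R → 0 < Cinf →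
        (∀ᶠ ε in 𝓝[>] (0 : ℝ), xc ε ∈ Λ) →
        0 < liminf (fun ε => Metric.infEDist (xc ε) (frontier Λ)) (𝓝[>] (0 : ℝ)) →
        ∀ᶠ ε in 𝓝[>] (0 : ℝ), ∃ U : EuclideanSpace ℝ (Fin N) → ℝ,
          FracSchrodinger.MemHsV s V U ∧
          FracSchrodinger.IsC11 U ∧
          ((∃ μ : ℝ, μ < N - 2 * s ∧
              FracSchrodinger.weightedSq V
                (fun x : EuclideanSpace ℝ (Fin N) => (1 + ‖x‖) ^ (-μ)) < ∞) →
            FracSchrodinger.IsUniformC11 U) ∧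
          (∀ x, 0 < U x) ∧
          (∀ x ∉ Metric.ball (xc ε) (R * ε), ∃ ℓ : ℝ,
            FracSchrodinger.HasFracLaplacian s U x ℓ ∧
            FracSchrodinger.penalization Λ σ t ε x * U x
              ≤ ε ^ (2 * s) * ℓ + (1 - δ) * V x * U x) ∧
          (∀ x ∈ Metric.ball (xc ε) (R * ε), Cinf ≤ U x) ∧
          (∀ x ∉ Λ, U x ^ (p - 2) < FracSchrodinger.penalization Λ σ t ε x) := by
  have hs0 := hs.1
  set γ := (N : ℝ) - 2 * s with hγ
  have hγ0 : 0 < γ := by linarith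
  have hp2 : 2 < p := lt_of_le_of_lt (by linarith [div_pos (mul_pos two_pos hs0) hγ0]) hp.1
  have hp2' : 0 < p - 2 := by linarith
  have hγp : 2 * s < γ * (p - 2) := by
    have h1 : 2 * s / γ < p - 2 := by linarith [hp.1]
    rwa [div_lt_iff₀ hγ0, mul_comm (p - 2)] at h1
  obtain ⟨t, ht1, ht2⟩ := exists_between hγp
  obtain ⟨c, hc, ρ₁, hρ₁, hV⟩ := FracSchrodinger.exists_le_of_liminf_pos hVinf
  have hVpos : ∀ x, ρ₁ ≤ ‖x‖ → 0 < V x := fun x hx =>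
    lt_of_lt_of_le (mul_pos hc (Real.rpow_pos_of_pos (by linarith) _)) (hV x hx)
  have hN0 : 0 < N := FracSchrodinger.pos_dim hs0 hN
  refine ⟨t, t, 1 / 2, by linarith, ht1, ht2, by norm_num, ?_, ?_⟩
  · filter_upwards [FracSchrodinger.eventually_condP2_penalization hs0 hN0 hVcont hc hρ₁ hV hΛopen
      hΛ0 ht1 ht1 one_half_pos, self_mem_nhdsWithin] with ε h2 hε
    exact ⟨FracSchrodinger.condP1_penalization hs0 hN0 hVcont hVnonneg hc hρ₁ hV hΛopen hΛbdd hΛ0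
      ht1 hε, h2⟩
  · intro δ R Cinf xc hδ hR hCinf hxc hd
    -- an admissible exponent `μ` of the integrability condition, if there is one
    obtain ⟨μ, hμ, hμfin⟩ : ∃ μ : ℝ, μ < γ ∧ ((∃ μ : ℝ, μ < γ ∧
        FracSchrodinger.weightedSq V
          (fun x : EuclideanSpace ℝ (Fin N) => (1 + ‖x‖) ^ (-μ)) < ∞) →
        FracSchrodinger.weightedSq V
          (fun x : EuclideanSpace ℝ (Fin N) => (1 + ‖x‖) ^ (-μ)) < ∞) := by
      by_cases h : ∃ μ : ℝ, μ < γ ∧ FracSchrodinger.weightedSq V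
          (fun x : EuclideanSpace ℝ (Fin N) => (1 + ‖x‖) ^ (-μ)) < ∞
      · obtain ⟨μ, hμ, hfin⟩ := h
        exact ⟨μ, hμ, fun _ => hfin⟩
      · exact ⟨0, hγ0, fun hc => absurd hc h⟩
    obtain ⟨α, hα1, hα2⟩ := exists_between
      (max_lt (half_lt_self hγ0) (max_lt ((div_lt_iff₀ hp2').2 ht2) hμ))
    have hαγ : γ / 2 < α := (le_max_left _ _).trans_lt hα1
    have hαt : t / (p - 2) < α := ((le_max_left _ _).trans (le_max_right _ _)).trans_lt hα1
    have hαμ : μ < α := ((le_max_right _ _).trans (le_max_right _ _)).trans_lt hα1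
    filter_upwards [FracSchrodinger.eventually_exists_barrier hs hN hαγ hα2 hp2 ht1
      ((div_lt_iff₀ hp2').1 hαt) hVcont hVnonneg hVpos hΛopen hΛbdd hΛ0 hδ.2 hR hCinf hxc hd]
      with ε hε
    obtain ⟨U, h1, h2, h3, h4, h5, h6, h7⟩ := hε
    exact ⟨U, h1, h2, fun h => h3 ((FracSchrodinger.weightedSq_rpow_le hVnonneg hαμ.le).trans_lt
      (hμfin h)), h4, fun x _ => h5 x, h6, h7⟩
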